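/- For each $N\ge 1$ let $A,B$ be independent $N\times N$ random matrices whose $2N^2$ entries are i.i.d. standard complex Gaussian variables (independent real and imaginary parts with law $\mathcal N(0,\tfrac12)$). The spherical ensemble $\mathbf x_1,\dots,\mathbf x_N\in\mathbb S^2$ consists of the images of the $N$ eigenvalues $z$ of $A^{-1}B$, counted with multiplicity, under inverse stereographic projection $$z\mapsto\frac{1}{1+|z|^2}\bigl(2\operatorname{Re}z,\;2\operatorname{Im}z,\;|z|^2-1\bigr).$$ Let $\delta$ be either the chordal (Euclidean) or the geodesic distance on the unit sphere $\mathbb S^2\subset\mathbb R^3$, and for $s\ge 0$ put $$G_{s,N}(\mathbf x_1,\dots,\mathbf x_N)=\frac1N\,\#\Bigl\{(i,j):1\le i,j\le N,\ i\ne j,\ \delta(\mathbf x_i,\mathbf x_j)\,N^{1/2}\le s\Bigr\}.$$ Then $G_{s,N}(\mathbf x_1,\dots,\mathbf x_N)$ is integrable, and for every $s\ge 0$ $$\lim_{N\to\infty}\mathbb E\bigl[G_{s,N}(\mathbf x_1,\dots,\mathbf x_N)\bigr]=\frac{s^2}{4}-1+e^{-s^2/4}.$$ As a consequence, $$\lim_{N\to\infty}\mathbb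 E[G_{s,N}]=\frac{s^4}{32}+O(s^6)\quad\text{as } s\to0^+,\qquad \lim_{N\to\infty}\mathbb E[G_{s,N}]=\frac{s^2}{4}-1+O(s^{-2})\quad\text{as } s\to\infty.$$ -/

import Mathlib

noncomputable section

namespace SphericalEnsemble

open MeasureTheory ProbabilityTheory

/-- The unit sphere in Euclidean three-space; its metric `dist` is the chordal
(Euclidean) distance. -/
abbrev S2 : Type := Metric.sphere (0 : EuclideanSpace ℝ (Fin 3)) 1

/-- The geodesic distance on the unit sphere, with values in `[0, π]`. -/
def geodesicDist (p q : S2) : ℝ :=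
  InnerProductGeometry.angle (p : EuclideanSpace ℝ (Fin 3)) (q : EuclideanSpace ℝ (Fin 3))

theorem stereoInv_mem (z : ℂ) :
    (!₂[2 * z.re / (1 + Complex.normSq z), 2 * z.im / (1 + Complex.normSq z),
      (Complex.normSq z - 1) / (1 + Complex.normSq z)] : EuclideanSpace ℝ (Fin 3)) ∈
      Metric.sphere (0 : EuclideanSpace ℝ (Fin 3)) 1 := by
  have h : (1 + Complex.normSq z) ≠ 0 := by
    have := Complex.normSq_nonneg z
    positivity
  rw [mem_sphere_zero_iff_norm, EuclideanSpace.norm_eq, Real.sqrt_eq_one, Fin.sum_univ_three]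
  simp only [Real.norm_eq_abs, sq_abs, Matrix.cons_val_zero, Matrix.cons_val_one,
    Matrix.cons_val]
  field_simp
  rw [Complex.normSq_apply]
  ring

/-- The point of the sphere over `z` in the equatorial plane, under stereographic
projection from the north pole `(0, 0, 1)`. -/
def stereoInv (z : ℂ) : S2 :=
  ⟨!₂[2 * z.re / (1 + Complex.normSq z), 2 * z.im / (1 + Complex.normSq z),
      (Complex.normSq z - 1) / (1 + Complex.normSq z)], stereoInv_mem z⟩

/-- The standard complex Gaussian law: independent real and imaginary parts, each
centred with variance `1 / 2`. -/
def complexGaussian : Measure ℂ :=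
  ((gaussianReal 0 (1 / 2)).prod (gaussianReal 0 (1 / 2))).map
    Complex.measurableEquivRealProd.symm

/-- `A` and `B` are independent random matrices (Ginibre matrices): all their
`2 * N ^ 2` entries are jointly independent standard complex Gaussians. -/
structure IsGinibrePair {Ω : Type*} [MeasurableSpace Ω] (P : Measure Ω) {N : ℕ}
    (A B : Ω → Matrix (Fin N) (Fin N) ℂ) : Prop where
  law_left : ∀ i j, HasLaw (fun ω => A ω i j) complexGaussian P
  law_right : ∀ i j, HasLaw (fun ω => B ω i j) complexGaussian P
  indep : iIndepFun
    (Sum.elim (fun (k : Fin N × Fin N) ω => A ω k.1 k.2) (fun (k : Fin N × Fin N) ω => B ω k.1 k.2))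
    P

/-- The points `x 0, …, x (N - 1)` are generated by the spherical ensemble: almost surely
they are, in some order, the points of the sphere corresponding under stereographic projection
to the eigenvalues (with algebraic multiplicity) of `A⁻¹ * B`, for `A` and `B` as above.
Nothing is assumed on how the labels are chosen. -/
def IsSphericalEnsemble {Ω : Type*} [MeasurableSpace Ω] (P : Measure Ω) {N : ℕ}
    (x : Fin N → Ω → S2) : Prop :=
  ∃ A B : Ω → Matrix (Fin N) (Fin N) ℂ, IsGinibrePair P A B ∧
    ∀ᵐ ω ∂P, (Finset.univ : Finset (Fin N)).val.map (fun i => x i ω) =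
      ((A ω)⁻¹ * B ω).charpoly.roots.map stereoInv

/-- `F_{s,N}` for a distance function `δ` on the two-dimensional sphere. -/
def F (δ : S2 → S2 → ℝ) (s : ℝ) (N : ℕ) (p q : S2) : ℝ :=
  (Set.Icc 0 s).indicator (fun _ => (1 : ℝ)) (δ p q * Real.sqrt N)

/-- The pair correlation statistic `G_{s,N}`: the sum runs over ordered pairs of
distinct indices. -/
def G (δ : S2 → S2 → ℝ) (s : ℝ) {N : ℕ} (x : Fin N → S2) : ℝ :=
  (1 / (N : ℝ)) * ∑ k ∈ (Finset.univ : Finset (Fin N)).offDiag, F δ s N (x k.1) (x k.2)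

end SphericalEnsemble

end

/-! The eigenvalues of `A⁻¹ * B` are almost surely the roots of `pencil A B = det (X A - B)`, so
only the multiset of these roots matters. The proof computes the two-point function of the roots
exactly for every `N = n + 2`.

Deflation (`exists_lintegral_sum_roots_pencil`). Encode an eigenvalue `z` and a left eigenvector
normalized to have zeroth coordinate one as a vector `y`. With `A` and the other rows of `B` fixed,
`eigMap` sends `y` to the only zeroth row of `B` for which `y` is an eigenpair. Its real Jacobian is
`|q(z)|²`, where `q` is the characteristic polynomial divided by `X - z`, so the area formula turns
a sum over roots into an integral over `y`. A unitary frame adapted to the eigenvector makes the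
pencil block triangular; Gaussian invariance leaves a Ginibre pencil of size one less, reweighted by
`|p(z)|²` (`p` being its own characteristic polynomial) and by a power of `(1 + |z|²)⁻¹`. Deflating
twice gives, up to a constant, the density `(1 + |w|²)^(-(n+3)) (1 + |z|²)^(-(n+3)) |w - z|² E |det
(w A - B) det (z A - B)|²`, with matrices of size `n`.

Determinant correlation (`normSq_sub_mul_lintegral_detSq_mul_detSq`). A unitary rotation of the pair
`(A, B)` reduces the expectation to `E |det A|² |det (s A + t B)|²`. Random row signs remove the
cross terms and leave determinants sharing a set `S` of rows, whose correlation is `n! (n+1)! / (n +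
1 - |S|)` (`mixMoment_mul`). The sum over `S` is a binomial expansion without its top term. Hence,
relative to spherical area, the two-point density is proportional to `1 - v ^ (n + 1)`, where `v =
overlap w z` is the squared cosine of half the angle between the two points.

By rotation invariance `v` is uniform on `(0, 1)` (`lintegral_comp_overlap`), and counting all `N (N
- 1)` ordered pairs fixes the constant as `N²` (`lintegral_pairSum_overlap`). Both distances are
decreasing functions of `v`, so the pairs counted by `G` are those with `v ≥ 1 - r`. Integration
gives `E G = N r - 1 + (1 - r)^N`, and in both cases `N r → s² / 4`, whence the limit. -/

noncomputable section
namespace SphericalEnsemble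
open MeasureTheory ProbabilityTheory Set Filter
open scoped ENNReal Topology

/-! ### The area formula in equal dimensions, and linear changes of variables. -/

section AreaFormula

variable {E : Type*} [NormedAddCommGroup E] [NormedSpace ℝ E] [FiniteDimensional ℝ E]
  [MeasurableSpace E] [BorelSpace E] (μ : Measure E) [μ.IsAddHaarMeasure]

/-- The regular points of a continuously differentiable map are covered by countably many disjoint
measurable sets on which the map is injective. -/
theorem exists_measurable_partition_injOn {g : E → E} {g' : E → E →L[ℝ] E}
    (hg : ∀ x, HasStrictFDerivAt g (g' x) x) (hc : Continuous g') :
    ∃ T : ℕ → Set E, (∀ i, MeasurableSet (T i)) ∧ (∀ i, InjOn g (T i)) ∧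
      Pairwise (Function.onFun Disjoint T) ∧ ⋃ i, T i = {x | (g' x).det ≠ 0} := by
  classical
  set U : Set E := {x | (g' x).det ≠ 0} with hU
  have hUo : IsOpen U := isOpen_ne_fun (ContinuousLinearMap.continuous_det.comp hc) continuous_const
  have key : ∀ x ∈ U, ∃ s : Set E, IsOpen s ∧ x ∈ s ∧ InjOn g s := by
    intro x hx
    have h1 : HasStrictFDerivAt g
        (((g' x).toContinuousLinearEquivOfDetNeZero hx : E ≃L[ℝ] E) : E →L[ℝ] E) x := by
      rw [ContinuousLinearMap.coe_toContinuousLinearEquivOfDetNeZero]; exact hg x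
    exact ⟨(h1.toOpenPartialHomeomorph g).source, (h1.toOpenPartialHomeomorph g).open_source,
      h1.mem_toOpenPartialHomeomorph_source, (h1.toOpenPartialHomeomorph g).injOn⟩
  choose! s hso hxs hinj using key
  let N : E → Set E := fun x => if x ∈ U then s x else ∅
  have hNo : ∀ x, MeasurableSet (N x) := by
    intro x
    by_cases hx : x ∈ U
    · simpa [N, hx] using (hso x hx).measurableSet
    · simp [N, hx]
  have hNi : ∀ x, InjOn g (N x) := by
    intro x
    by_cases hx : x ∈ U
    · simpa [N, hx] using hinj x hx
    · simp [N, hx]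
  obtain ⟨t, htU, htc, hcov⟩ := TopologicalSpace.countable_cover_nhdsWithin
    (f := N) (s := U) (fun x hx => mem_nhdsWithin_of_mem_nhds (by
      simpa [N, hx] using (hso x hx).mem_nhds (hxs x hx)))
  -- Inserting `0` makes the countable index set nonempty, hence the range of a sequence. The extra
  -- index is harmless because `N` is empty outside `U`.
  obtain ⟨e, he⟩ := (htc.insert (0 : E)).exists_eq_range (insert_nonempty _ _)
  refine ⟨fun i => disjointed (fun i => N (e i)) i ∩ U, fun i => ?_, fun i => ?_, ?_, ?_⟩
  · exact (MeasurableSet.disjointed (fun i => hNo _) i).inter hUo.measurableSet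
  · exact (hNi (e i)).mono (inter_subset_left.trans (disjointed_subset _ _))
  · intro i j hij
    exact (disjoint_disjointed (fun i => N (e i)) hij).mono inter_subset_left inter_subset_left
  · rw [← iUnion_inter, iUnion_disjointed, inter_eq_right]
    intro x hx
    obtain ⟨y, hy, hxy⟩ := mem_iUnion₂.1 (hcov hx)
    have : y ∈ range e := he ▸ mem_insert_of_mem _ hy
    obtain ⟨i, rfl⟩ := this
    exact mem_iUnion.2 ⟨i, hxy⟩

/-- On a piece where `g` is injective each fibre sum has at most one nonzero term, so this is the
usual change of variables. The fibre sum is the extension of `θ` along a measurable embedding, hence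
measurable. -/
theorem lintegral_det_fderiv_mul_eq_lintegral_extend {g : E → E} {g' : E → E →L[ℝ] E}
    (hg : ∀ x, HasStrictFDerivAt g (g' x) x) {T : Set E} (hT : MeasurableSet T)
    (hinj : InjOn g T) {θ : E → ℝ≥0∞} (hθ : Measurable θ) :
    ∫⁻ x in T, ENNReal.ofReal |(g' x).det| * θ x ∂μ =
        ∫⁻ b, ∑' y, (T ∩ g ⁻¹' {b}).indicator θ y ∂μ ∧
      Measurable fun b => ∑' y, (T ∩ g ⁻¹' {b}).indicator θ y := by
  classical
  have hgc : Continuous g := continuous_iff_continuousAt.2 fun x => (hg x).continuousAt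
  have hval : ∀ x ∈ T, (∑' y, (T ∩ g ⁻¹' {g x}).indicator θ y) = θ x := by
    intro x hx
    rw [tsum_eq_single x]
    · simp [hx]
    · intro y hy
      apply indicator_of_notMem
      rintro ⟨h1, h2⟩
      exact hy (hinj h1 hx h2)
  have hzero : ∀ b, b ∉ g '' T → (∑' y, (T ∩ g ⁻¹' {b}).indicator θ y) = 0 := by
    intro b hb
    rw [ENNReal.tsum_eq_zero]
    intro y
    apply indicator_of_notMem
    rintro ⟨h1, h2⟩
    exact hb ⟨y, h1, h2⟩
  have hemb := ContinuousOn.measurableEmbedding hT hgc.continuousOn hinj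
  have hF : (fun b => ∑' y, (T ∩ g ⁻¹' {b}).indicator θ y) =
      Function.extend (T.domRestrict g) (T.domRestrict θ) 0 := by
    funext b
    by_cases hb : b ∈ g '' T
    · obtain ⟨x, hx, rfl⟩ := hb
      rw [hval x hx]
      exact (hemb.injective.extend_apply (T.domRestrict θ) 0 ⟨x, hx⟩).symm
    · rw [hzero b hb, Function.extend_apply']
      · rfl
      · rintro ⟨⟨a, ha⟩, rfl⟩
        exact hb ⟨a, ha, rfl⟩
  refine ⟨?_, ?_⟩
  · have hsupp : (Function.support fun b => ∑' y, (T ∩ g ⁻¹' {b}).indicator θ y) ⊆ g '' T := by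
      intro b hb
      by_contra h
      exact hb (hzero b h)
    rw [← setLIntegral_eq_of_support_subset hsupp,
      lintegral_image_eq_lintegral_abs_det_fderiv_mul μ hT
        (fun x _ => (hg x).hasFDerivAt.hasFDerivWithinAt) hinj]
    exact setLIntegral_congr_fun hT fun x hx => by simp only [hval x hx]
  · rw [hF]
    exact hemb.measurable_extend (hθ.comp measurable_subtype_coe) measurable_const

/-- Area formula for a continuously differentiable map between spaces of equal dimension. -/
theorem lintegral_det_fderiv_mul_eq_lintegral_tsum {g : E → E} {g' : E → E →L[ℝ] E}
    (hg : ∀ x, HasStrictFDerivAt g (g' x) x) (hc : Continuous g')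
    {θ : E → ℝ≥0∞} (hθ : Measurable θ) :
    ∫⁻ x, ENNReal.ofReal |(g' x).det| * θ x ∂μ =
      ∫⁻ b, ∑' y, (g ⁻¹' {b}).indicator θ y ∂μ := by
  obtain ⟨T, hTm, hTi, hTd, hTU⟩ := exists_measurable_partition_injOn hg hc
  have hsupp : (Function.support fun x => ENNReal.ofReal |(g' x).det| * θ x) ⊆ ⋃ i, T i := by
    intro x hx
    rw [hTU]
    intro h
    exact hx (by simp [h])
  rw [← setLIntegral_eq_of_support_subset hsupp, lintegral_iUnion hTm hTd,
    tsum_congr fun i => (lintegral_det_fderiv_mul_eq_lintegral_extend μ hg (hTm i) (hTi i) hθ).1,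
    ← lintegral_tsum fun i =>
      (lintegral_det_fderiv_mul_eq_lintegral_extend μ hg (hTm i) (hTi i) hθ).2.aemeasurable]
  -- Critical values form a null set (the easy case of Sard's theorem). Over any other `b` the whole
  -- fibre lies in the union of the pieces.
  have hnull : μ (g '' {x | (g' x).det = 0}) = 0 :=
    addHaar_image_eq_zero_of_det_fderivWithin_eq_zero μ
      (fun x _ => (hg x).hasFDerivAt.hasFDerivWithinAt) fun x hx => hx
  refine lintegral_congr_ae ?_
  filter_upwards [compl_mem_ae_iff.2 hnull] with b hb
  rw [ENNReal.tsum_comm]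
  refine tsum_congr fun y => ?_
  by_cases hy : g y = b
  · have hyU : y ∈ ⋃ i, T i := by
      rw [hTU]
      exact fun h => hb ⟨y, h, hy⟩
    obtain ⟨i, hi⟩ := mem_iUnion.1 hyU
    rw [tsum_eq_single i]
    · simp [hi, hy]
    · intro j hj
      apply indicator_of_notMem
      exact fun h => (hTd hj).le_bot ⟨h.1, hi⟩
  · simp [hy]

/-- A linear change of variables, with the Jacobian expressed by a test function. -/
theorem lintegral_mul_lintegral_comp_linearEquiv (T : E ≃ₗ[ℝ] E) {f w : E → ℝ≥0∞}
    (hf : Measurable f) (hw : Measurable w) :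
    (∫⁻ x, f x ∂μ) * ∫⁻ x, w (T x) ∂μ = (∫⁻ x, f (T x) ∂μ) * ∫⁻ x, w x ∂μ := by
  have hT : Measurable T := (LinearMap.continuous_of_finiteDimensional (T : E →ₗ[ℝ] E)).measurable
  have hdet : LinearMap.det (T : E →ₗ[ℝ] E) ≠ 0 := (LinearEquiv.isUnit_det' T).ne_zero
  have key : ∀ h : E → ℝ≥0∞, Measurable h → ∫⁻ x, h (T x) ∂μ =
      ENNReal.ofReal |(LinearMap.det (T : E →ₗ[ℝ] E))⁻¹| * ∫⁻ x, h x ∂μ := by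
    intro h hh
    rw [← lintegral_map hh hT]
    have := Measure.map_linearMap_addHaar_eq_smul_addHaar μ hdet
    rw [show (T : E → E) = ((T : E →ₗ[ℝ] E) : E → E) from rfl, this, lintegral_smul_measure,
      smul_eq_mul]
  rw [key f hf, key w hw]
  ring

/-- A linear automorphism preserving an integrable weight preserves Lebesgue measure. -/
theorem measurePreserving_of_weight (T : E ≃ₗ[ℝ] E) {w : E → ℝ≥0∞}
    (hw : Measurable w) (hwT : ∀ x, w (T x) = w x) (h0 : ∫⁻ x, w x ∂μ ≠ 0)
    (htop : ∫⁻ x, w x ∂μ ≠ ∞) : MeasurePreserving T μ μ := by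
  have hT : Measurable T := (LinearMap.continuous_of_finiteDimensional (T : E →ₗ[ℝ] E)).measurable
  refine ⟨hT, Measure.ext fun s hs => ?_⟩
  have h := lintegral_mul_lintegral_comp_linearEquiv μ T
    (f := s.indicator 1) (measurable_one.indicator hs) hw
  simp only [hwT] at h
  -- Since `w ∘ T = w`, the same finite nonzero integral stands on both sides and cancels; the
  -- determinant of `T` is never computed.
  rw [ENNReal.mul_left_inj h0 htop] at h
  rw [Measure.map_apply hT hs, ← lintegral_indicator_one hs, h, ← lintegral_indicator_one (hT hs)]
  rfl

end AreaFormula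
end SphericalEnsemble
end

noncomputable section
namespace SphericalEnsemble
open MeasureTheory ProbabilityTheory Set Filter
open scoped ENNReal Topology

/-! ### Gaussian vectors and matrices, their densities and their invariances. -/

section GaussianRows

theorem complexGaussian_eq_withDensity :
    complexGaussian = (volume : Measure ℂ).withDensity
      fun z => ENNReal.ofReal (Real.pi⁻¹ * Real.exp (-Complex.normSq z)) := by
  have hden : gaussianReal 0 (1 / 2) = (volume : Measure ℝ).withDensity (gaussianPDF 0 (1 / 2)) :=
    gaussianReal_of_var_ne_zero 0 (by norm_num)
  have hm : Measurable fun z : ℂ => ENNReal.ofReal (Real.pi⁻¹ * Real.exp (-Complex.normSq z)) := by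
    have : Continuous fun z : ℂ => Real.pi⁻¹ * Real.exp (-Complex.normSq z) := by
      have := Complex.continuous_normSq
      fun_prop
    exact this.measurable.ennreal_ofReal
  unfold complexGaussian
  rw [hden, prod_withDensity (measurable_gaussianPDF _ _) (measurable_gaussianPDF _ _)]
  ext s hs
  rw [Measure.map_apply Complex.measurableEquivRealProd.symm.measurable hs,
    withDensity_apply _ (Complex.measurableEquivRealProd.symm.measurable hs),
    withDensity_apply _ hs,
    ← (Complex.volume_preserving_equiv_real_prod.symm).setLIntegral_comp_preimage hs hm]
  refine lintegral_congr fun p => ?_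
  rw [gaussianPDF, gaussianPDF, ← ENNReal.ofReal_mul (gaussianPDFReal_nonneg _ _ _)]
  congr 1
  simp only [gaussianPDFReal, sub_zero]
  have h1 : (2 * Real.pi * ((1 / 2 : NNReal) : ℝ)) = Real.pi := by push_cast; ring
  have h2 : (2 * ((1 / 2 : NNReal) : ℝ)) = 1 := by push_cast; ring
  rw [h1, h2]
  have h3 : (Real.sqrt Real.pi)⁻¹ * (Real.sqrt Real.pi)⁻¹ = Real.pi⁻¹ := by
    rw [← mul_inv, Real.mul_self_sqrt Real.pi_pos.le]
  rw [mul_mul_mul_comm, h3, ← Real.exp_add]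
  congr 2
  rw [Complex.normSq_apply, Complex.measurableEquivRealProd_symm_apply]
  ring

instance : IsProbabilityMeasure complexGaussian := by
  unfold complexGaussian
  exact Measure.isProbabilityMeasure_map (MeasurableEquiv.measurable _).aemeasurable

/-- Integrating over a finite product, one coordinate singled out. -/
theorem lintegral_pi_insertNth {E : Type*} [MeasurableSpace E] (μ : Measure E) [SigmaFinite μ]
    {n : ℕ} (j : Fin (n + 1)) {f : (Fin (n + 1) → E) → ℝ≥0∞} (hf : Measurable f) :
    ∫⁻ x, f x ∂Measure.pi (fun _ => μ) =
      ∫⁻ a, ∫⁻ y, f (j.insertNth a y) ∂Measure.pi (fun _ : Fin n => μ) ∂μ := by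
  have h := (measurePreserving_piFinSuccAbove (fun _ : Fin (n + 1) => μ) j).symm
  rw [← h.lintegral_comp_emb (MeasurableEquiv.measurableEmbedding _)]
  exact lintegral_prod _ (hf.comp (MeasurableEquiv.measurable _)).aemeasurable

theorem lintegral_pi_cons {E : Type*} [MeasurableSpace E] (μ : Measure E) [SigmaFinite μ]
    {n : ℕ} {f : (Fin (n + 1) → E) → ℝ≥0∞} (hf : Measurable f) :
    ∫⁻ x, f x ∂Measure.pi (fun _ => μ) =
      ∫⁻ a, ∫⁻ y, f (Fin.cons a y) ∂Measure.pi (fun _ : Fin n => μ) ∂μ := by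
  simpa only [Fin.insertNth_zero'] using lintegral_pi_insertNth μ 0 hf

theorem lintegral_pi_prod {E : Type*} [MeasurableSpace E] (μ : Measure E) [SigmaFinite μ] (n : ℕ)
    {f : Fin n → E → ℝ≥0∞} (hf : ∀ i, Measurable (f i)) :
    ∫⁻ x, ∏ i, f i (x i) ∂Measure.pi (fun _ : Fin n => μ) = ∏ i, ∫⁻ x, f i x ∂μ := by
  induction n with
  | zero => simp
  | succ n ih =>
    rw [lintegral_pi_cons μ (f := fun x => ∏ i, f i (x i))
      (Finset.measurable_prod _ fun i _ => (hf _).comp (measurable_pi_apply i))]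
    simp_rw [Fin.prod_univ_succ, Fin.cons_succ, Fin.cons_zero]
    rw [← ih fun i => hf _, ← lintegral_mul_const _ (hf 0)]
    refine lintegral_congr fun a => lintegral_const_mul _ ?_
    exact Finset.measurable_prod _ fun i _ => (hf _).comp (measurable_pi_apply i)

theorem pi_withDensity {E : Type*} [MeasurableSpace E] (μ : Measure E) [SigmaFinite μ] (n : ℕ)
    {f : E → ℝ≥0∞} (hf : Measurable f) [SigmaFinite (μ.withDensity f)] :
    Measure.pi (fun _ : Fin n => μ.withDensity f) =
      (Measure.pi fun _ : Fin n => μ).withDensity fun x => ∏ i, f (x i) := by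
  refine Measure.pi_eq fun s hs => ?_
  rw [withDensity_apply _ (MeasurableSet.univ_pi hs),
    ← lintegral_indicator (MeasurableSet.univ_pi hs)]
  have : (fun x : Fin n → E => (univ.pi s).indicator (fun x => ∏ i, f (x i)) x) =
      fun x => ∏ i, (s i).indicator f (x i) := by
    funext x
    by_cases hx : x ∈ univ.pi s
    · rw [indicator_of_mem hx]
      exact Finset.prod_congr rfl fun i _ => (indicator_of_mem (hx i trivial) _).symm
    · rw [indicator_of_notMem hx]
      simp only [Set.mem_pi, mem_univ, true_imp_iff, not_forall] at hx
      obtain ⟨i, hi⟩ := hx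
      exact (Finset.prod_eq_zero (Finset.mem_univ i) (indicator_of_notMem hi _)).symm
  rw [this, lintegral_pi_prod μ n fun i => hf.indicator (hs i)]
  exact Finset.prod_congr rfl fun i _ => by rw [lintegral_indicator (hs i), withDensity_apply _ (hs i)]

instance (k m : ℕ) : (volume : Measure (Fin k → Fin m → ℂ)).IsAddHaarMeasure :=
  Measure.pi.isAddHaarMeasure _

/-- Squared Euclidean norm of a complex vector. -/
def normSqVec {m : ℕ} (a : Fin m → ℂ) : ℝ := ∑ i, Complex.normSq (a i)

/-- Squared Frobenius norm. -/
def frob {k m : ℕ} (A : Fin k → Fin m → ℂ) : ℝ := ∑ j, normSqVec (A j)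

/-- The law of a vector with independent standard complex Gaussian entries. -/
abbrev gaussVec (m : ℕ) : Measure (Fin m → ℂ) := Measure.pi fun _ => complexGaussian

/-- The law of a rectangular matrix with independent standard complex Gaussian entries. -/
abbrev gaussMat (k m : ℕ) : Measure (Fin k → Fin m → ℂ) := Measure.pi fun _ => gaussVec m

/-- The Gaussian weight, as a function of the squared norm. -/
def wt (t : ℝ) : ℝ≥0∞ := ENNReal.ofReal (Real.exp (-t))

theorem wt_add (s t : ℝ) : wt (s + t) = wt s * wt t := by
  rw [wt, wt, wt, ← ENNReal.ofReal_mul (Real.exp_pos _).le, ← Real.exp_add]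
  ring_nf

theorem wt_sum {ι : Type*} (s : Finset ι) (f : ι → ℝ) :
    wt (∑ i ∈ s, f i) = ∏ i ∈ s, wt (f i) := by
  classical
  induction s using Finset.induction_on with
  | empty => simp [wt]
  | insert i s hi ih => rw [Finset.sum_insert hi, Finset.prod_insert hi, wt_add, ih]

@[fun_prop] theorem measurable_wt : Measurable wt := by
  unfold wt
  fun_prop

@[fun_prop] theorem continuous_normSqVec {m : ℕ} : Continuous (normSqVec (m := m)) :=
  continuous_finsetSum _ fun i _ => Complex.continuous_normSq.comp (continuous_apply i)

@[fun_prop] theorem continuous_frob {k m : ℕ} : Continuous (frob (k := k) (m := m)) :=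
  continuous_finsetSum _ fun i _ => continuous_normSqVec.comp (continuous_apply i)

@[fun_prop] theorem measurable_normSqVec {m : ℕ} : Measurable (normSqVec (m := m)) :=
  continuous_normSqVec.measurable

@[fun_prop] theorem measurable_frob {k m : ℕ} : Measurable (frob (k := k) (m := m)) :=
  continuous_frob.measurable

theorem normSqVec_nonneg {m : ℕ} (a : Fin m → ℂ) : 0 ≤ normSqVec a :=
  Finset.sum_nonneg fun _ _ => Complex.normSq_nonneg _

/-- The normalizing constant of one complex Gaussian. -/
def gaussConst : ℝ≥0∞ := ENNReal.ofReal Real.pi⁻¹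

theorem gaussConst_ne_top : gaussConst ≠ ∞ := ENNReal.ofReal_ne_top

theorem complexGaussian_eq_wt :
    complexGaussian = (volume : Measure ℂ).withDensity
      fun z => gaussConst * wt (Complex.normSq z) := by
  rw [complexGaussian_eq_withDensity]
  congr 1
  funext z
  rw [ENNReal.ofReal_mul (by positivity)]
  rfl

theorem measurable_gaussConst_mul_wt :
    Measurable fun z : ℂ => gaussConst * wt (Complex.normSq z) :=
  (measurable_wt.comp Complex.continuous_normSq.measurable).const_mul _

theorem gaussVec_eq_withDensity (m : ℕ) :
    gaussVec m = (volume : Measure (Fin m → ℂ)).withDensity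
      fun a => gaussConst ^ m * wt (normSqVec a) := by
  have : SigmaFinite ((volume : Measure ℂ).withDensity
      fun z => gaussConst * wt (Complex.normSq z)) := by
    rw [← complexGaussian_eq_wt]; infer_instance
  rw [gaussVec, complexGaussian_eq_wt, pi_withDensity _ _ measurable_gaussConst_mul_wt]
  congr 1
  funext a
  rw [Finset.prod_mul_distrib, normSqVec, wt_sum]
  simp

theorem gaussMat_eq_withDensity (k m : ℕ) :
    gaussMat k m = (volume : Measure (Fin k → Fin m → ℂ)).withDensity
      fun A => gaussConst ^ (m * k) * wt (frob A) := by
  have : SigmaFinite ((volume : Measure (Fin m → ℂ)).withDensity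
      fun a => gaussConst ^ m * wt (normSqVec a)) := by
    rw [← gaussVec_eq_withDensity]; infer_instance
  rw [gaussMat, gaussVec_eq_withDensity, pi_withDensity _ _ (by fun_prop)]
  congr 1
  funext A
  rw [Finset.prod_mul_distrib, frob, wt_sum]
  simp [pow_mul]

theorem lintegral_gaussVec {m : ℕ} {f : (Fin m → ℂ) → ℝ≥0∞} (hf : Measurable f) :
    ∫⁻ a, f a ∂gaussVec m = gaussConst ^ m * ∫⁻ a, wt (normSqVec a) * f a := by
  rw [gaussVec_eq_withDensity, lintegral_withDensity_eq_lintegral_mul _ (by fun_prop) hf,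
    ← lintegral_const_mul _ (by fun_prop)]
  exact lintegral_congr fun a => by simp [mul_assoc]

theorem lintegral_gaussMat {k m : ℕ} {f : (Fin k → Fin m → ℂ) → ℝ≥0∞} (hf : Measurable f) :
    ∫⁻ A, f A ∂gaussMat k m = gaussConst ^ (m * k) * ∫⁻ A, wt (frob A) * f A := by
  rw [gaussMat_eq_withDensity, lintegral_withDensity_eq_lintegral_mul _ (by fun_prop) hf,
    ← lintegral_const_mul _ (by fun_prop)]
  exact lintegral_congr fun a => by simp [mul_assoc]

/-- A linear map preserving a density of total mass one has Jacobian of modulus one, so it preserves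
the reference measure as well as the weighted one. This yields every Gaussian invariance below from
an identity between norms. -/
theorem measurePreserving_withDensity {E : Type*} [NormedAddCommGroup E] [NormedSpace ℝ E]
    [FiniteDimensional ℝ E] [MeasurableSpace E] [BorelSpace E] (μ : Measure E)
    [μ.IsAddHaarMeasure] (T : E ≃ₗ[ℝ] E) {w : E → ℝ≥0∞}
    (hw : Measurable w) (hwT : ∀ x, w (T x) = w x) [IsProbabilityMeasure (μ.withDensity w)] :
    MeasurePreserving T μ μ ∧ MeasurePreserving T (μ.withDensity w) (μ.withDensity w) := by
  have h1 : ∫⁻ x, w x ∂μ = 1 := by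
    rw [← setLIntegral_univ, ← withDensity_apply _ MeasurableSet.univ, measure_univ]
  have h := measurePreserving_of_weight μ T hw hwT (by simp [h1]) (by simp [h1])
  refine ⟨h, h.measurable, Measure.ext fun s hs => ?_⟩
  rw [Measure.map_apply h.measurable hs, withDensity_apply _ hs,
    withDensity_apply _ (h.measurable hs), ← h.setLIntegral_comp_preimage hs hw]
  simp only [hwT]

theorem measurePreserving_gaussMat {k m : ℕ}
    (T : (Fin k → Fin m → ℂ) ≃ₗ[ℝ] (Fin k → Fin m → ℂ)) (hT : ∀ A, frob (T A) = frob A) :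
    MeasurePreserving T volume volume ∧ MeasurePreserving T (gaussMat k m) (gaussMat k m) := by
  have : IsProbabilityMeasure ((volume : Measure (Fin k → Fin m → ℂ)).withDensity
      fun A => gaussConst ^ (m * k) * wt (frob A)) := by
    rw [← gaussMat_eq_withDensity]; infer_instance
  rw [gaussMat_eq_withDensity]
  exact measurePreserving_withDensity _ T (by fun_prop) (by simp [hT])

theorem measurePreserving_gaussMat_prod {k m : ℕ}
    (T : ((Fin k → Fin m → ℂ) × (Fin k → Fin m → ℂ)) ≃ₗ[ℝ]
      ((Fin k → Fin m → ℂ) × (Fin k → Fin m → ℂ)))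
    (hT : ∀ p, frob (T p).1 + frob (T p).2 = frob p.1 + frob p.2) :
    MeasurePreserving T ((gaussMat k m).prod (gaussMat k m))
      ((gaussMat k m).prod (gaussMat k m)) := by
  have h : (gaussMat k m).prod (gaussMat k m) =
      ((volume : Measure (Fin k → Fin m → ℂ)).prod
        (volume : Measure (Fin k → Fin m → ℂ))).withDensity fun p =>
        gaussConst ^ (m * k) * gaussConst ^ (m * k) * wt (frob p.1 + frob p.2) := by
    rw [gaussMat_eq_withDensity, prod_withDensity (by fun_prop) (by fun_prop)]
    congr 1
    funext p
    rw [wt_add]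
    ring
  have : IsProbabilityMeasure (((volume : Measure (Fin k → Fin m → ℂ)).prod
      (volume : Measure (Fin k → Fin m → ℂ))).withDensity fun p =>
        gaussConst ^ (m * k) * gaussConst ^ (m * k) * wt (frob p.1 + frob p.2)) := by
    rw [← h]; infer_instance
  have hH : ((volume : Measure (Fin k → Fin m → ℂ)).prod
      (volume : Measure (Fin k → Fin m → ℂ))).IsAddHaarMeasure :=
    Measure.prod.instIsAddHaarMeasure _ _
  rw [h]
  exact (measurePreserving_withDensity _ T (by fun_prop) (by simp [hT])).2

theorem measurePreserving_uncurry {ι κ E : Type*} [Fintype ι] [Fintype κ] [MeasurableSpace E]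
    (μ : Measure E) [SigmaFinite μ] :
    MeasurePreserving (MeasurableEquiv.curry ι κ E) (Measure.pi fun _ => μ)
      (Measure.pi fun _ => Measure.pi fun _ => μ) := by
  refine MeasurePreserving.symm (MeasurableEquiv.curry ι κ E).symm ⟨MeasurableEquiv.measurable _, ?_⟩
  refine (Measure.pi_eq fun s hs => ?_).symm
  rw [Measure.map_apply (MeasurableEquiv.measurable _) (MeasurableSet.univ_pi hs)]
  have : (MeasurableEquiv.curry ι κ E).symm ⁻¹' univ.pi s =
      univ.pi fun i => univ.pi fun j => s (i, j) := by
    ext x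
    simp [MeasurableEquiv.curry, Function.uncurry]
  rw [this, Measure.pi_pi]
  simp_rw [Measure.pi_pi]
  rw [Fintype.prod_prod_type]

/-- The joint law of a pair of independent Ginibre matrices. -/
theorem IsGinibrePair.hasLaw {Ω : Type*} [MeasurableSpace Ω] {P : Measure Ω}
    [IsProbabilityMeasure P] {N : ℕ} {A B : Ω → Matrix (Fin N) (Fin N) ℂ}
    (h : IsGinibrePair P A B) :
    HasLaw (fun ω => ((fun i j => A ω i j, fun i j => B ω i j) :
      (Fin N → Fin N → ℂ) × (Fin N → Fin N → ℂ))) ((gaussMat N N).prod (gaussMat N N)) P := by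
  have h1 := h.indep.hasLaw_pi (μ := fun _ => complexGaussian) (by
    rintro (k | k)
    · exact h.law_left k.1 k.2
    · exact h.law_right k.1 k.2)
  have h2 := measurePreserving_sumPiEquivProdPi (X := fun _ : Fin N × Fin N ⊕ Fin N × Fin N => ℂ)
    (fun _ => complexGaussian)
  have h3 := (measurePreserving_uncurry (ι := Fin N) (κ := Fin N) complexGaussian).prod
    (measurePreserving_uncurry (ι := Fin N) (κ := Fin N) complexGaussian)
  exact (h3.comp h2).fun_comp_hasLaw h1

end GaussianRows
end SphericalEnsemble
end

noncomputable section
namespace SphericalEnsemble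
open MeasureTheory ProbabilityTheory Set Filter
open scoped ENNReal Topology Matrix

/-! ### Unitary changes of coordinates on rows and columns. -/

section Unitary

theorem normSqVec_eq_dotProduct {m : ℕ} (a : Fin m → ℂ) :
    (normSqVec a : ℂ) = a ⬝ᵥ star a := by
  simp [normSqVec, dotProduct, Complex.mul_conj]

theorem normSqVec_vecMul {m : ℕ} {Q : Matrix (Fin m) (Fin m) ℂ} (hQ : Q * Qᴴ = 1)
    (a : Fin m → ℂ) : normSqVec (a ᵥ* Q) = normSqVec a := by
  have : (normSqVec (a ᵥ* Q) : ℂ) = normSqVec a := by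
    rw [normSqVec_eq_dotProduct, normSqVec_eq_dotProduct, Matrix.star_vecMul,
      Matrix.dotProduct_mulVec, Matrix.vecMul_vecMul, hQ, Matrix.vecMul_one]
  exact_mod_cast this

theorem normSqVec_mulVec {m : ℕ} {R : Matrix (Fin m) (Fin m) ℂ} (hR : Rᴴ * R = 1)
    (a : Fin m → ℂ) : normSqVec (R *ᵥ a) = normSqVec a := by
  have h := normSqVec_vecMul (Q := Rᵀ) (by
    rw [show (Rᵀ)ᴴ = (Rᴴ)ᵀ from rfl, ← Matrix.transpose_mul, hR, Matrix.transpose_one]) a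
  rwa [Matrix.vecMul_transpose] at h

theorem frob_eq_sum_columns {k m : ℕ} (A : Fin k → Fin m → ℂ) :
    frob A = ∑ i, normSqVec fun j => A j i :=
  Finset.sum_comm

theorem frob_cons {k m : ℕ} (a : Fin m → ℂ) (A : Fin k → Fin m → ℂ) :
    frob (Fin.cons a A : Fin (k + 1) → Fin m → ℂ) = normSqVec a + frob A := by
  simp [frob, Fin.sum_univ_succ]

/-- Multiplication of all rows by an invertible matrix. -/
def rowsMul (k : ℕ) {m : ℕ} {Q Q' : Matrix (Fin m) (Fin m) ℂ} (h : Q * Q' = 1) (h' : Q' * Q = 1) :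
    (Fin k → Fin m → ℂ) ≃ₗ[ℝ] (Fin k → Fin m → ℂ) where
  toFun X i := X i ᵥ* Q
  invFun X i := X i ᵥ* Q'
  map_add' X Y := by funext i; simp [Matrix.add_vecMul]
  map_smul' c X := by funext i; simp [Matrix.smul_vecMul]
  left_inv X := by funext i; simp [Matrix.vecMul_vecMul, h]
  right_inv X := by funext i; simp [Matrix.vecMul_vecMul, h']

/-- Left multiplication by an invertible matrix. -/
def leftMul {k : ℕ} (m : ℕ) {R R' : Matrix (Fin k) (Fin k) ℂ} (h : R * R' = 1) (h' : R' * R = 1) :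
    (Fin k → Fin m → ℂ) ≃ₗ[ℝ] (Fin k → Fin m → ℂ) where
  toFun X := R * Matrix.of X
  invFun X := R' * Matrix.of X
  map_add' X Y := Matrix.mul_add R (Matrix.of X) (Matrix.of Y)
  map_smul' c X := Matrix.mul_smul R c (Matrix.of X)
  left_inv X := by
    change R' * (R * Matrix.of X) = X
    rw [← Matrix.mul_assoc, h', Matrix.one_mul]; rfl
  right_inv X := by
    change R * (R' * Matrix.of X) = X
    rw [← Matrix.mul_assoc, h, Matrix.one_mul]; rfl

theorem frob_rowsMul (k : ℕ) {m : ℕ} {Q : Matrix (Fin m) (Fin m) ℂ} (h : Q * Qᴴ = 1)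
    (h' : Qᴴ * Q = 1) (X : Fin k → Fin m → ℂ) : frob (rowsMul k h h' X) = frob X :=
  Finset.sum_congr rfl fun i _ => normSqVec_vecMul h (X i)

theorem frob_leftMul {k : ℕ} (m : ℕ) {R : Matrix (Fin k) (Fin k) ℂ} (h : R * Rᴴ = 1)
    (h' : Rᴴ * R = 1) (X : Fin k → Fin m → ℂ) : frob (leftMul m h h' X) = frob X := by
  rw [frob_eq_sum_columns, frob_eq_sum_columns]
  exact Finset.sum_congr rfl fun i _ => normSqVec_mulVec h' fun j => X j i

theorem measurePreserving_tail (n : ℕ) :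
    MeasurePreserving (fun (a : Fin (n + 1) → ℂ) (j : Fin n) => a j.succ)
      (gaussVec (n + 1)) (gaussVec n) := by
  have h := (measurePreserving_snd (μ := complexGaussian) (ν := gaussVec n)).comp
    (measurePreserving_piFinSuccAbove (fun _ : Fin (n + 1) => complexGaussian) 0)
  exact h

/-- Deleting the first column after a unitary change of coordinates. -/
theorem measurePreserving_tail_vecMul (k n : ℕ) {Q : Matrix (Fin (n + 1)) (Fin (n + 1)) ℂ}
    (h : Q * Qᴴ = 1) (h' : Qᴴ * Q = 1) :
    MeasurePreserving (fun (X : Fin k → Fin (n + 1) → ℂ) i (j : Fin n) => (X i ᵥ* Q) j.succ)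
      (gaussMat k (n + 1)) (gaussMat k n) := by
  have h1 := measurePreserving_pi (fun _ : Fin k => gaussVec (n + 1)) (fun _ => gaussVec n)
    (fun _ => measurePreserving_tail n)
  exact h1.comp (measurePreserving_gaussMat (rowsMul k h h') (frob_rowsMul k h h')).2

theorem normSqVec_eq_zero {m : ℕ} {a : Fin m → ℂ} : normSqVec a = 0 ↔ a = 0 := by
  rw [normSqVec, Finset.sum_eq_zero_iff_of_nonneg fun _ _ => Complex.normSq_nonneg _]
  simp [funext_iff]

theorem normSqVec_pos {m : ℕ} {a : Fin m → ℂ} (h : a ≠ 0) : 0 < normSqVec a :=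
  (normSqVec_nonneg a).lt_of_ne fun h' => h (normSqVec_eq_zero.1 h'.symm)

/-- Every nonzero vector is a positive multiple of the first row of a unitary matrix. -/
theorem exists_unitary_row {n : ℕ} {a : Fin (n + 1) → ℂ} (ha : a ≠ 0) :
    ∃ R : Matrix (Fin (n + 1)) (Fin (n + 1)) ℂ, R * Rᴴ = 1 ∧ Rᴴ * R = 1 ∧
      a = fun j => (Real.sqrt (normSqVec a) : ℂ) * R 0 j := by
  have hpos : 0 < Real.sqrt (normSqVec a) := Real.sqrt_pos.2 (normSqVec_pos ha)
  have hne : (Real.sqrt (normSqVec a) : ℂ) ≠ 0 := by exact_mod_cast hpos.ne'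
  -- Only the value at index `0` matters: the family is restricted to `{0}` before being extended to
  -- an orthonormal basis.
  let v : Fin (n + 1) → EuclideanSpace ℂ (Fin (n + 1)) := fun _ =>
    WithLp.toLp 2 fun j => (Real.sqrt (normSqVec a) : ℂ)⁻¹ * a j
  have hv : Orthonormal ℂ (({0} : Set (Fin (n + 1))).domRestrict v) := by
    refine ⟨fun i => ?_, fun i j hij => (hij (Subsingleton.elim i j)).elim⟩
    rw [EuclideanSpace.norm_eq, Real.sqrt_eq_one]
    have : ∀ j, ‖(v 0) j‖ ^ 2 = (normSqVec a)⁻¹ * Complex.normSq (a j) := by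
      intro j
      rw [← Complex.normSq_eq_norm_sq]
      simp only [v, map_mul, map_inv₀, Complex.normSq_ofReal]
      rw [Real.mul_self_sqrt (normSqVec_nonneg a)]
    rw [show (({0} : Set (Fin (n + 1))).domRestrict v) i = v 0 from rfl]
    simp_rw [this]
    rw [← Finset.mul_sum]
    exact inv_mul_cancel₀ (normSqVec_pos ha).ne'
  obtain ⟨b, hb⟩ := hv.exists_orthonormalBasis_extension_of_card_eq (by simp)
  let R : Matrix (Fin (n + 1)) (Fin (n + 1)) ℂ := fun i j => b i j
  have h1 : R * Rᴴ = 1 := by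
    ext i j
    have := orthonormal_iff_ite.1 b.orthonormal j i
    rw [Matrix.mul_apply, Matrix.one_apply]
    rw [EuclideanSpace.inner_eq_star_dotProduct] at this
    simp only [eq_comm (a := i)]
    exact this
  refine ⟨R, h1, mul_eq_one_comm.1 h1, ?_⟩
  funext j
  have : R 0 j = (Real.sqrt (normSqVec a) : ℂ)⁻¹ * a j := by
    change (b 0) j = _
    rw [hb 0 rfl]
  rw [this, mul_inv_cancel_left₀ hne]

/-- Every nonzero vector is mapped by a unitary matrix to a multiple of the first basis vector. -/
theorem exists_unitary_vecMul {n : ℕ} {a : Fin (n + 1) → ℂ} (ha : a ≠ 0) :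
    ∃ Q : Matrix (Fin (n + 1)) (Fin (n + 1)) ℂ, Q * Qᴴ = 1 ∧ Qᴴ * Q = 1 ∧
      a ᵥ* Q = Pi.single 0 (Real.sqrt (normSqVec a) : ℂ) := by
  obtain ⟨R, h1, h2, h3⟩ := exists_unitary_row ha
  refine ⟨Rᴴ, by simpa using h2, by simpa using h1, ?_⟩
  funext j
  have h4 := congrFun (congrFun h1 0) j
  rw [Matrix.mul_apply, Matrix.one_apply] at h4
  conv_lhs => rw [h3]
  simp only [Matrix.vecMul, dotProduct, mul_assoc, ← Finset.mul_sum, h4]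
  by_cases hj : j = 0
  · simp [hj]
  · simp [hj, Ne.symm hj]

/-- Row `j` of `M * Q` has a single nonzero entry, in column `0`, so the Laplace expansion along it
has one term. The ring is general because the identity serves both complex matrices and matrices of
polynomials. -/
theorem det_mul_det_eq_of_vecMul_eq_single {S : Type*} [CommRing S] {n : ℕ}
    (M Q : Matrix (Fin (n + 1)) (Fin (n + 1)) S) (j : Fin (n + 1)) (c : S)
    (h : M j ᵥ* Q = Pi.single 0 c) :
    M.det * Q.det = (-1) ^ (j : ℕ) * c *
      (Matrix.of fun (i k : Fin n) => (M (j.succAbove i) ᵥ* Q) k.succ).det := by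
  rw [← Matrix.det_mul, Matrix.det_succ_row (M * Q) j, Finset.sum_eq_single 0]
  · have : (M * Q) j 0 = c := by
      change (M j ᵥ* Q) 0 = c
      rw [h, Pi.single_eq_same]
    rw [this]
    simp only [Fin.val_zero, add_zero]
    rfl
  · intro k _ hk
    have : (M * Q) j k = 0 := by
      change (M j ᵥ* Q) k = 0
      rw [h, Pi.single_eq_of_ne hk]
    simp [this]
  · simp

theorem normSq_det_of_unitary {m : ℕ} {Q : Matrix (Fin m) (Fin m) ℂ} (h : Q * Qᴴ = 1) :
    Complex.normSq Q.det = 1 := by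
  have := congrArg Matrix.det h
  rw [Matrix.det_mul, Matrix.det_conjTranspose, Matrix.det_one] at this
  have h2 : (Complex.normSq Q.det : ℂ) = 1 := by rw [← Complex.mul_conj]; exact this
  exact_mod_cast h2

end Unitary
end SphericalEnsemble
end

noncomputable section
namespace SphericalEnsemble
open MeasureTheory ProbabilityTheory Set Filter
open scoped ENNReal Topology Matrix

/-! ### Moments of Gaussian vectors. -/

section Moments

/-- Integration of a radial function over the complex plane. -/
theorem lintegral_normSq {f : ℝ → ℝ≥0∞} (hf : Measurable f) :
    ∫⁻ z : ℂ, f (Complex.normSq z) = ENNReal.ofReal Real.pi * ∫⁻ t in Ioi (0 : ℝ), f t := by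
  have himg : (fun r : ℝ => r ^ 2) '' Ioi 0 = Ioi 0 := by
    ext t
    constructor
    · rintro ⟨r, hr, rfl⟩
      exact pow_pos (mem_Ioi.1 hr) 2
    · intro ht
      exact ⟨Real.sqrt t, Real.sqrt_pos.2 ht, Real.sq_sqrt (mem_Ioi.1 ht).le⟩
  have hinj : InjOn (fun r : ℝ => r ^ 2) (Ioi 0) := fun a ha b hb h =>
    (pow_left_inj₀ (mem_Ioi.1 ha).le (mem_Ioi.1 hb).le two_ne_zero).1 h
  have hsub : ∫⁻ t in Ioi (0 : ℝ), f t = ∫⁻ r in Ioi (0 : ℝ), ENNReal.ofReal (2 * r) * f (r ^ 2) := by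
    conv_lhs => rw [← himg]
    rw [lintegral_image_eq_lintegral_abs_deriv_mul measurableSet_Ioi
      (fun r _ => (by simpa using (hasDerivAt_pow 2 r).hasDerivWithinAt :
        HasDerivWithinAt (fun r : ℝ => r ^ 2) (2 * r) (Ioi 0) r)) hinj]
    refine setLIntegral_congr_fun measurableSet_Ioi fun r hr => ?_
    have : (0 : ℝ) < r := hr
    simp only [abs_of_pos (by positivity : 0 < 2 * r)]
  rw [← Complex.lintegral_comp_polarCoord_symm]
  have h1 : ∀ p ∈ polarCoord.target,
      ENNReal.ofReal p.1 • f (Complex.normSq (Complex.polarCoord.symm p)) =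
        ENNReal.ofReal p.1 * f (p.1 ^ 2) := by
    intro p hp
    rw [smul_eq_mul, Complex.normSq_eq_norm_sq, Complex.norm_polarCoord_symm, sq_abs]
  rw [setLIntegral_congr_fun (polarCoord.open_target.measurableSet) h1]
  have h2 : polarCoord.target = Ioi (0 : ℝ) ×ˢ Ioo (-Real.pi) Real.pi := rfl
  have h3 := lintegral_prod_mul (μ := (volume : Measure ℝ).restrict (Ioi 0))
    (ν := (volume : Measure ℝ).restrict (Ioo (-Real.pi) Real.pi))
    (f := fun r : ℝ => ENNReal.ofReal r * f (r ^ 2)) (g := fun _ => 1) (by fun_prop) (by fun_prop)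
  simp only [mul_one] at h3
  rw [h2, Measure.volume_eq_prod, ← Measure.prod_restrict, h3, hsub]
  simp only [lintegral_const, one_mul, Measure.restrict_apply_univ, Real.volume_Ioo]
  rw [← lintegral_mul_const _ (by fun_prop), ← lintegral_const_mul _ (by fun_prop)]
  refine lintegral_congr fun r => ?_
  rw [show Real.pi - -Real.pi = Real.pi * 2 by ring, ENNReal.ofReal_mul Real.pi_pos.le,
    ENNReal.ofReal_mul two_pos.le]
  ring

/-- The squared modulus is a unit exponential variable, so its moments are values of the Gamma
function. -/
theorem lintegral_complexGaussian_normSq_pow (k : ℕ) :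
    ∫⁻ z, ENNReal.ofReal (Complex.normSq z) ^ k ∂complexGaussian = (k.factorial : ℝ≥0∞) := by
  have hm : Measurable fun t : ℝ => gaussConst * wt t * ENNReal.ofReal t ^ k := by fun_prop
  have hn : Measurable fun z : ℂ => ENNReal.ofReal (Complex.normSq z) ^ k :=
    (Complex.continuous_normSq.measurable.ennreal_ofReal).pow_const k
  rw [complexGaussian_eq_wt, lintegral_withDensity_eq_lintegral_mul _ measurable_gaussConst_mul_wt hn]
  refine (lintegral_normSq hm).trans ?_
  have h1 : ∫⁻ t in Ioi (0 : ℝ), gaussConst * wt t * ENNReal.ofReal t ^ k =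
      gaussConst * ENNReal.ofReal (k.factorial : ℝ) := by
    simp only [mul_assoc]
    rw [lintegral_const_mul _ (by fun_prop)]
    congr 1
    have h2 := Real.Gamma_eq_integral (s := k + 1) (by positivity)
    rw [Real.Gamma_nat_eq_factorial] at h2
    rw [h2, ofReal_integral_eq_lintegral_ofReal (Real.GammaIntegral_convergent (by positivity))]
    · refine setLIntegral_congr_fun measurableSet_Ioi fun t ht => ?_
      have ht' : (0 : ℝ) < t := ht
      rw [wt, ← ENNReal.ofReal_pow ht'.le, ← ENNReal.ofReal_mul (Real.exp_pos _).le]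
      simp
    · filter_upwards [ae_restrict_mem measurableSet_Ioi] with t ht
      have ht' : (0 : ℝ) < t := ht
      simp only [Pi.zero_apply]
      positivity
  rw [h1, ← mul_assoc, gaussConst, ← ENNReal.ofReal_mul Real.pi_pos.le,
    mul_inv_cancel₀ Real.pi_pos.ne']
  simp

theorem lintegral_gaussVec_normSqVec (m : ℕ) :
    ∫⁻ a, ENNReal.ofReal (normSqVec a) ∂gaussVec m = m := by
  induction m with
  | zero => simp [normSqVec]
  | succ m ih =>
    rw [lintegral_pi_cons _ (by fun_prop)]
    have h1 : ∀ (a : ℂ) (y : Fin m → ℂ),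
        ENNReal.ofReal (normSqVec (Fin.cons a y : Fin (m + 1) → ℂ)) =
          ENNReal.ofReal (Complex.normSq a) ^ 1 + ENNReal.ofReal (normSqVec y) := by
      intro a y
      rw [pow_one, ← ENNReal.ofReal_add (Complex.normSq_nonneg _) (normSqVec_nonneg _)]
      simp [normSqVec, Fin.sum_univ_succ]
    have hn : Measurable fun z : ℂ => ENNReal.ofReal (Complex.normSq z) ^ 1 :=
      (Complex.continuous_normSq.measurable.ennreal_ofReal).pow_const 1
    simp only [h1]
    have h2 : ∀ a : ℂ, ∫⁻ y, (ENNReal.ofReal (Complex.normSq a) ^ 1 + ENNReal.ofReal (normSqVec y))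
        ∂gaussVec m = ENNReal.ofReal (Complex.normSq a) ^ 1 + m := by
      intro a
      rw [lintegral_add_left measurable_const, ih]
      simp
    simp only [h2]
    rw [lintegral_add_left hn, lintegral_complexGaussian_normSq_pow]
    simp [add_comm]

/-- `normSqVec` is a sum of `m` independent unit exponentials, and one coordinate is split off at
each step. This second moment drives the recursion for determinants with a common row. -/
theorem lintegral_gaussVec_normSqVec_sq (m : ℕ) :
    ∫⁻ a, ENNReal.ofReal (normSqVec a) ^ 2 ∂gaussVec m = m * (m + 1) := by
  induction m with
  | zero => simp [normSqVec]
  | succ m ih =>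
    rw [lintegral_pi_cons _ (by fun_prop)]
    have h1 : ∀ (a : ℂ) (y : Fin m → ℂ),
        ENNReal.ofReal (normSqVec (Fin.cons a y : Fin (m + 1) → ℂ)) ^ 2 =
          ENNReal.ofReal (Complex.normSq a) ^ 2 +
          (2 * ENNReal.ofReal (Complex.normSq a) ^ 1 * ENNReal.ofReal (normSqVec y)
            + ENNReal.ofReal (normSqVec y) ^ 2) := by
      intro a y
      have : normSqVec (Fin.cons a y : Fin (m + 1) → ℂ) = Complex.normSq a + normSqVec y := by
        simp [normSqVec, Fin.sum_univ_succ]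
      rw [this, ENNReal.ofReal_add (Complex.normSq_nonneg _) (normSqVec_nonneg _)]
      ring
    have hn : ∀ k : ℕ, Measurable fun z : ℂ => ENNReal.ofReal (Complex.normSq z) ^ k := fun k =>
      (Complex.continuous_normSq.measurable.ennreal_ofReal).pow_const k
    simp only [h1]
    have h2 : ∀ a : ℂ, ∫⁻ y, (ENNReal.ofReal (Complex.normSq a) ^ 2 +
          (2 * ENNReal.ofReal (Complex.normSq a) ^ 1 * ENNReal.ofReal (normSqVec y)
            + ENNReal.ofReal (normSqVec y) ^ 2))
        ∂gaussVec m = ENNReal.ofReal (Complex.normSq a) ^ 2 +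
          (ENNReal.ofReal (Complex.normSq a) ^ 1 * (2 * m) + m * (m + 1)) := by
      intro a
      rw [lintegral_add_left measurable_const, lintegral_add_right _ (by fun_prop),
        lintegral_const_mul _ (by fun_prop), ih, lintegral_gaussVec_normSqVec]
      simp only [lintegral_const, measure_univ, mul_one]
      ring
    simp only [h2]
    rw [lintegral_add_left (hn 2), lintegral_add_right _ measurable_const,
      lintegral_mul_const _ (hn 1),
      lintegral_complexGaussian_normSq_pow, lintegral_complexGaussian_normSq_pow]
    simp only [lintegral_const, measure_univ, mul_one, Nat.factorial, Nat.cast_one]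
    push_cast
    ring

end Moments
end SphericalEnsemble
end

noncomputable section
namespace SphericalEnsemble
open MeasureTheory ProbabilityTheory Set Filter
open scoped ENNReal Topology Matrix

/-! ### Correlation of two Gaussian determinants with common rows. -/

section DetCorrelation

theorem lintegral_const_mul_comp {α β : Type*} [MeasurableSpace α] [MeasurableSpace β]
    {μ : Measure α} {ν : Measure β} {t : α → β} (ht : MeasurePreserving t μ ν) (c : ℝ≥0∞)
    {f : β → ℝ≥0∞} (hf : Measurable f) :
    ∫⁻ x, c * f (t x) ∂μ = c * ∫⁻ y, f y ∂ν := by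
  rw [← ht.lintegral_comp hf]
  exact lintegral_const_mul c (hf.comp ht.measurable)

/-- Squared modulus of the determinant with given rows. -/
def detSq {n : ℕ} (M : Fin n → Fin n → ℂ) : ℝ≥0∞ :=
  ENNReal.ofReal (Complex.normSq (Matrix.of M).det)

theorem Continuous.measurable_detSq {X : Type*} [TopologicalSpace X] [MeasurableSpace X]
    [OpensMeasurableSpace X] {n : ℕ} {f : X → Fin n → Fin n → ℂ} (hf : Continuous f) :
    Measurable fun x => detSq (f x) := by
  have h1 : Continuous fun x => (Matrix.of (f x)).det := Continuous.matrix_det hf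
  exact (Complex.continuous_normSq.comp h1).measurable.ennreal_ofReal

@[fun_prop] theorem measurable_detSq {n : ℕ} : Measurable (detSq (n := n)) :=
  Continuous.measurable_detSq continuous_id

/-- Rotate `a` onto the first axis and expand along its row. It matters that `Q` depends on `a`
alone: one rotation then handles two determinants that share this row. For `a = 0` both sides
vanish. -/
theorem exists_unitary_detSq_insertNth {n : ℕ} (a : Fin (n + 1) → ℂ) :
    ∃ Q : Matrix (Fin (n + 1)) (Fin (n + 1)) ℂ, Q * Qᴴ = 1 ∧ Qᴴ * Q = 1 ∧
      ∀ (j : Fin (n + 1)) (X : Fin n → Fin (n + 1) → ℂ),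
        detSq (j.insertNth a X : Fin (n + 1) → Fin (n + 1) → ℂ) =
          ENNReal.ofReal (normSqVec a) * detSq fun i k => (X i ᵥ* Q) k.succ := by
  by_cases ha : a = 0
  · refine ⟨1, by simp, by simp, fun j X => ?_⟩
    have : (Matrix.of (j.insertNth a X : Fin (n + 1) → Fin (n + 1) → ℂ)).det = 0 :=
      Matrix.det_eq_zero_of_row_eq_zero j fun k => by simp [ha]
    rw [detSq, this]
    simp [ha, normSqVec]
  · obtain ⟨Q, h1, h2, h3⟩ := exists_unitary_vecMul ha
    refine ⟨Q, h1, h2, fun j X => ?_⟩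
    have h := det_mul_det_eq_of_vecMul_eq_single
      (Matrix.of (j.insertNth a X : Fin (n + 1) → Fin (n + 1) → ℂ)) Q j
      (Real.sqrt (normSqVec a) : ℂ) (by
        have : (Matrix.of (j.insertNth a X : Fin (n + 1) → Fin (n + 1) → ℂ)) j = a :=
          Fin.insertNth_apply_same
            (α := fun _ => Fin (n + 1) → ℂ) j a X
        rw [this, h3])
    have hs : ∀ i, (Matrix.of (j.insertNth a X : Fin (n + 1) → Fin (n + 1) → ℂ)) (j.succAbove i)
        = X i := fun i =>
      Fin.insertNth_apply_succAbove (α := fun _ => Fin (n + 1) → ℂ) j a X i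
    simp only [hs] at h
    have h' := congrArg Complex.normSq h
    simp only [map_mul, normSq_det_of_unitary h1, mul_one, Complex.normSq_ofReal,
      Real.mul_self_sqrt (normSqVec_nonneg a), map_pow, Complex.normSq_neg, map_one, one_pow,
      one_mul] at h'
    rw [detSq, h', ENNReal.ofReal_mul (normSqVec_nonneg a)]
    rfl

/-- Condition on row zero. After the rotation and the deletion of a column the other rows form a
smaller Gaussian matrix, and the row itself contributes its mean squared norm `n + 1`. -/
theorem lintegral_detSq (n : ℕ) : ∫⁻ A, detSq A ∂gaussMat n n = (n.factorial : ℝ≥0∞) := by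
  induction n with
  | zero => simp [detSq]
  | succ n ih =>
    rw [lintegral_pi_insertNth _ 0 measurable_detSq]
    have h1 : ∀ a : Fin (n + 1) → ℂ, ∫⁻ X, detSq (Fin.insertNth 0 a X : Fin (n + 1) → _)
        ∂gaussMat n (n + 1) = ENNReal.ofReal (normSqVec a) * (n.factorial : ℝ≥0∞) := by
      intro a
      obtain ⟨Q, hQ, hQ', h⟩ := exists_unitary_detSq_insertNth a
      simp only [h]
      have hmp := measurePreserving_tail_vecMul n n hQ hQ'
      rw [← ih]
      exact lintegral_const_mul_comp hmp _ measurable_detSq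
    simp only [h1]
    rw [lintegral_mul_const _ (by fun_prop), lintegral_gaussVec_normSqVec, Nat.factorial_succ]
    push_cast
    ring

/-- The matrix whose rows with index in `S` come from `A`, the others from `B`. -/
def mixRows {n m : ℕ} (S : Finset (Fin n)) (A B : Fin n → Fin m → ℂ) : Fin n → Fin m → ℂ :=
  fun i => if i ∈ S then A i else B i

theorem continuous_mixRows {n m : ℕ} (S : Finset (Fin n)) :
    Continuous fun p : (Fin n → Fin m → ℂ) × (Fin n → Fin m → ℂ) => mixRows S p.1 p.2 := by
  refine continuous_pi fun i => ?_
  by_cases hi : i ∈ S <;> simp only [mixRows, hi, if_true, if_false] <;> fun_prop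

/-- The product of the squared determinants of `A` and of a matrix sharing rows with `A`. -/
def mixSq {n : ℕ} (S : Finset (Fin n)) (A B : Fin n → Fin n → ℂ) : ℝ≥0∞ :=
  detSq A * detSq (mixRows S A B)

theorem measurable_uncurry_mixSq {n : ℕ} (S : Finset (Fin n)) :
    Measurable (Function.uncurry (mixSq S)) :=
  (Continuous.measurable_detSq continuous_fst).mul
    (Continuous.measurable_detSq (continuous_mixRows S))

theorem measurable_mixSq {n : ℕ} (S : Finset (Fin n)) (A : Fin n → Fin n → ℂ) :
    Measurable (mixSq S A) :=
  (Continuous.measurable_detSq (f := fun B => mixRows S A B)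
    ((continuous_mixRows S).comp (Continuous.prodMk_right A))).const_mul (detSq A)

/-- Expectation of `mixSq`. -/
def mixMoment (n : ℕ) (S : Finset (Fin n)) : ℝ≥0∞ :=
  ∫⁻ A, ∫⁻ B, mixSq S A B ∂gaussMat n n ∂gaussMat n n

theorem mixRows_insertNth {n : ℕ} {S : Finset (Fin (n + 1))} {j : Fin (n + 1)} (hj : j ∈ S)
    (a b : Fin (n + 1) → ℂ) (X Y : Fin n → Fin (n + 1) → ℂ) :
    mixRows S (j.insertNth a X : Fin (n + 1) → Fin (n + 1) → ℂ) (j.insertNth b Y) =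
      j.insertNth a (mixRows (Finset.univ.filter fun i => j.succAbove i ∈ S) X Y) := by
  funext i
  rcases Fin.eq_self_or_eq_succAbove j i with rfl | ⟨k, rfl⟩
  · simp [mixRows, hj]
  · simp [mixRows]

theorem card_filter_succAbove {n : ℕ} {S : Finset (Fin (n + 1))} {j : Fin (n + 1)} (hj : j ∈ S) :
    S.card = (Finset.univ.filter fun i => j.succAbove i ∈ S).card + 1 := by
  have himg : S = insert j ((Finset.univ.filter fun i => j.succAbove i ∈ S).image j.succAbove) := by
    ext i
    rcases Fin.eq_self_or_eq_succAbove j i with rfl | ⟨k, rfl⟩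
    · simp [hj]
    · simp [Fin.succAbove_ne, Fin.succAbove_right_injective.eq_iff]
  conv_lhs => rw [himg]
  rw [Finset.card_insert_of_notMem (by simp [Fin.succAbove_ne]),
    Finset.card_image_of_injective _ Fin.succAbove_right_injective]

/-- The common row contributes its squared norm to each of the two determinants, hence the exponent
`2`. Row `j` of `B` does not occur and integrates to one. -/
theorem lintegral_mixSq_insertNth {n : ℕ} {S : Finset (Fin (n + 1))} {j : Fin (n + 1)}
    (hj : j ∈ S) (a : Fin (n + 1) → ℂ) :
    ∫⁻ X, ∫⁻ B, mixSq S (j.insertNth a X) B ∂gaussMat (n + 1) (n + 1) ∂gaussMat n (n + 1) =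
      ENNReal.ofReal (normSqVec a) ^ 2 *
        mixMoment n (Finset.univ.filter fun i => j.succAbove i ∈ S) := by
  set S' := Finset.univ.filter fun i => j.succAbove i ∈ S
  obtain ⟨Q, hQ, hQ', h⟩ := exists_unitary_detSq_insertNth a
  have hmp := measurePreserving_tail_vecMul n n hQ hQ'
  let t : (Fin n → Fin (n + 1) → ℂ) → Fin n → Fin n → ℂ := fun X i k => (X i ᵥ* Q) k.succ
  have h2 : ∀ (b : Fin (n + 1) → ℂ) (X Y : Fin n → Fin (n + 1) → ℂ),
      mixSq S (j.insertNth a X) (j.insertNth b Y) =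
        ENNReal.ofReal (normSqVec a) ^ 2 * mixSq S' (t X) (t Y) := by
    intro b X Y
    have h3 : (fun (i : Fin n) (k : Fin n) => ((mixRows S' X Y) i ᵥ* Q) k.succ) =
        mixRows S' (t X) (t Y) := by
      funext i k
      simp only [mixRows, t]
      split_ifs <;> rfl
    rw [mixSq, mixRows_insertNth hj, h, h, h3, mixSq]
    ring
  have h1 : ∀ X : Fin n → Fin (n + 1) → ℂ,
      ∫⁻ B, mixSq S (j.insertNth a X) B ∂gaussMat (n + 1) (n + 1) =
        ENNReal.ofReal (normSqVec a) ^ 2 * ∫⁻ B, mixSq S' (t X) B ∂gaussMat n n := by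
    intro X
    rw [lintegral_pi_insertNth _ j (measurable_mixSq S _)]
    simp only [h2]
    rw [lintegral_const, measure_univ, mul_one]
    exact lintegral_const_mul_comp hmp _ (measurable_mixSq S' (t X))
  simp only [h1]
  have hmf : Measurable fun A => ∫⁻ B, mixSq S' A B ∂gaussMat n n :=
    (measurable_uncurry_mixSq S').lintegral_prod_right'
  exact lintegral_const_mul_comp hmp _ hmf

theorem mixMoment_empty (n : ℕ) :
    mixMoment n ∅ = (n.factorial : ℝ≥0∞) * (n.factorial : ℝ≥0∞) := by
  have h1 : ∀ A : Fin n → Fin n → ℂ, ∫⁻ B, mixSq ∅ A B ∂gaussMat n n =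
      detSq A * (n.factorial : ℝ≥0∞) := by
    intro A
    rw [← lintegral_detSq, ← lintegral_const_mul _ measurable_detSq]
    rfl
  simp only [mixMoment, h1]
  rw [lintegral_mul_const _ measurable_detSq, lintegral_detSq]

/-- Correlation of two Gaussian determinants sharing the rows with index in `S`. -/
theorem mixMoment_mul (n : ℕ) (S : Finset (Fin n)) :
    mixMoment n S * ((n + 1 - S.card : ℕ) : ℝ≥0∞) =
      (n.factorial : ℝ≥0∞) * ((n + 1).factorial : ℝ≥0∞) := by
  induction n with
  | zero => simp [Finset.eq_empty_of_isEmpty S, mixMoment_empty]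
  | succ n ih =>
    rcases S.eq_empty_or_nonempty with rfl | ⟨j, hj⟩
    · rw [mixMoment_empty, Finset.card_empty, Nat.factorial_succ (n + 1)]
      push_cast
      ring
    · have hm : Measurable fun A => ∫⁻ B, mixSq S A B ∂gaussMat (n + 1) (n + 1) :=
        (measurable_uncurry_mixSq S).lintegral_prod_right'
      have hc := card_filter_succAbove hj
      rw [mixMoment, lintegral_pi_insertNth _ j hm]
      simp only [lintegral_mixSq_insertNth hj]
      -- The removed row contributes `(n + 1) (n + 2)`, which is the ratio of `(n + 1)! (n + 2)!` to
      -- `n! (n + 1)!`. The factor on the left is unchanged, since the matrix size and the number of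
      -- common rows drop together.
      rw [lintegral_mul_const _ (by fun_prop), lintegral_gaussVec_normSqVec_sq, mul_assoc, hc,
        show n + 1 + 1 - ((Finset.univ.filter fun i => j.succAbove i ∈ S).card + 1) =
          n + 1 - (Finset.univ.filter fun i => j.succAbove i ∈ S).card by omega, ih,
        Nat.factorial_succ (n + 1), Nat.factorial_succ n]
      push_cast
      ring

end DetCorrelation
end SphericalEnsemble
end

noncomputable section
namespace SphericalEnsemble
open MeasureTheory ProbabilityTheory Set Filter
open scoped ENNReal Topology Matrix

/-! ### From common rows to the characteristic determinants of a pencil at two points. -/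

section DetCorrelation

/-- Flipping the sign of one row. -/
def negRow {k : ℕ} (m : ℕ) (j : Fin k) : (Fin k → Fin m → ℂ) ≃ₗ[ℝ] (Fin k → Fin m → ℂ) where
  toFun B i := if i = j then -B i else B i
  invFun B i := if i = j then -B i else B i
  map_add' X Y := by funext i; by_cases h : i = j <;> simp [h, add_comm]
  map_smul' c X := by funext i; by_cases h : i = j <;> simp [h]
  left_inv X := by funext i; by_cases h : i = j <;> simp [h]
  right_inv X := by funext i; by_cases h : i = j <;> simp [h]

theorem frob_negRow {k m : ℕ} (j : Fin k) (B : Fin k → Fin m → ℂ) :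
    frob (negRow m j B) = frob B := by
  refine Finset.sum_congr rfl fun i _ => ?_
  by_cases h : i = j <;> simp [negRow, h, normSqVec]

/-- Matrix with rows `A i` for `i ∈ S`, rows `B i` for `i ∈ T \ S`, and rows `s A i + t B i`
outside of `T`. -/
def combRows {n : ℕ} (s t : ℂ) (S T : Finset (Fin n)) (A B : Fin n → Fin n → ℂ) :
    Fin n → Fin n → ℂ :=
  fun i => if i ∈ S then A i else if i ∈ T then B i else s • A i + t • B i

theorem continuous_combRows {n : ℕ} (s t : ℂ) (S T : Finset (Fin n)) :
    Continuous fun p : (Fin n → Fin n → ℂ) × (Fin n → Fin n → ℂ) =>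
      combRows s t S T p.1 p.2 := by
  refine continuous_pi fun i => ?_
  unfold combRows
  split_ifs <;> fun_prop

theorem measurable_detSq_combRows {n : ℕ} (s t : ℂ) (S T : Finset (Fin n))
    (A : Fin n → Fin n → ℂ) : Measurable fun B => detSq (combRows s t S T A B) :=
  Continuous.measurable_detSq (f := fun B => combRows s t S T A B)
    ((continuous_combRows s t S T).comp (Continuous.prodMk_right A))

/-- All the matrices involved differ in row `j` only; this form makes multilinearity of the
determinant in that row available. -/
theorem combRows_eq_update {n : ℕ} (s t : ℂ) {S T : Finset (Fin n)} {j : Fin n} (hS : j ∉ S)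
    (hT : j ∉ T) (A B : Fin n → Fin n → ℂ) :
    combRows s t S T A B =
        Function.update (combRows s t S T A B) j (s • A j + t • B j) ∧
      combRows s t S (insert j T) A B = Function.update (combRows s t S T A B) j (B j) ∧
      combRows s t (insert j S) (insert j T) A B =
        Function.update (combRows s t S T A B) j (A j) ∧
      combRows s t S T A (negRow n j B) =
        Function.update (combRows s t S T A B) j (s • A j - t • B j) := by
  refine ⟨?_, ?_, ?_, ?_⟩
  all_goals
    funext i
    by_cases h : i = j
    · subst h
      simp [combRows, hS, hT, negRow, sub_eq_add_neg]
    · simp [combRows, h, negRow]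

/-- The determinant is linear in row `j`, so this is the parallelogram identity `|sα + tβ|² + |sα -
tβ|² = 2 (|s|² |α|² + |t|² |β|²)`. -/
theorem detSq_add_detSq_negRow {n : ℕ} (s t : ℂ) {S T : Finset (Fin n)} {j : Fin n} (hS : j ∉ S)
    (hT : j ∉ T) (A B : Fin n → Fin n → ℂ) :
    detSq (combRows s t S T A B) + detSq (combRows s t S T A (negRow n j B)) =
      2 * (ENNReal.ofReal (Complex.normSq s) *
          detSq (combRows s t (insert j S) (insert j T) A B) +
        ENNReal.ofReal (Complex.normSq t) * detSq (combRows s t S (insert j T) A B)) := by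
  obtain ⟨h1, h2, h3, h4⟩ := combRows_eq_update s t hS hT A B
  rw [h2, h3, h4, h1]
  have e : ∀ v : Fin n → ℂ, Matrix.of (Function.update (combRows s t S T A B) j v) =
    Matrix.updateRow (Matrix.of (combRows s t S T A B)) j v := fun v => rfl
  rw [Function.update_idem, Function.update_idem, Function.update_idem]
  simp only [detSq, e]
  rw [sub_eq_add_neg, ← neg_smul, Matrix.det_updateRow_add, Matrix.det_updateRow_add,
    Matrix.det_updateRow_smul, Matrix.det_updateRow_smul, Matrix.det_updateRow_smul]
  set α := (Matrix.updateRow (Matrix.of (combRows s t S T A B)) j (A j)).det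
  set β := (Matrix.updateRow (Matrix.of (combRows s t S T A B)) j (B j)).det
  have hn := Complex.normSq_nonneg
  rw [← ENNReal.ofReal_add (hn _) (hn _), ← ENNReal.ofReal_mul (hn _),
    ← ENNReal.ofReal_mul (hn _), ← ENNReal.ofReal_add (mul_nonneg (hn _) (hn _))
      (mul_nonneg (hn _) (hn _)),
    show (2 : ℝ≥0∞) = ENNReal.ofReal 2 by simp, ← ENNReal.ofReal_mul two_pos.le]
  congr 1
  simp only [Complex.normSq_apply, Complex.add_re, Complex.add_im, Complex.mul_re, Complex.mul_im,
    Complex.neg_re, Complex.neg_im]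
  ring

/-- Changing the sign of row `j` of `B` preserves the Gaussian law, so averaging the parallelogram
identity removes the cross terms. -/
theorem lintegral_detSq_combRows_insert {n : ℕ} (s t : ℂ) {S T : Finset (Fin n)} {j : Fin n}
    (hS : j ∉ S) (hT : j ∉ T) (A : Fin n → Fin n → ℂ) :
    ∫⁻ B, detSq (combRows s t S T A B) ∂gaussMat n n =
      ENNReal.ofReal (Complex.normSq s) *
          ∫⁻ B, detSq (combRows s t (insert j S) (insert j T) A B) ∂gaussMat n n +
        ENNReal.ofReal (Complex.normSq t) *
          ∫⁻ B, detSq (combRows s t S (insert j T) A B) ∂gaussMat n n := by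
  have hm := measurable_detSq_combRows (n := n) s t
  have h := (measurePreserving_gaussMat (negRow n j) (frob_negRow j)).2
  have h2 := lintegral_congr (μ := gaussMat n n) (detSq_add_detSq_negRow s t hS hT A)
  rw [lintegral_add_left (hm _ _ A), lintegral_const_mul _ (by fun_prop),
    lintegral_add_left (by fun_prop), lintegral_const_mul _ (hm _ _ A),
    lintegral_const_mul _ (hm _ _ A), h.lintegral_comp (hm S T A), ← two_mul] at h2
  exact (ENNReal.mul_right_inj two_ne_zero ENNReal.ofNat_ne_top).1 h2

/-- Iterate the previous step over the rows in `T`; `S` records those for which the row of `A` was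
selected. -/
theorem lintegral_detSq_combRows_eq_sum {n : ℕ} (s t : ℂ) (A : Fin n → Fin n → ℂ)
    (T : Finset (Fin n)) :
    ∫⁻ B, detSq (combRows s t ∅ ∅ A B) ∂gaussMat n n =
      ∑ S ∈ T.powerset, ENNReal.ofReal (Complex.normSq s) ^ S.card *
        ENNReal.ofReal (Complex.normSq t) ^ (T.card - S.card) *
        ∫⁻ B, detSq (combRows s t S T A B) ∂gaussMat n n := by
  induction T using Finset.induction_on with
  | empty => simp
  | insert j T hj ih =>
    rw [ih, Finset.sum_powerset_insert hj, ← Finset.sum_add_distrib]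
    refine Finset.sum_congr rfl fun S hS => ?_
    have hST := Finset.mem_powerset.1 hS
    have hjS : j ∉ S := fun h => hj (hST h)
    have hle := Finset.card_le_card hST
    rw [lintegral_detSq_combRows_insert s t hjS hj, Finset.card_insert_of_notMem hj,
      Finset.card_insert_of_notMem hjS, show T.card + 1 - S.card = (T.card - S.card) + 1 by omega,
      Nat.add_sub_add_right]
    ring

/-- Expanding over the set `S` of rows taken from `A` and using `C(n, m) / (n + 1 - m) = C(n + 1, m)
/ (n + 1)`, the expectation is `n!² ∑_{m ≤ n} C(n + 1, m) |s|^(2m) |t|^(2(n - m))`. Multiplied by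
`|t|²` it is a binomial expansion without the term `m = n + 1`; that term is added on the left,
which avoids subtraction in `ℝ≥0∞`. -/
theorem lintegral_detSq_mul_detSq_comb (n : ℕ) (s t : ℂ) :
    ENNReal.ofReal (Complex.normSq t) *
        (∫⁻ A, ∫⁻ B, detSq A * detSq (s • A + t • B) ∂gaussMat n n ∂gaussMat n n) +
      (n.factorial : ℝ≥0∞) ^ 2 * ENNReal.ofReal (Complex.normSq s) ^ (n + 1) =
    (n.factorial : ℝ≥0∞) ^ 2 *
      (ENNReal.ofReal (Complex.normSq s) + ENNReal.ofReal (Complex.normSq t)) ^ (n + 1) := by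
  set σ := ENNReal.ofReal (Complex.normSq s)
  set τ := ENNReal.ofReal (Complex.normSq t)
  have h1 : ∀ A : Fin n → Fin n → ℂ, ∫⁻ B, detSq A * detSq (s • A + t • B) ∂gaussMat n n =
      ∑ S : Finset (Fin n), σ ^ S.card * τ ^ (n - S.card) * ∫⁻ B, mixSq S A B ∂gaussMat n n := by
    intro A
    have h2 : ∀ B, s • A + t • B = combRows s t ∅ ∅ A B := by
      intro B
      funext i
      simp [combRows]
    simp only [h2]
    rw [lintegral_const_mul _ (measurable_detSq_combRows s t _ _ A),
      lintegral_detSq_combRows_eq_sum s t A Finset.univ, Finset.mul_sum, Finset.powerset_univ]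
    refine Finset.sum_congr rfl fun S _ => ?_
    have h3 : ∀ B, combRows s t S Finset.univ A B = mixRows S A B := by
      intro B
      funext i
      simp [combRows, mixRows]
    simp only [h3, mixSq, Finset.card_univ, Fintype.card_fin]
    rw [lintegral_const_mul _ (Continuous.measurable_detSq (f := fun B => mixRows S A B)
      ((continuous_mixRows S).comp (Continuous.prodMk_right A)))]
    ring
  have h4 : ∫⁻ A, ∫⁻ B, detSq A * detSq (s • A + t • B) ∂gaussMat n n ∂gaussMat n n =
      ∑ S : Finset (Fin n), σ ^ S.card * τ ^ (n - S.card) * mixMoment n S := by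
    simp only [h1]
    have hm : ∀ S : Finset (Fin n), Measurable fun A => ∫⁻ B, mixSq S A B ∂gaussMat n n :=
      fun S => (measurable_uncurry_mixSq S).lintegral_prod_right'
    rw [lintegral_finsetSum _ fun S _ => (hm S).const_mul _]
    exact Finset.sum_congr rfl fun S _ => lintegral_const_mul _ (hm S)
  have h5 : ∀ S : Finset (Fin n), ((n.choose S.card : ℕ) : ℝ≥0∞) * mixMoment n S =
      (n.factorial : ℝ≥0∞) ^ 2 * ((n + 1).choose S.card : ℕ) := by
    intro S
    have hle : S.card ≤ n := by simpa using Finset.card_le_univ S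
    have hm := mixMoment_mul n S
    have hne : ((n + 1 - S.card : ℕ) : ℝ≥0∞) ≠ 0 := by
      exact_mod_cast (by omega : n + 1 - S.card ≠ 0)
    rw [← ENNReal.mul_left_inj hne (ENNReal.natCast_ne_top _), mul_assoc, hm]
    have hc := Nat.choose_mul_succ_eq n S.card
    have hc' : ((n.choose S.card : ℕ) : ℝ≥0∞) * ((n + 1 : ℕ) : ℝ≥0∞) =
        ((n + 1).choose S.card : ℕ) * ((n + 1 - S.card : ℕ) : ℝ≥0∞) := by exact_mod_cast hc
    rw [mul_assoc, ← hc', Nat.factorial_succ]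
    push_cast
    ring
  have h6 : ∑ S : Finset (Fin n), σ ^ S.card * τ ^ (n - S.card) * mixMoment n S =
      ∑ m ∈ Finset.range (n + 1), (n.factorial : ℝ≥0∞) ^ 2 * ((n + 1).choose m : ℕ) *
        (σ ^ m * τ ^ (n - m)) := by
    -- The moment depends on `S` through its cardinality only, so the sum can be grouped by size.
    have h7 : ∀ S : Finset (Fin n), σ ^ S.card * τ ^ (n - S.card) * mixMoment n S =
        σ ^ S.card * τ ^ (n - S.card) *
          ((n.factorial : ℝ≥0∞) ^ 2 * ((n + 1).choose S.card : ℕ) / (n.choose S.card : ℕ)) := by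
      intro S
      have hle : S.card ≤ n := by simpa using Finset.card_le_univ S
      have hpos : ((n.choose S.card : ℕ) : ℝ≥0∞) ≠ 0 := by
        exact_mod_cast (Nat.choose_pos hle).ne'
      rw [← h5, mul_comm ((n.choose S.card : ℕ) : ℝ≥0∞),
        ENNReal.mul_div_cancel_right hpos (ENNReal.natCast_ne_top _)]
    rw [Finset.sum_congr rfl fun S _ => h7 S, ← Finset.powerset_univ,
      Finset.sum_powerset_apply_card (fun m => σ ^ m * τ ^ (n - m) *
        ((n.factorial : ℝ≥0∞) ^ 2 * ((n + 1).choose m : ℕ) / (n.choose m : ℕ))),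
      Finset.card_univ, Fintype.card_fin]
    refine Finset.sum_congr rfl fun m hm => ?_
    have hle : m ≤ n := Nat.lt_succ_iff.1 (Finset.mem_range.1 hm)
    have hpos : ((n.choose m : ℕ) : ℝ≥0∞) ≠ 0 := by exact_mod_cast (Nat.choose_pos hle).ne'
    rw [nsmul_eq_mul, mul_left_comm,
      ENNReal.mul_div_cancel hpos (ENNReal.natCast_ne_top _)]
    ring
  rw [h4, h6, add_pow, Finset.sum_range_succ _ (n + 1), mul_add, Finset.mul_sum, Finset.mul_sum]
  congr 1
  · refine Finset.sum_congr rfl fun m hm => ?_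
    have hle : m ≤ n := Nat.lt_succ_iff.1 (Finset.mem_range.1 hm)
    rw [show n + 1 - m = (n - m) + 1 by omega]
    ring
  · simp

theorem sqrt_one_add_normSq_mul_self (w : ℂ) :
    (Real.sqrt (1 + Complex.normSq w) : ℂ) * Real.sqrt (1 + Complex.normSq w) =
      1 + w * starRingEnd ℂ w := by
  rw [← Complex.ofReal_mul, Real.mul_self_sqrt (by linarith [Complex.normSq_nonneg w]),
    Complex.mul_conj]
  push_cast
  rfl

theorem sqrt_one_add_normSq_ne_zero (w : ℂ) : (Real.sqrt (1 + Complex.normSq w) : ℂ) ≠ 0 := by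
  have : 0 < Real.sqrt (1 + Complex.normSq w) :=
    Real.sqrt_pos.2 (by linarith [Complex.normSq_nonneg w])
  exact_mod_cast this.ne'

/-- The unitary change of coordinates on pencils sending the parameter `w` to a base point. -/
def pencilRotation (n : ℕ) (w : ℂ) :
    ((Fin n → Fin n → ℂ) × (Fin n → Fin n → ℂ)) ≃ₗ[ℝ]
      ((Fin n → Fin n → ℂ) × (Fin n → Fin n → ℂ)) where
  toFun p := ((Real.sqrt (1 + Complex.normSq w) : ℂ)⁻¹ • (w • p.1 - p.2),
    (Real.sqrt (1 + Complex.normSq w) : ℂ)⁻¹ • (p.1 + starRingEnd ℂ w • p.2))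
  invFun p := ((Real.sqrt (1 + Complex.normSq w) : ℂ)⁻¹ • (starRingEnd ℂ w • p.1 + p.2),
    (Real.sqrt (1 + Complex.normSq w) : ℂ)⁻¹ • (w • p.2 - p.1))
  map_add' X Y := by
    ext i j <;> simp only [Prod.fst_add, Prod.snd_add, Pi.add_apply, Pi.sub_apply, Pi.smul_apply,
      smul_eq_mul] <;> ring
  map_smul' c X := by
    ext i j <;> simp only [Prod.smul_fst, Prod.smul_snd, Pi.add_apply, Pi.sub_apply,
      Pi.smul_apply, smul_eq_mul, Complex.real_smul, RingHom.id_apply] <;> ring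
  left_inv X := by
    have h := sqrt_one_add_normSq_mul_self w
    ext i j <;> simp only [Pi.add_apply, Pi.sub_apply, Pi.smul_apply, smul_eq_mul] <;>
      field_simp [sqrt_one_add_normSq_ne_zero w] <;> rw [pow_two, h] <;> ring
  right_inv X := by
    have h := sqrt_one_add_normSq_mul_self w
    ext i j <;> simp only [Pi.add_apply, Pi.sub_apply, Pi.smul_apply, smul_eq_mul] <;>
      field_simp [sqrt_one_add_normSq_ne_zero w] <;> rw [pow_two, h] <;> ring

theorem frob_pencilRotation {n : ℕ} (w : ℂ) (p : (Fin n → Fin n → ℂ) × (Fin n → Fin n → ℂ)) :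
    frob (pencilRotation n w p).1 + frob (pencilRotation n w p).2 = frob p.1 + frob p.2 := by
  simp only [frob, normSqVec, ← Finset.sum_add_distrib]
  refine Finset.sum_congr rfl fun i _ => Finset.sum_congr rfl fun j _ => ?_
  have hpos : 0 < 1 + Complex.normSq w := by linarith [Complex.normSq_nonneg w]
  simp only [pencilRotation, LinearEquiv.coe_mk, LinearMap.coe_mk, AddHom.coe_mk, Pi.add_apply,
    Pi.sub_apply, Pi.smul_apply, smul_eq_mul, map_mul, map_inv₀, Complex.normSq_ofReal,
    Real.mul_self_sqrt hpos.le]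
  rw [← mul_add, inv_mul_eq_iff_eq_mul₀ hpos.ne']
  simp only [Complex.normSq_apply, Complex.add_re, Complex.add_im, Complex.mul_re, Complex.mul_im,
    Complex.sub_re, Complex.sub_im, Complex.conj_re, Complex.conj_im]
  ring

theorem detSq_smul {n : ℕ} (c : ℂ) (M : Fin n → Fin n → ℂ) :
    detSq (c • M) = ENNReal.ofReal (Complex.normSq c) ^ n * detSq M := by
  have : Matrix.of (c • M) = c • Matrix.of M := rfl
  rw [detSq, this, Matrix.det_smul, map_mul, map_pow,
    ENNReal.ofReal_mul (pow_nonneg (Complex.normSq_nonneg _) _),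
    ENNReal.ofReal_pow (Complex.normSq_nonneg _), Fintype.card_fin]
  rfl

/-- Two-point correlation of the characteristic determinant of a Gaussian pencil. -/
theorem normSq_sub_mul_lintegral_detSq_mul_detSq (n : ℕ) (w z : ℂ) :
    ENNReal.ofReal (Complex.normSq (z - w)) *
        (∫⁻ A, ∫⁻ B, detSq (w • A - B) * detSq (z • A - B) ∂gaussMat n n ∂gaussMat n n) +
      (n.factorial : ℝ≥0∞) ^ 2 *
        ENNReal.ofReal (Complex.normSq (1 + z * starRingEnd ℂ w)) ^ (n + 1) =
    (n.factorial : ℝ≥0∞) ^ 2 *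
      ENNReal.ofReal ((1 + Complex.normSq w) * (1 + Complex.normSq z)) ^ (n + 1) := by
  set ρ : ℝ := 1 + Complex.normSq w with hρ
  have hpos : 0 < ρ := by linarith [Complex.normSq_nonneg w]
  set r : ℂ := (Real.sqrt ρ : ℂ)⁻¹ with hr
  have hrr : r * r = (ρ : ℂ)⁻¹ := by
    rw [hr, ← mul_inv, ← Complex.ofReal_mul, Real.mul_self_sqrt hpos.le]
  have hρc : (ρ : ℂ) ≠ 0 := by exact_mod_cast hpos.ne'
  have hρw : (ρ : ℂ) = 1 + w * starRingEnd ℂ w := by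
    rw [Complex.mul_conj, hρ]; push_cast; rfl
  have hnr : ∀ x : ℂ, ENNReal.ofReal ρ * ENNReal.ofReal (Complex.normSq (r * x)) =
      ENNReal.ofReal (Complex.normSq x) := by
    intro x
    rw [← ENNReal.ofReal_mul hpos.le, map_mul, hr, map_inv₀, Complex.normSq_ofReal,
      Real.mul_self_sqrt hpos.le, mul_inv_cancel_left₀ hpos.ne']
  -- These are the coordinates of `z A - B` in the rotated pair: with `A' = r (w A - B)` and `B' = r
  -- (A + conj w B)` one has `z A - B = s A' + t B'`.
  set s : ℂ := r * (1 + z * starRingEnd ℂ w) with hs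
  set t : ℂ := r * (z - w) with ht
  have h := lintegral_detSq_mul_detSq_comb n s t
  have hm : Measurable fun p : (Fin n → Fin n → ℂ) × (Fin n → Fin n → ℂ) =>
      detSq p.1 * detSq (s • p.1 + t • p.2) :=
    (Continuous.measurable_detSq continuous_fst).mul
      (Continuous.measurable_detSq (by fun_prop))
  have hm' : Measurable fun p : (Fin n → Fin n → ℂ) × (Fin n → Fin n → ℂ) =>
      detSq (w • p.1 - p.2) * detSq (z • p.1 - p.2) :=
    (Continuous.measurable_detSq (by fun_prop)).mul
      (Continuous.measurable_detSq (by fun_prop))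
  have hT := measurePreserving_gaussMat_prod (pencilRotation n w) (frob_pencilRotation w)
  have hcomp : ∀ p, detSq (pencilRotation n w p).1 *
      detSq (s • (pencilRotation n w p).1 + t • (pencilRotation n w p).2) =
      ENNReal.ofReal (Complex.normSq r) ^ n * (detSq (w • p.1 - p.2) * detSq (z • p.1 - p.2)) := by
    intro p
    have h1 : (pencilRotation n w p).1 = r • (w • p.1 - p.2) := rfl
    have h2 : s • (pencilRotation n w p).1 + t • (pencilRotation n w p).2 = z • p.1 - p.2 := by
      have h3 : (pencilRotation n w p).2 = r • (p.1 + starRingEnd ℂ w • p.2) := rfl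
      rw [h1, h3]
      ext i j
      simp only [Pi.add_apply, Pi.sub_apply, Pi.smul_apply, smul_eq_mul, hs, ht]
      have : r * (1 + z * starRingEnd ℂ w) * (r * (w * p.1 i j - p.2 i j)) +
          r * (z - w) * (r * (p.1 i j + starRingEnd ℂ w * p.2 i j)) =
          (r * r) * (1 + w * starRingEnd ℂ w) * (z * p.1 i j - p.2 i j) := by ring
      rw [this, hrr, ← hρw, inv_mul_cancel₀ hρc, one_mul]
    rw [h2, h1, detSq_smul, mul_assoc]
  have hI : ∫⁻ A, ∫⁻ B, detSq A * detSq (s • A + t • B) ∂gaussMat n n ∂gaussMat n n =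
      ENNReal.ofReal (Complex.normSq r) ^ n *
        ∫⁻ A, ∫⁻ B, detSq (w • A - B) * detSq (z • A - B) ∂gaussMat n n ∂gaussMat n n := by
    have e1 := lintegral_prod (μ := gaussMat n n) (ν := gaussMat n n) _ hm.aemeasurable
    have e2 := lintegral_prod (μ := gaussMat n n) (ν := gaussMat n n) _ hm'.aemeasurable
    rw [← e1, ← e2, ← lintegral_const_mul _ hm', ← hT.lintegral_comp hm]
    exact lintegral_congr hcomp
  rw [hI] at h
  -- Multiplying by `ρ ^ (n + 1)` cancels the normalizations: `n` factors come from the determinant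
  -- of `w A - B`, the last one from `|t|²`.
  have h' := congrArg (fun x => ENNReal.ofReal ρ ^ (n + 1) * x) h
  simp only [mul_add] at h'
  have hst : ENNReal.ofReal ρ * (ENNReal.ofReal (Complex.normSq s) +
      ENNReal.ofReal (Complex.normSq t)) = ENNReal.ofReal (ρ * (1 + Complex.normSq z)) := by
    rw [mul_add, hnr, hnr, ← ENNReal.ofReal_add (Complex.normSq_nonneg _) (Complex.normSq_nonneg _)]
    congr 1
    simp only [hρ, Complex.normSq_apply, Complex.add_re, Complex.add_im, Complex.mul_re,
      Complex.mul_im, Complex.sub_re, Complex.sub_im, Complex.conj_re, Complex.conj_im,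
      Complex.one_re, Complex.one_im]
    ring
  have hr1 : ENNReal.ofReal ρ * ENNReal.ofReal (Complex.normSq r) = 1 := by
    have := hnr 1
    simpa using this
  rw [← hst, mul_pow, ← hnr (1 + z * starRingEnd ℂ w), ← hnr (z - w)]
  set D := ∫⁻ A, ∫⁻ B, detSq (w • A - B) * detSq (z • A - B) ∂gaussMat n n ∂gaussMat n n
  have e3 : ENNReal.ofReal ρ * ENNReal.ofReal (Complex.normSq (r * (z - w))) * D =
      ENNReal.ofReal ρ ^ (n + 1) * (ENNReal.ofReal (Complex.normSq t) *
        (ENNReal.ofReal (Complex.normSq r) ^ n * D)) := by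
    calc _ = (ENNReal.ofReal ρ * ENNReal.ofReal (Complex.normSq r)) ^ n *
          (ENNReal.ofReal ρ * ENNReal.ofReal (Complex.normSq (r * (z - w))) * D) := by
          rw [hr1, one_pow, one_mul]
      _ = _ := by rw [mul_pow]; ring
  rw [e3, mul_pow]
  calc _ = ENNReal.ofReal ρ ^ (n + 1) * (ENNReal.ofReal (Complex.normSq t) *
        (ENNReal.ofReal (Complex.normSq r) ^ n * D)) + ENNReal.ofReal ρ ^ (n + 1) *
        ((n.factorial : ℝ≥0∞) ^ 2 * ENNReal.ofReal (Complex.normSq s) ^ (n + 1)) := by ring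
    _ = _ := by rw [h']; ring

end DetCorrelation
end SphericalEnsemble
end

noncomputable section
namespace SphericalEnsemble
open MeasureTheory ProbabilityTheory Set Filter Polynomial
open scoped ENNReal Topology Matrix

/-! ### Measurability of functions of the roots of a random polynomial. -/

section MeasurablePolynomials

/-- The σ-algebra on polynomials generated by the coefficients. -/
instance polynomialMeasurableSpace : MeasurableSpace ℂ[X] :=
  MeasurableSpace.comap (fun p => p.coeff) inferInstance

theorem measurable_polynomial_iff {α : Type*} [MeasurableSpace α] {f : α → ℂ[X]} :
    Measurable f ↔ ∀ k, Measurable fun x => (f x).coeff k := by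
  rw [measurable_comap_iff, measurable_pi_iff]
  rfl

theorem measurable_coeff (k : ℕ) : Measurable fun p : ℂ[X] => p.coeff k :=
  measurable_polynomial_iff.1 measurable_id k

theorem measurable_polynomial_add {α : Type*} [MeasurableSpace α] {f g : α → ℂ[X]}
    (hf : Measurable f) (hg : Measurable g) : Measurable fun x => f x + g x := by
  rw [measurable_polynomial_iff] at *
  intro k
  simp only [coeff_add]
  exact (hf k).add (hg k)

theorem measurable_polynomial_mul {α : Type*} [MeasurableSpace α] {f g : α → ℂ[X]}
    (hf : Measurable f) (hg : Measurable g) : Measurable fun x => f x * g x := by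
  rw [measurable_polynomial_iff] at *
  intro k
  simp only [coeff_mul]
  exact Finset.measurable_sum _ fun i _ => (hf i.1).mul (hg i.2)

theorem measurable_polynomial_C {α : Type*} [MeasurableSpace α] {f : α → ℂ}
    (hf : Measurable f) : Measurable fun x => (C (f x) : ℂ[X]) := by
  rw [measurable_polynomial_iff]
  intro k
  by_cases hk : k = 0
  · simpa [hk] using hf
  · simp [coeff_C, hk]

theorem measurable_polynomial_sum {α ι : Type*} [MeasurableSpace α] (s : Finset ι)
    {f : ι → α → ℂ[X]} (hf : ∀ i, Measurable (f i)) : Measurable fun x => ∑ i ∈ s, f i x := by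
  classical
  induction s using Finset.induction_on with
  | empty => simp
  | insert i s hi ih =>
    simp only [Finset.sum_insert hi]
    exact measurable_polynomial_add (hf i) ih

theorem measurable_polynomial_prod {α ι : Type*} [MeasurableSpace α] (s : Finset ι)
    {f : ι → α → ℂ[X]} (hf : ∀ i, Measurable (f i)) : Measurable fun x => ∏ i ∈ s, f i x := by
  classical
  induction s using Finset.induction_on with
  | empty => simp
  | insert i s hi ih =>
    simp only [Finset.prod_insert hi]
    exact measurable_polynomial_mul (hf i) ih

theorem measurable_polynomial_det {α : Type*} [MeasurableSpace α] {n : ℕ}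
    {M : α → Matrix (Fin n) (Fin n) ℂ[X]} (hM : ∀ i j, Measurable fun x => M x i j) :
    Measurable fun x => (M x).det := by
  simp only [Matrix.det_apply']
  refine measurable_polynomial_sum _ fun σ => measurable_polynomial_mul measurable_const ?_
  exact measurable_polynomial_prod _ fun i => hM _ _

theorem measurable_of_countable_cover {α β : Type*} [MeasurableSpace α] [MeasurableSpace β]
    {f : α → β} {S : ℕ → Set α} {g : ℕ → α → β} (hS : ∀ k, MeasurableSet (S k))
    (hg : ∀ k, Measurable (g k)) (hfg : ∀ k, ∀ x ∈ S k, f x = g k x) (hcov : ∀ x, ∃ k, x ∈ S k) :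
    Measurable f := by
  intro t ht
  have : f ⁻¹' t = ⋃ k, S k ∩ g k ⁻¹' t := by
    ext x
    simp only [mem_iUnion, mem_inter_iff, mem_preimage]
    constructor
    · intro hx
      obtain ⟨k, hk⟩ := hcov x
      exact ⟨k, hk, hfg k x hk ▸ hx⟩
    · rintro ⟨k, hk, hx⟩
      rw [hfg k x hk]
      exact hx
  rw [this]
  exact MeasurableSet.iUnion fun k => (hS k).inter (hg k ht)

theorem measurableSet_natDegree_le (k : ℕ) : MeasurableSet {p : ℂ[X] | p.natDegree ≤ k} := by
  have : {p : ℂ[X] | p.natDegree ≤ k} = ⋂ i : ℕ, ⋂ _ : k < i, {p | p.coeff i = 0} := by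
    ext p
    simp [natDegree_le_iff_coeff_eq_zero]
  rw [this]
  exact MeasurableSet.iInter fun i => MeasurableSet.iInter fun _ =>
    measurable_coeff i (measurableSet_singleton 0)

theorem measurable_polynomial_eval :
    Measurable fun x : ℂ × ℂ[X] => x.2.eval x.1 := by
  refine measurable_of_countable_cover (S := fun k => {x | x.2.natDegree ≤ k})
    (g := fun k x => ∑ i ∈ Finset.range (k + 1), x.2.coeff i * x.1 ^ i)
    (fun k => measurable_snd (measurableSet_natDegree_le k)) (fun k => ?_) (fun k x hx => ?_)
    fun x => ⟨x.2.natDegree, le_refl x.2.natDegree⟩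
  · exact Finset.measurable_sum _ fun i _ =>
      ((measurable_coeff i).comp measurable_snd).mul (measurable_fst.pow_const i)
  · exact eval_eq_sum_range' (Nat.lt_succ_of_le hx) _

/-- The monic polynomial with prescribed lower coefficients. -/
def monicOfCoeffs (k : ℕ) (c : Fin k → ℂ) : ℂ[X] := X ^ k + ∑ i, C (c i) * X ^ (i : ℕ)

theorem monicOfCoeffs_coeff {p : ℂ[X]} (hp : p.Monic) :
    monicOfCoeffs p.natDegree (fun i => p.coeff i) = p := by
  conv_rhs => rw [hp.as_sum]
  rw [monicOfCoeffs, Finset.sum_range]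

theorem exists_roots_eq (p : ℂ[X]) {k : ℕ} (hk : p.natDegree = k) :
    ∃ t : Fin k → ℂ, p.roots = (Finset.univ : Finset (Fin k)).val.map t := by
  have hcard : p.roots.card = k := by
    rw [← hk]
    exact (IsAlgClosed.splits p).natDegree_eq_card_roots.symm
  obtain ⟨l, hl⟩ := Quot.exists_rep p.roots
  have hlen : l.length = k := by rw [← hcard, ← hl]; rfl
  subst hlen
  refine ⟨l.get, ?_⟩
  rw [← hl]
  simp [Fin.univ_def]

/-- A function of the multiset of roots is measurable as soon as it is measurable as a function of
labelled roots. -/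
theorem measurable_roots {T : ℂ → Multiset ℂ → ℝ≥0∞}
    (hT : ∀ k : ℕ, Measurable fun x : ℂ × (Fin k → ℂ) =>
      T x.1 ((Finset.univ : Finset (Fin k)).val.map x.2)) :
    Measurable fun x : ℂ × ℂ[X] => T x.1 x.2.roots := by
  have hk : ∀ k : ℕ, Measurable fun x : ℂ × (Fin k → ℂ) => T x.1 (monicOfCoeffs k x.2).roots := by
    intro k
    let V : (Fin k → ℂ) → ℂ[X] := fun t => ∏ i, (X - C (t i))
    have hVmon : ∀ t, (V t).Monic := fun t => monic_prod_of_monic _ _ fun i _ =>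
      monic_X_sub_C (t i)
    have hVdeg : ∀ t, (V t).natDegree = k := fun t => by
      simp [V, natDegree_prod_of_monic _ (fun i => X - C (t i)) fun i _ => monic_X_sub_C (t i)]
    let e : ℂ × (Fin k → ℂ) → ℂ × (Fin k → ℂ) := fun x => (x.1, fun i => (V x.2).coeff i)
    have hVm : Measurable V := measurable_polynomial_prod _ fun i => by
      simp only [sub_eq_add_neg, ← C_neg]
      exact measurable_polynomial_add measurable_const
        (measurable_polynomial_C (measurable_pi_apply i).neg)
    have he : Measurable e := measurable_fst.prodMk (measurable_pi_lambda _ fun i =>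
      (measurable_coeff i).comp (hVm.comp measurable_snd))
    have hVP : ∀ t, monicOfCoeffs k (fun i => (V t).coeff i) = V t := by
      intro t
      have := monicOfCoeffs_coeff (hVmon t)
      rw [hVdeg t] at this
      exact this
    have hsurj : Function.Surjective e := by
      rintro ⟨z, c⟩
      have hdeg : (∑ i : Fin k, C (c i) * X ^ (i : ℕ)).degree < (k : WithBot ℕ) :=
        degree_sum_fin_lt c
      have hmon : (monicOfCoeffs k c).Monic := monic_X_pow_add hdeg
      have hnat : (monicOfCoeffs k c).natDegree = k :=
        natDegree_eq_of_degree_eq_some (by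
          rw [monicOfCoeffs, degree_add_eq_left_of_degree_lt (by simpa using hdeg), degree_X_pow])
      obtain ⟨t, ht⟩ := exists_roots_eq _ hnat
      refine ⟨(z, t), Prod.ext rfl ?_⟩
      have hV : V t = monicOfCoeffs k c := by
        have h1 := (IsAlgClosed.splits (monicOfCoeffs k c)).eq_prod_roots_of_monic hmon
        rw [h1, ht, Multiset.map_map]
        rfl
      funext i
      change (V t).coeff i = c i
      rw [hV]
      simp only [monicOfCoeffs, coeff_add, coeff_X_pow, i.2.ne, if_false, zero_add,
        finsetSum_coeff, coeff_C_mul, mul_ite, mul_one, mul_zero, Fin.val_inj]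
      simp
    -- The passage from roots to coefficients is a measurable surjection of standard Borel spaces,
    -- so measurability may be tested after composing with it. No measurable labelling of the roots
    -- has to be chosen.
    rw [← he.measurable_comp_iff_of_surjective hsurj]
    have hcomp : ((fun x : ℂ × (Fin k → ℂ) => T x.1 (monicOfCoeffs k x.2).roots) ∘ e) =
        fun x => T x.1 ((Finset.univ : Finset (Fin k)).val.map x.2) := by
      funext x
      change T x.1 (monicOfCoeffs k fun i => (V x.2).coeff i).roots = _
      rw [hVP, show V x.2 = ((Finset.univ.val.map x.2).map fun a => X - C a).prod by
        rw [Multiset.map_map]; rfl, roots_multiset_prod_X_sub_C]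
    rw [hcomp]
    exact hT k
  -- Split by degree and divide by the leading coefficient. The zero polynomial is put in the piece
  -- `k = 0`, where it is replaced by the constant `1`: neither has roots.
  refine measurable_of_countable_cover
    (S := fun k => {x | x.2.natDegree ≤ k ∧ x.2.coeff k ≠ 0} ∪ {x | k = 0 ∧ x.2.coeff 0 = 0 ∧
      x.2.natDegree ≤ 0})
    (g := fun k x => T x.1 (monicOfCoeffs k fun i => x.2.coeff i / x.2.coeff k).roots)
    (fun k => ?_) (fun k => ?_) (fun k x hx => ?_) fun x => ?_
  · have h0 : MeasurableSet {x : ℂ × ℂ[X] | k = 0 ∧ x.2.coeff 0 = 0 ∧ x.2.natDegree ≤ 0} := by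
      by_cases hk0 : k = 0
      · simp only [hk0, true_and]
        exact (((measurable_coeff 0).comp measurable_snd) (measurableSet_singleton 0)).inter
          (measurable_snd (measurableSet_natDegree_le 0))
      · simp [hk0]
    exact ((measurable_snd (measurableSet_natDegree_le k)).inter
      (((measurable_coeff k).comp measurable_snd) (measurableSet_singleton 0)).compl).union h0
  · exact (hk k).comp (measurable_fst.prodMk (measurable_pi_lambda _ fun i =>
      ((measurable_coeff i).comp measurable_snd).div ((measurable_coeff k).comp measurable_snd)))
  · rcases hx with ⟨h1, h2⟩ | ⟨rfl, h1, h2⟩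
    · have hdeg : x.2.natDegree = k := natDegree_eq_of_le_of_coeff_ne_zero h1 h2
      have hne : (x.2.coeff k)⁻¹ ≠ 0 := inv_ne_zero h2
      have hmon : (C (x.2.coeff k)⁻¹ * x.2).Monic := by
        rw [Monic, leadingCoeff_mul, leadingCoeff_C, leadingCoeff, hdeg, inv_mul_cancel₀ h2]
      have hnd : (C (x.2.coeff k)⁻¹ * x.2).natDegree = k := by
        rw [natDegree_C_mul hne, hdeg]
      have h3 := monicOfCoeffs_coeff hmon
      rw [hnd] at h3
      have h4 : (fun i : Fin k => x.2.coeff i / x.2.coeff k) =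
          fun i : Fin k => (C (x.2.coeff k)⁻¹ * x.2).coeff i := by
        funext i
        rw [coeff_C_mul, div_eq_inv_mul]
      simp only [h4, h3]
      rw [roots_C_mul _ hne]
    · have : x.2 = 0 := by
        rw [eq_C_of_natDegree_le_zero h2, h1, C_0]
      simp [this, monicOfCoeffs]
  · by_cases h : x.2 = 0
    · exact ⟨0, Or.inr ⟨rfl, by simp [h], by simp [h]⟩⟩
    · exact ⟨x.2.natDegree, Or.inl ⟨le_rfl, by simpa using h⟩⟩

end MeasurablePolynomials
end SphericalEnsemble
end

noncomputable section
namespace SphericalEnsemble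
open MeasureTheory ProbabilityTheory Set Filter Polynomial
open scoped ENNReal Topology Matrix

/-! ### Encoding eigenpairs of a pencil as fibres of `eigMap`. -/

section Eigenvectors

/-- The characteristic polynomial `det (X A - B)` of a pencil. -/
def pencil {n : ℕ} (A B : Fin n → Fin n → ℂ) : ℂ[X] :=
  (Matrix.of fun i j => X * C (A i j) - C (B i j)).det

theorem eval_pencil {n : ℕ} (A B : Fin n → Fin n → ℂ) (z : ℂ) :
    (pencil A B).eval z = (Matrix.of (z • A - B)).det := by
  rw [pencil, ← coe_evalRingHom, RingHom.map_det]
  congr 1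
  ext i j
  simp only [RingHom.mapMatrix_apply, Matrix.map_apply, Matrix.of_apply, coe_evalRingHom, eval_sub,
    eval_mul, eval_X, eval_C, Pi.sub_apply, Pi.smul_apply, smul_eq_mul]

theorem measurable_pencil {n : ℕ} :
    Measurable fun p : (Fin n → Fin n → ℂ) × (Fin n → Fin n → ℂ) => pencil p.1 p.2 := by
  refine measurable_polynomial_det fun i j => ?_
  simp only [Matrix.of_apply, sub_eq_add_neg, ← C_neg]
  exact measurable_polynomial_add (measurable_polynomial_mul measurable_const
    (measurable_polynomial_C (by fun_prop))) (measurable_polynomial_C (by fun_prop))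

/-- The eigenvector encoded by `y`: the zeroth coordinate of `y` is the eigenvalue, the zeroth
coordinate of the eigenvector is normalized to one. -/
def eigVec {n : ℕ} (y : Fin (n + 1) → ℂ) : Fin (n + 1) → ℂ := Function.update y 0 1

/-- The image of the eigenvector under `A`. -/
def eigRow {n : ℕ} (A : Fin (n + 1) → Fin (n + 1) → ℂ) (y : Fin (n + 1) → ℂ) :
    Fin (n + 1) → ℂ := A 0 + ∑ i : Fin n, y i.succ • A i.succ

/-- The zeroth row that `B` must have for `y` to encode an eigenvector of the pencil. -/
def eigMap {n : ℕ} (A : Fin (n + 1) → Fin (n + 1) → ℂ) (B : Fin n → Fin (n + 1) → ℂ)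
    (y : Fin (n + 1) → ℂ) : Fin (n + 1) → ℂ := y 0 • eigRow A y - ∑ i : Fin n, y i.succ • B i

/-- The characteristic polynomial of the pencil divided by the linear factor of an eigenvalue. -/
def eigQuot {n : ℕ} (A : Fin (n + 1) → Fin (n + 1) → ℂ) (B : Fin n → Fin (n + 1) → ℂ)
    (y : Fin (n + 1) → ℂ) : ℂ[X] :=
  (Matrix.of (Fin.cons (fun k => C (eigRow A y k))
    fun (i : Fin n) k => X * C (A i.succ k) - C (B i k))).det

theorem eval_eigQuot {n : ℕ} (A : Fin (n + 1) → Fin (n + 1) → ℂ) (B : Fin n → Fin (n + 1) → ℂ)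
    (y : Fin (n + 1) → ℂ) (z : ℂ) :
    (eigQuot A B y).eval z =
      (Matrix.of (Fin.cons (eigRow A y) fun i : Fin n => z • A i.succ - B i)).det := by
  rw [eigQuot, ← coe_evalRingHom, RingHom.map_det]
  congr 1
  ext i j
  refine Fin.cases ?_ (fun i => ?_) i
  · simp
  · simp only [RingHom.mapMatrix_apply, Matrix.map_apply, Matrix.of_apply, coe_evalRingHom,
      eval_sub, eval_mul, eval_X, eval_C, Pi.sub_apply, Pi.smul_apply, smul_eq_mul, Fin.cons_succ]

/-- Replace row zero of `X A - B` by the combination of all rows with the coefficients of the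
eigenvector. The determinant is unchanged because the coefficient of row zero is one, and the new
row is `X - y 0` times `eigRow A y`. -/
theorem pencil_eq_mul_eigQuot {n : ℕ} {A : Fin (n + 1) → Fin (n + 1) → ℂ}
    {B : Fin n → Fin (n + 1) → ℂ} {y b : Fin (n + 1) → ℂ} (h : eigMap A B y = b) :
    pencil A (Fin.cons b B) = (X - C (y 0)) * eigQuot A B y := by
  set M : Matrix (Fin (n + 1)) (Fin (n + 1)) ℂ[X] :=
    Matrix.of fun i j => X * C (A i j) - C ((Fin.cons b B : Fin (n + 1) → _) i j) with hM
  have h1 := Matrix.det_updateRow_sum M 0 fun i => C (eigVec y i)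
  have h2 : (∑ k, C (eigVec y k) • M k) = (X - C (y 0)) • fun k => C (eigRow A y k) := by
    funext k
    have hk := congrFun h k
    simp only [eigMap, eigRow, Pi.sub_apply, Pi.smul_apply, Pi.add_apply, Finset.sum_apply,
      smul_eq_mul] at hk
    simp only [Finset.sum_apply, Pi.smul_apply, smul_eq_mul, Fin.sum_univ_succ, eigRow,
      Pi.add_apply]
    simp only [eigVec, Function.update_self, hM, Matrix.of_apply, Fin.cons_zero, Fin.cons_succ,
      C_1, one_mul, ← hk, C_add, C_sub, C_mul, map_sum, ne_eq, Fin.succ_ne_zero, not_false_eq_true,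
      Function.update_of_ne, mul_sub, Finset.sum_sub_distrib, Finset.mul_sum, mul_add, sub_mul]
    have e : ∀ i : Fin n, C (y i.succ) * (X * C (A i.succ k)) = X * (C (y i.succ) * C (A i.succ k)) :=
      fun i => by ring
    simp only [e]
    ring
  rw [h2, Matrix.det_updateRow_smul] at h1
  have h3 : M.updateRow 0 (fun k => C (eigRow A y k)) =
      Matrix.of (Fin.cons (fun k => C (eigRow A y k))
        fun (i : Fin n) k => X * C (A i.succ k) - C (B i k)) := by
    ext1 i j
    refine Fin.cases ?_ (fun i => ?_) i
    · simp
    · rw [Matrix.updateRow_ne (Fin.succ_ne_zero i)]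
      simp [hM]
  rw [h3] at h1
  simp only [eigVec, Function.update_self, C_1, one_smul] at h1
  exact h1.symm

theorem eigMap_eq_iff {n : ℕ} {A : Fin (n + 1) → Fin (n + 1) → ℂ}
    {B : Fin n → Fin (n + 1) → ℂ} {y b : Fin (n + 1) → ℂ} :
    eigMap A B y = b ↔
      eigVec y ᵥ* Matrix.of (y 0 • A - (Fin.cons b B : Fin (n + 1) → Fin (n + 1) → ℂ)) = 0 := by
  have : eigVec y ᵥ* Matrix.of (y 0 • A - (Fin.cons b B : Fin (n + 1) → Fin (n + 1) → ℂ)) =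
      eigMap A B y - b := by
    funext k
    simp only [Matrix.vecMul, dotProduct, Fin.sum_univ_succ, eigVec, Function.update_self,
      Matrix.of_apply, Pi.sub_apply, Pi.smul_apply, smul_eq_mul, Fin.cons_zero, Fin.cons_succ,
      ne_eq, Fin.succ_ne_zero, not_false_eq_true, Function.update_of_ne, one_mul, eigMap, eigRow,
      Pi.add_apply, Finset.sum_apply, mul_sub, Finset.sum_sub_distrib, mul_add, Finset.mul_sum]
    have e : ∀ i : Fin n, y i.succ * (y 0 * A i.succ k) = y 0 * (y i.succ * A i.succ k) :=
      fun i => by ring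
    simp only [e]
    ring
  rw [this, sub_eq_zero]

/-- For a generic pencil, the points encoding eigenvectors correspond to the roots of the
characteristic polynomial, which are simple. -/
theorem tsum_indicator_eigMap {n : ℕ} {A : Fin (n + 1) → Fin (n + 1) → ℂ}
    {B : Fin n → Fin (n + 1) → ℂ} {b : Fin (n + 1) → ℂ}
    (hJ : ∀ y, eigMap A B y = b → (eigQuot A B y).eval (y 0) ≠ 0)
    (hv : ∀ (z : ℂ) (u : Fin n → ℂ), u ≠ 0 →
      u ᵥ* Matrix.of (fun i => z • A i.succ - B i) ≠ 0) (Θ : ℂ → ℂ[X] → ℝ≥0∞) :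
    ∑' y, (eigMap A B ⁻¹' {b}).indicator (fun y => Θ (y 0) (eigQuot A B y)) y =
      ((pencil A (Fin.cons b B)).roots.map fun z =>
        Θ z (pencil A (Fin.cons b B) /ₘ (X - C z))).sum := by
  classical
  set p := pencil A (Fin.cons b B) with hp
  -- By `hv`, a left null vector with vanishing zeroth coordinate is zero. Hence every eigenvector
  -- can be normalized, and an eigenvalue determines its normalized eigenvector.
  have hker : ∀ (z : ℂ) (v : Fin (n + 1) → ℂ), v 0 = 0 →
      v ᵥ* Matrix.of (z • A - (Fin.cons b B : Fin (n + 1) → Fin (n + 1) → ℂ)) = 0 → v = 0 := by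
    intro z v h0 h
    have h1 : (fun i : Fin n => v i.succ) ᵥ* Matrix.of (fun i => z • A i.succ - B i) = 0 := by
      rw [← h]
      funext k
      simp [Matrix.vecMul, dotProduct, Fin.sum_univ_succ, h0]
    have h2 : (fun i : Fin n => v i.succ) = 0 := by
      by_contra hne
      exact hv z _ hne h1
    funext i
    exact Fin.cases h0 (fun i => congrFun h2 i) i
  have hA : ∀ y, eigMap A B y = b → y 0 ∈ p.roots ∧ p.roots.count (y 0) = 1 ∧
      p /ₘ (X - C (y 0)) = eigQuot A B y := by
    intro y hy
    have hfac : p = (X - C (y 0)) * eigQuot A B y := pencil_eq_mul_eigQuot hy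
    have hq := hJ y hy
    have hq0 : eigQuot A B y ≠ 0 := fun h => hq (by rw [h, eval_zero])
    have hp0 : (X - C (y 0)) * eigQuot A B y ≠ 0 := mul_ne_zero (X_sub_C_ne_zero _) hq0
    have hcount : p.roots.count (y 0) = 1 := by
      rw [hfac, roots_mul hp0, roots_X_sub_C, Multiset.count_add, Multiset.count_singleton_self,
        Multiset.count_eq_zero.2 fun h => hq ((mem_roots hq0).1 h)]
    refine ⟨Multiset.count_pos.1 (by rw [hcount]; exact one_pos), hcount, ?_⟩
    rw [hfac, mul_divByMonic_cancel_left _ (monic_X_sub_C _)]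
  have hB : ∀ z ∈ p.roots, ∃ y, eigMap A B y = b ∧ y 0 = z := by
    intro z hz
    have hdet : (Matrix.of (z • A - (Fin.cons b B : Fin (n + 1) → Fin (n + 1) → ℂ))).det = 0 := by
      rw [← eval_pencil]
      exact (mem_roots'.1 hz).2
    obtain ⟨v, hv0, hvz⟩ := Matrix.exists_vecMul_eq_zero_iff.2 hdet
    have h0 : v 0 ≠ 0 := fun h => hv0 (hker z v h hvz)
    refine ⟨Function.update ((v 0)⁻¹ • v) 0 z, eigMap_eq_iff.2 ?_, by simp⟩
    have : eigVec (Function.update ((v 0)⁻¹ • v) 0 z) = (v 0)⁻¹ • v := by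
      funext i
      refine Fin.cases ?_ (fun i => ?_) i <;> simp [eigVec, h0]
    rw [this, Function.update_self, Matrix.smul_vecMul, hvz, smul_zero]
  have huniq : ∀ y y', eigMap A B y = b → eigMap A B y' = b → y 0 = y' 0 → y = y' := by
    intro y y' h h' h0
    have e := eigMap_eq_iff.1 h
    have e' := eigMap_eq_iff.1 h'
    rw [← h0] at e'
    have h1 := hker (y 0) (eigVec y - eigVec y') (by simp [eigVec]) (by
      rw [Matrix.sub_vecMul, e, e', sub_zero])
    funext i
    refine Fin.cases h0 (fun i => ?_) i
    have := congrFun h1 i.succ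
    simpa [eigVec, sub_eq_zero] using this
  choose! Y hY using hB
  have hnodup : p.roots.Nodup := by
    rw [Multiset.nodup_iff_count_eq_one]
    intro z hz
    have := (hA (Y z) (hY z hz).1).2.1
    rwa [(hY z hz).2] at this
  have hmem : ∀ y, eigMap A B y = b → Y (y 0) = y := fun y hy =>
    huniq _ _ (hY _ (hA y hy).1).1 hy (hY _ (hA y hy).1).2
  rw [tsum_eq_sum (s := p.roots.toFinset.image Y), Finset.sum_image]
  · rw [Finset.sum, Multiset.toFinset_val, hnodup.dedup]
    congr 1
    refine Multiset.map_congr rfl fun z hz => ?_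
    have hz' := hY z hz
    rw [indicator_of_mem (show Y z ∈ eigMap A B ⁻¹' {b} from hz'.1), ← (hA _ hz'.1).2.2, hz'.2]
  · intro z hz z' hz' h
    have hz1 := hY z (by simpa using hz)
    have hz2 := hY z' (by simpa using hz')
    rw [← hz1.2, ← hz2.2, h]
  · intro y hy
    apply indicator_of_notMem
    intro hyb
    have hyb' : eigMap A B y = b := hyb
    exact hy (Finset.mem_image.2 ⟨y 0, by simpa using (hA y hyb').1, hmem y hyb'⟩)

end Eigenvectors
end SphericalEnsemble
end

noncomputable section
namespace SphericalEnsemble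
open MeasureTheory ProbabilityTheory Set Filter Polynomial
open scoped ENNReal Topology Matrix

/-! ### Jacobian of `eigMap`, and the exceptional null sets. -/

section Genericity

variable {n : ℕ}

/-- The derivative of `y ↦ y 0 • (c + L y) - (d + K y)`. -/
def eigDeriv (L K : (Fin (n + 1) → ℂ) →L[ℂ] (Fin (n + 1) → ℂ)) (c y : Fin (n + 1) → ℂ) :
    (Fin (n + 1) → ℂ) →L[ℂ] (Fin (n + 1) → ℂ) :=
  (y 0 • L + (ContinuousLinearMap.proj 0).smulRight (c + L y)) - K

/-- The affine form covers both `eigMap`, where `d = 0`, and the parametrization of degenerate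
pencils below. -/
theorem hasStrictFDerivAt_eig (L K : (Fin (n + 1) → ℂ) →L[ℂ] (Fin (n + 1) → ℂ))
    (c d y : Fin (n + 1) → ℂ) :
    HasStrictFDerivAt (fun y : Fin (n + 1) → ℂ => y 0 • (c + L y) - (d + K y))
      (eigDeriv L K c y) y :=
  ((ContinuousLinearMap.proj (R := ℂ) (φ := fun _ : Fin (n + 1) => ℂ) 0).hasStrictFDerivAt.smul
    (L.hasStrictFDerivAt.const_add c)).sub (K.hasStrictFDerivAt.const_add d)

theorem continuous_eigDeriv (L K : (Fin (n + 1) → ℂ) →L[ℂ] (Fin (n + 1) → ℂ))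
    (c : Fin (n + 1) → ℂ) : Continuous (eigDeriv L K c) := by
  rw [continuous_clm_apply]
  intro h
  simp only [eigDeriv, _root_.sub_apply, _root_.add_apply,
    _root_.smul_apply, ContinuousLinearMap.smulRight_apply]
  fun_prop

/-- The real Jacobian of a complex linear map. -/
theorem det_restrictScalars_complex (f : (Fin n → ℂ) →L[ℂ] (Fin n → ℂ)) :
    |(f.restrictScalars ℝ).det| = Complex.normSq (LinearMap.det (f : (Fin n → ℂ) →ₗ[ℂ] _)) := by
  have h : (f.restrictScalars ℝ).det =
      LinearMap.det ((f : (Fin n → ℂ) →ₗ[ℂ] (Fin n → ℂ)).restrictScalars ℝ) := rfl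
  rw [h, LinearMap.det_restrictScalars, Algebra.norm_complex_eq]
  exact abs_of_nonneg (Complex.normSq_nonneg _)

/-- The linear combination of rows with coefficients the coordinates of positive index in `s`. -/
def rowComb (s : Finset (Fin n)) (B : Fin n → Fin (n + 1) → ℂ) :
    (Fin (n + 1) → ℂ) →L[ℂ] (Fin (n + 1) → ℂ) :=
  ∑ i ∈ s, (ContinuousLinearMap.proj (R := ℂ) (φ := fun _ : Fin (n + 1) => ℂ) i.succ).smulRight
    (B i)

theorem rowComb_apply (s : Finset (Fin n)) (B : Fin n → Fin (n + 1) → ℂ) (y : Fin (n + 1) → ℂ) :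
    rowComb s B y = ∑ i ∈ s, y i.succ • B i := by
  simp [rowComb]

theorem eigMap_eq (A : Fin (n + 1) → Fin (n + 1) → ℂ) (B : Fin n → Fin (n + 1) → ℂ) :
    eigMap A B = fun y => y 0 • (A 0 + rowComb Finset.univ (fun i => A i.succ) y) -
      (0 + rowComb Finset.univ B y) := by
  funext y
  simp only [rowComb_apply, zero_add]
  rfl

/-- The real derivative of `eigMap`. -/
def eigMapDeriv (A : Fin (n + 1) → Fin (n + 1) → ℂ) (B : Fin n → Fin (n + 1) → ℂ)
    (y : Fin (n + 1) → ℂ) : (Fin (n + 1) → ℂ) →L[ℝ] (Fin (n + 1) → ℂ) :=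
  (eigDeriv (rowComb Finset.univ fun i => A i.succ) (rowComb Finset.univ B) (A 0)
    y).restrictScalars ℝ

theorem hasStrictFDerivAt_eigMap (A : Fin (n + 1) → Fin (n + 1) → ℂ)
    (B : Fin n → Fin (n + 1) → ℂ) (y : Fin (n + 1) → ℂ) :
    HasStrictFDerivAt (eigMap A B) (eigMapDeriv A B y) y := by
  rw [eigMap_eq]
  exact (hasStrictFDerivAt_eig _ _ _ _ _).restrictScalars ℝ

theorem continuous_eigMapDeriv (A : Fin (n + 1) → Fin (n + 1) → ℂ)
    (B : Fin n → Fin (n + 1) → ℂ) : Continuous (eigMapDeriv A B) := by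
  rw [continuous_clm_apply]
  intro h
  exact (continuous_clm_apply.1 (continuous_eigDeriv _ _ _) h)

/-- The complex derivative sends `h` to `h 0 • eigRow A y + ∑ h i.succ • (y 0 • A i.succ - B i)`, so
its matrix is the transpose of the one whose determinant is `eigQuot` at `y 0`. The real Jacobian is
the squared modulus of the complex one. -/
theorem abs_det_eigMapDeriv (A : Fin (n + 1) → Fin (n + 1) → ℂ)
    (B : Fin n → Fin (n + 1) → ℂ) (y : Fin (n + 1) → ℂ) :
    |(eigMapDeriv A B y).det| = Complex.normSq ((eigQuot A B y).eval (y 0)) := by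
  rw [eigMapDeriv, det_restrictScalars_complex, eval_eigQuot, ← Matrix.det_transpose,
    ← LinearMap.det_toLin']
  congr 2
  refine LinearMap.ext fun h => ?_
  rw [Matrix.toLin'_apply, Matrix.mulVec_transpose]
  funext k
  simp only [eigDeriv, ContinuousLinearMap.coe_coe, _root_.sub_apply,
    _root_.add_apply, _root_.smul_apply,
    ContinuousLinearMap.smulRight_apply, ContinuousLinearMap.proj_apply, rowComb_apply]
  simp only [Matrix.vecMul, dotProduct, Fin.sum_univ_succ, Matrix.of_apply, Fin.cons_zero,
    Fin.cons_succ, Pi.sub_apply, Pi.add_apply, Pi.smul_apply, Finset.sum_apply, smul_eq_mul,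
    eigRow, mul_sub, Finset.sum_sub_distrib, Finset.mul_sum]
  have e : ∀ i : Fin n, h i.succ * (y 0 * A i.succ k) = y 0 * (h i.succ * A i.succ k) :=
    fun i => by ring
  simp only [e]
  ring

/-- For almost every zeroth row of `B`, all encoded eigenvalues are simple. -/
theorem ae_eval_eigQuot_ne_zero (A : Fin (n + 1) → Fin (n + 1) → ℂ)
    (B : Fin n → Fin (n + 1) → ℂ) :
    ∀ᵐ b : Fin (n + 1) → ℂ, ∀ y, eigMap A B y = b → (eigQuot A B y).eval (y 0) ≠ 0 := by
  -- An encoded root is multiple exactly when `y` is a critical point of `eigMap`, and critical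
  -- values are negligible.
  have hnull : volume (eigMap A B '' {y | (eigMapDeriv A B y).det = 0}) = 0 :=
    addHaar_image_eq_zero_of_det_fderivWithin_eq_zero volume
      (fun x _ => (hasStrictFDerivAt_eigMap A B x).hasFDerivAt.hasFDerivWithinAt) fun x hx => hx
  filter_upwards [compl_mem_ae_iff.2 hnull] with b hb y hy h0
  refine hb ⟨y, ?_, hy⟩
  have := abs_det_eigMapDeriv A B y
  rw [h0, map_zero, abs_eq_zero] at this
  exact this

/-- Pencils of rectangular matrices having a left null vector with `j`-th coordinate one. -/
def degenerateSet (A : Fin n → Fin (n + 1) → ℂ) (j : Fin n) : Set (Fin n → Fin (n + 1) → ℂ) :=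
  {B | ∃ (z : ℂ) (u : Fin n → ℂ), u j = 1 ∧ u ᵥ* Matrix.of (fun i => z • A i - B i) = 0}

/-- When `z` and `u` are confined to closed balls, the set is the projection of a closed set along a
compact factor, hence closed; these sets exhaust the whole. -/
theorem measurableSet_degenerateSet (A : Fin n → Fin (n + 1) → ℂ) (j : Fin n) :
    MeasurableSet (degenerateSet A j) := by
  let K : ℕ → Set (ℂ × (Fin n → ℂ)) := fun k =>
    (Metric.closedBall 0 k ×ˢ Metric.closedBall 0 k) ∩ {p | p.2 j = 1}
  have hK : ∀ k, IsCompact (K k) := fun k =>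
    ((isCompact_closedBall _ _).prod (isCompact_closedBall _ _)).inter_right
      (isClosed_eq (by fun_prop) continuous_const)
  let D : ∀ k, Set ((Fin n → Fin (n + 1) → ℂ) × K k) := fun k =>
    {q | (q.2 : ℂ × (Fin n → ℂ)).2 ᵥ*
      Matrix.of (fun i => (q.2 : ℂ × (Fin n → ℂ)).1 • A i - q.1 i) = 0}
  have hD : ∀ k, IsClosed (D k) := fun k => by
    refine isClosed_eq ?_ continuous_const
    refine Continuous.matrix_vecMul (by fun_prop) ?_
    exact continuous_pi fun i => by
      change Continuous fun q : (Fin n → Fin (n + 1) → ℂ) × K k =>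
        (q.2 : ℂ × (Fin n → ℂ)).1 • A i - q.1 i
      fun_prop
  have : degenerateSet A j = ⋃ k, Prod.fst '' D k := by
    ext B
    simp only [mem_iUnion, degenerateSet, mem_ofPred_eq, mem_image]
    constructor
    · rintro ⟨z, u, hu, h⟩
      obtain ⟨k, hk⟩ := exists_nat_ge (max ‖z‖ ‖u‖)
      exact ⟨k, (B, ⟨(z, u), ⟨by simpa using (le_max_left _ _).trans hk,
        by simpa using (le_max_right _ _).trans hk⟩, hu⟩), h, rfl⟩
    · rintro ⟨k, ⟨B', ⟨⟨z, u⟩, hzu, hu⟩⟩, h, rfl⟩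
      exact ⟨z, u, hu, h⟩
  rw [this]
  refine MeasurableSet.iUnion fun k => ?_
  have : CompactSpace (K k) := isCompact_iff_compactSpace.1 (hK k)
  exact (isClosedMap_fst_of_compactSpace _ (hD k)).measurableSet

/-- A dimension count. Let only row `j` of `B` vary: its degenerate values are parametrized by `z`
and the coordinates of `u` other than the `j`-th, which is `n` complex parameters in a space of
dimension `n + 1`. -/
theorem ae_notMem_degenerateSet (A : Fin n → Fin (n + 1) → ℂ) (j : Fin n) :
    ∀ᵐ B : Fin n → Fin (n + 1) → ℂ, B ∉ degenerateSet A j := by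
  refine ae_mem_of_ae_add_linearMap_mem
    (LinearMap.single ℝ (fun _ : Fin n => Fin (n + 1) → ℂ) j) volume volume
    (s := (degenerateSet A j)ᶜ) (measurableSet_degenerateSet A j).compl fun B => ?_
  set L := rowComb (Finset.univ.erase j) A
  set K := rowComb (Finset.univ.erase j) B
  let φ : (Fin (n + 1) → ℂ) → Fin (n + 1) → ℂ := fun y => y 0 • (A j + L y) - (B j + K y)
  have hdet : ∀ y, ((eigDeriv L K (A j) y).restrictScalars ℝ).det = 0 := by
    intro y
    rw [← abs_eq_zero, det_restrictScalars_complex, map_eq_zero]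
    by_contra hne
    -- `φ` does not depend on the coordinate `j.succ`, so its derivative has a kernel at every
    -- point.
    have hz : (eigDeriv L K (A j) y) (Pi.single j.succ 1) = 0 := by
      have hs : ∀ C : Fin n → Fin (n + 1) → ℂ,
          rowComb (Finset.univ.erase j) C (Pi.single j.succ 1) = 0 := by
        intro C
        rw [rowComb_apply]
        refine Finset.sum_eq_zero fun i hi => ?_
        rw [Pi.single_eq_of_ne (by simpa using Finset.ne_of_mem_erase hi), zero_smul]
      simp [eigDeriv, L, K, hs]
    refine hne (LinearMap.det_eq_zero_iff_ker_ne_bot.2 fun hbot => ?_)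
    have := LinearMap.ker_eq_bot'.1 hbot _ hz
    exact one_ne_zero ((Pi.single_eq_same (M := fun _ => ℂ) j.succ 1).symm.trans
      (congrFun this j.succ))
  have hnull : volume (φ '' univ) = 0 :=
    addHaar_image_eq_zero_of_det_fderivWithin_eq_zero volume
      (fun x _ => ((hasStrictFDerivAt_eig L K (A j) (B j) x).restrictScalars
        ℝ).hasFDerivAt.hasFDerivWithinAt) fun x _ => hdet x
  filter_upwards [compl_mem_ae_iff.2 hnull] with x hx
  rintro ⟨z, u, hu, h⟩
  refine hx ⟨Fin.cons z u, trivial, ?_⟩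
  funext k
  have hk := congrFun h k
  simp only [Matrix.vecMul, dotProduct, Matrix.of_apply, Pi.sub_apply, Pi.smul_apply, smul_eq_mul,
    Pi.add_apply, Pi.zero_apply, LinearMap.single_apply] at hk
  rw [← Finset.add_sum_erase _ _ (Finset.mem_univ j), hu, Pi.single_eq_same] at hk
  have hrest : ∀ i ∈ Finset.univ.erase j,
      u i * (z * A i k - (B i k + (Pi.single j x : Fin n → Fin (n + 1) → ℂ) i k)) =
        z * (u i * A i k) - u i * B i k := by
    intro i hi
    rw [Pi.single_eq_of_ne (Finset.ne_of_mem_erase hi), Pi.zero_apply]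
    ring
  rw [Finset.sum_congr rfl hrest, Finset.sum_sub_distrib, ← Finset.mul_sum] at hk
  simp only [φ, L, K, rowComb_apply, Pi.sub_apply, Pi.add_apply, Pi.smul_apply, smul_eq_mul,
    Finset.sum_apply, Fin.cons_zero, Fin.cons_succ]
  linear_combination hk

theorem ae_vecMul_ne_zero (A : Fin n → Fin (n + 1) → ℂ) :
    ∀ᵐ B : Fin n → Fin (n + 1) → ℂ, ∀ (z : ℂ) (u : Fin n → ℂ), u ≠ 0 →
      u ᵥ* Matrix.of (fun i => z • A i - B i) ≠ 0 := by
  filter_upwards [ae_all_iff.2 fun j => ae_notMem_degenerateSet A j] with B hB z u hu h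
  obtain ⟨j, hj⟩ := Function.ne_iff.1 hu
  refine hB j ⟨z, (u j)⁻¹ • u, ?_, ?_⟩
  · simp [inv_mul_cancel₀ hj]
  · rw [Matrix.smul_vecMul, h, smul_zero]

end Genericity
end SphericalEnsemble
end

noncomputable section
namespace SphericalEnsemble
open MeasureTheory ProbabilityTheory Set Filter Polynomial
open scoped ENNReal Topology Matrix

/-! ### Block triangular form of a pencil with a known eigenvector. -/

section Deflation

variable {n : ℕ}

theorem measurable_eigMap : Measurable fun x : (Fin (n + 1) → Fin (n + 1) → ℂ) ×
    (Fin n → Fin (n + 1) → ℂ) × (Fin (n + 1) → ℂ) => eigMap x.1 x.2.1 x.2.2 := by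
  have : Continuous fun x : (Fin (n + 1) → Fin (n + 1) → ℂ) ×
    (Fin n → Fin (n + 1) → ℂ) × (Fin (n + 1) → ℂ) => eigMap x.1 x.2.1 x.2.2 := by
    unfold eigMap eigRow
    fun_prop
  exact this.measurable

theorem measurable_eigQuot : Measurable fun x : (Fin (n + 1) → Fin (n + 1) → ℂ) ×
    (Fin n → Fin (n + 1) → ℂ) × (Fin (n + 1) → ℂ) => eigQuot x.1 x.2.1 x.2.2 := by
  have hrow : Continuous fun x : (Fin (n + 1) → Fin (n + 1) → ℂ) ×
    (Fin n → Fin (n + 1) → ℂ) × (Fin (n + 1) → ℂ) => eigRow x.1 x.2.2 := by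
    unfold eigRow
    fun_prop
  refine measurable_polynomial_det fun i k => ?_
  refine Fin.cases ?_ (fun i => ?_) i
  · simp only [Matrix.of_apply, Fin.cons_zero]
    exact measurable_polynomial_C ((measurable_pi_apply k).comp hrow.measurable)
  · simp only [Matrix.of_apply, Fin.cons_succ, sub_eq_add_neg, ← C_neg]
    exact measurable_polynomial_add (measurable_polynomial_mul measurable_const
      (measurable_polynomial_C (by fun_prop))) (measurable_polynomial_C (by fun_prop))

theorem eigQuot_cons_eq (a : Fin (n + 1) → ℂ) (A B : Fin n → Fin (n + 1) → ℂ) (z : ℂ) :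
    eigQuot (Fin.cons a A) B (Fin.cons z 0) =
      (Matrix.of (Fin.cons (fun k => C (a k)) fun (i : Fin n) k => X * C (A i k) - C (B i k))).det := by
  have : eigRow (Fin.cons a A) (Fin.cons z 0) = a := by
    simp [eigRow]
  rw [eigQuot, this]
  rfl

/-- Rotating the columns so that `a` becomes a multiple of the first basis vector and expanding
along that row leaves the other rows with one column removed. -/
theorem eigQuot_cons_eq_mul_pencil {a : Fin (n + 1) → ℂ}
    {Q : Matrix (Fin (n + 1)) (Fin (n + 1)) ℂ} {c : ℂ} (hQ : Q * Qᴴ = 1)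
    (hc : a ᵥ* Q = Pi.single 0 c) (A B : Fin n → Fin (n + 1) → ℂ) (z : ℂ) :
    eigQuot (Fin.cons a A) B (Fin.cons z 0) =
      C (c * Q.det⁻¹) * pencil (fun i k => (A i ᵥ* Q) k.succ) (fun i k => (B i ᵥ* Q) k.succ) := by
  have hdet : Q.det ≠ 0 := fun h => by
    have := normSq_det_of_unitary hQ
    simp [h] at this
  rw [eigQuot_cons_eq]
  set M : Matrix (Fin (n + 1)) (Fin (n + 1)) ℂ[X] :=
    Matrix.of (Fin.cons (fun k => C (a k)) fun (i : Fin n) k => X * C (A i k) - C (B i k))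
  have hrow : ∀ u : Fin (n + 1) → ℂ, (fun k => C (u k)) ᵥ* Q.map C = fun k => C ((u ᵥ* Q) k) := by
    intro u
    funext k
    simp [Matrix.vecMul, dotProduct]
  have h := det_mul_det_eq_of_vecMul_eq_single M (Q.map C) 0 (C c) (by
    change (fun k => C (a k)) ᵥ* Q.map C = _
    rw [hrow, hc]
    funext k
    by_cases hk : k = 0
    · simp [hk]
    · simp [Pi.single_eq_of_ne hk])
  have h2 : (Matrix.of fun (i k : Fin n) => (M ((0 : Fin (n + 1)).succAbove i) ᵥ* Q.map C) k.succ) =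
      Matrix.of fun i k => X * C ((A i ᵥ* Q) k.succ) - C ((B i ᵥ* Q) k.succ) := by
    ext1 i k
    have hM : M ((0 : Fin (n + 1)).succAbove i) =
        (X : ℂ[X]) • (fun k => C (A i k)) - fun k => C (B i k) := by
      rw [Fin.zero_succAbove]
      rfl
    rw [Matrix.of_apply, hM, Matrix.sub_vecMul, Matrix.smul_vecMul, hrow, hrow]
    rfl
  have h3 : (Q.map C).det = C Q.det := (RingHom.map_det (C : ℂ →+* ℂ[X]) Q).symm
  rw [h2, h3] at h
  simp only [Fin.val_zero, pow_zero, one_mul] at h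
  have h4 := congrArg (· * C Q.det⁻¹) h
  simp only [mul_assoc, ← C_mul, mul_inv_cancel₀ hdet, C_1, mul_one] at h4
  rw [h4, C_mul, pencil]
  ring

/-- Conditionally on a row of the deflated pencil, the other rows form a smaller Ginibre pair. -/
theorem lintegral_eigQuot_cons {Φ : ℂ[X] → ℝ≥0∞} (hΦ : Measurable Φ) {k : ℕ}
    (hhom : ∀ c : ℂ, c ≠ 0 → ∀ q, Φ (C c * q) = ENNReal.ofReal (Complex.normSq c) ^ (k + 1) * Φ q)
    (h0 : Φ 0 = 0) (a : Fin (n + 1) → ℂ) (z : ℂ) :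
    ∫⁻ A, ∫⁻ B, Φ (eigQuot (Fin.cons a A) B (Fin.cons z 0)) ∂gaussMat n (n + 1)
        ∂gaussMat n (n + 1) =
      ENNReal.ofReal (normSqVec a) ^ (k + 1) *
        ∫⁻ A, ∫⁻ B, Φ (pencil A B) ∂gaussMat n n ∂gaussMat n n := by
  -- For `a = 0` there is no nonzero scalar to which homogeneity could apply, and the quotient
  -- polynomial is zero; this is the role of `h0`.
  by_cases ha : a = 0
  · have hz : ∀ A B : Fin n → Fin (n + 1) → ℂ,
        eigQuot (Fin.cons a A) B (Fin.cons z 0) = 0 := by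
      intro A B
      rw [eigQuot_cons_eq]
      exact Matrix.det_eq_zero_of_row_eq_zero 0 fun k => by simp [ha]
    simp only [hz, h0]
    simp [ha, normSqVec]
  · obtain ⟨Q, hQ, hQ', hc⟩ := exists_unitary_vecMul ha
    have hmp := measurePreserving_tail_vecMul n n hQ hQ'
    have hn : Complex.normSq ((Real.sqrt (normSqVec a) : ℂ) * Q.det⁻¹) = normSqVec a := by
      rw [map_mul, map_inv₀, normSq_det_of_unitary hQ, Complex.normSq_ofReal,
        Real.mul_self_sqrt (normSqVec_nonneg a), inv_one, mul_one]
    have hne : (Real.sqrt (normSqVec a) : ℂ) * Q.det⁻¹ ≠ 0 := fun h => by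
      rw [h, map_zero] at hn
      exact (normSqVec_pos ha).ne hn
    have hm : Measurable fun p : (Fin n → Fin n → ℂ) × (Fin n → Fin n → ℂ) =>
      Φ (pencil p.1 p.2) := hΦ.comp measurable_pencil
    have hmB : ∀ A : Fin n → Fin n → ℂ, Measurable fun B => Φ (pencil A B) := fun A =>
      Measurable.of_uncurry_left (f := fun A B => Φ (pencil A B)) hm
    have hconst : ∀ (c : ℝ≥0∞) (f : (Fin n → Fin n → ℂ) → ℝ≥0∞), Measurable f →
        ∫⁻ X, c * f (fun i (k : Fin n) => (X i ᵥ* Q) k.succ) ∂gaussMat n (n + 1) =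
          c * ∫⁻ X, f X ∂gaussMat n n := fun c f hf => lintegral_const_mul_comp hmp c hf
    have hstep : ∀ A : Fin n → Fin (n + 1) → ℂ,
        ∫⁻ B, Φ (eigQuot (Fin.cons a A) B (Fin.cons z 0)) ∂gaussMat n (n + 1) =
          ENNReal.ofReal (normSqVec a) ^ (k + 1) *
            ∫⁻ B, Φ (pencil (fun i (k : Fin n) => (A i ᵥ* Q) k.succ) B) ∂gaussMat n n := by
      intro A
      simp only [eigQuot_cons_eq_mul_pencil hQ hc, hhom _ hne, hn]
      exact hconst _ _ (hmB _)
    simp only [hstep]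
    exact hconst _ (fun A => ∫⁻ B, Φ (pencil A B) ∂gaussMat n n) hm.lintegral_prod_right'

theorem pencil_mul (R : Matrix (Fin n) (Fin n) ℂ) (A B : Fin n → Fin n → ℂ) :
    pencil (R * Matrix.of A) (R * Matrix.of B) = C R.det * pencil A B := by
  have h : (Matrix.of fun i j => X * C ((R * Matrix.of A) i j) - C ((R * Matrix.of B) i j)) =
      R.map C * Matrix.of fun i j => X * C (A i j) - C (B i j) := by
    ext1 i j
    simp only [Matrix.of_apply, Matrix.mul_apply, Matrix.map_apply, map_sum, map_mul, mul_sub,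
      Finset.sum_sub_distrib, Finset.mul_sum]
    congr 1
    exact Finset.sum_congr rfl fun k _ => by ring
  refine (congrArg Matrix.det h).trans ?_
  rw [Matrix.det_mul]
  congr 1
  exact (RingHom.map_det (C : ℂ →+* ℂ[X]) R).symm

theorem eigVec_ne_zero (y : Fin (n + 1) → ℂ) : eigVec y ≠ 0 := fun h => by
  have := congrFun h 0
  simp [eigVec] at this

/-- A unitary frame adapted to the eigenvector encoded by `y`. -/
theorem exists_frame (y : Fin (n + 1) → ℂ) :
    ∃ R : Matrix (Fin (n + 1)) (Fin (n + 1)) ℂ, R * Rᴴ = 1 ∧ Rᴴ * R = 1 ∧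
      (∃ ρ : ℂ, eigVec y = ρ • R 0) ∧ (Rᴴ.submatrix Fin.succ Fin.succ).det ≠ 0 := by
  obtain ⟨R, h1, h2, h3⟩ := exists_unitary_row (eigVec_ne_zero y)
  refine ⟨R, h1, h2, ⟨_, h3⟩, fun hdet => ?_⟩
  obtain ⟨u, hu, huz⟩ := Matrix.exists_vecMul_eq_zero_iff.2 hdet
  have hR00 : R 0 0 ≠ 0 := fun h => by
    have := congrFun h3 0
    simp [h, eigVec] at this
  -- If the minor killed `u`, then `w ᵥ* Rᴴ` would be supported at index `0`, so `w` would be a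
  -- multiple of `R 0`. As `w 0 = 0` while `R 0 0 ≠ 0`, that multiple is zero.
  set w : Fin (n + 1) → ℂ := Fin.cons 0 u
  have hw : ∀ k : Fin n, (w ᵥ* Rᴴ) k.succ = 0 := by
    intro k
    have := congrFun huz k
    simpa [Matrix.vecMul, dotProduct, Fin.sum_univ_succ, w] using this
  have hw2 : w = (w ᵥ* Rᴴ) ᵥ* R := by rw [Matrix.vecMul_vecMul, h2, Matrix.vecMul_one]
  have hw3 : ∀ j, w j = (w ᵥ* Rᴴ) 0 * R 0 j := by
    intro j
    conv_lhs => rw [hw2]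
    rw [Matrix.vecMul, dotProduct, Fin.sum_univ_succ]
    simp [hw]
  have hc : (w ᵥ* Rᴴ) 0 = 0 := by
    have := hw3 0
    simp only [w, Fin.cons_zero] at this
    exact (mul_eq_zero.1 this.symm).resolve_right hR00
  refine hu (funext fun i => ?_)
  have := hw3 i.succ
  rw [hc, zero_mul] at this
  simpa [w] using this

/-- In an adapted frame, the pencils with a given eigenvector are block triangular. -/
theorem eigMap_frame {R : Matrix (Fin (n + 1)) (Fin (n + 1)) ℂ} (hR : R * Rᴴ = 1)
    {y : Fin (n + 1) → ℂ} {ρ : ℂ} (hy : eigVec y = ρ • R 0) (A : Fin (n + 1) → Fin (n + 1) → ℂ)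
    (B : Fin n → Fin (n + 1) → ℂ) :
    eigMap (Rᴴ * Matrix.of A)
        (fun i => (Rᴴ * Matrix.of (Fin.cons (y 0 • A 0) B : Fin (n + 1) → _)) i.succ) y =
      (Rᴴ * Matrix.of (Fin.cons (y 0 • A 0) B : Fin (n + 1) → Fin (n + 1) → ℂ)) 0 := by
  set B' : Matrix (Fin (n + 1)) (Fin (n + 1)) ℂ :=
    Rᴴ * Matrix.of (Fin.cons (y 0 • A 0) B : Fin (n + 1) → Fin (n + 1) → ℂ)
  refine eigMap_eq_iff.2 ?_
  have hcons : (Fin.cons (B' 0) fun i => B' i.succ : Fin (n + 1) → Fin (n + 1) → ℂ) = B' :=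
    Fin.cons_self_tail (α := fun _ => Fin (n + 1) → ℂ) B'
  rw [hcons]
  have h1 : ∀ M : Matrix (Fin (n + 1)) (Fin (n + 1)) ℂ, eigVec y ᵥ* (Rᴴ * M) = ρ • M 0 := by
    intro M
    have hR0 : R 0 ᵥ* Rᴴ = Pi.single 0 1 := by
      funext j
      have := congrFun (congrFun hR 0) j
      rw [Matrix.mul_apply] at this
      rw [Matrix.vecMul, dotProduct, this, Matrix.one_apply, Pi.single_apply]
      simp [eq_comm]
    rw [hy, Matrix.smul_vecMul, ← Matrix.vecMul_vecMul, hR0]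
    congr 1
    simp [Matrix.row]
  change eigVec y ᵥ* ((y 0 • (Rᴴ * Matrix.of A) : Matrix (Fin (n + 1)) (Fin (n + 1)) ℂ) -
    Rᴴ * Matrix.of (Fin.cons (y 0 • A 0) B : Fin (n + 1) → Fin (n + 1) → ℂ)) = 0
  rw [Matrix.vecMul_sub, Matrix.vecMul_smul, h1, h1]
  funext k
  simp only [Pi.sub_apply, Pi.smul_apply, smul_eq_mul, Matrix.of_apply, Fin.cons_zero,
    Pi.zero_apply]
  ring

/-- Multiplied by `X - C (y 0)`, both sides become the characteristic polynomial of the same pencil,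
and this factor cancels. -/
theorem eigQuot_frame {R : Matrix (Fin (n + 1)) (Fin (n + 1)) ℂ} (hR : R * Rᴴ = 1)
    {y : Fin (n + 1) → ℂ} {ρ : ℂ} (hy : eigVec y = ρ • R 0) (A : Fin (n + 1) → Fin (n + 1) → ℂ)
    (B : Fin n → Fin (n + 1) → ℂ) :
    eigQuot (Rᴴ * Matrix.of A)
        (fun i => (Rᴴ * Matrix.of (Fin.cons (y 0 • A 0) B : Fin (n + 1) → _)) i.succ) y =
      C (Rᴴ.det) * eigQuot A B (Fin.cons (y 0) 0) := by
  have h1 := pencil_eq_mul_eigQuot (eigMap_frame hR hy A B)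
  have hcons : (Fin.cons ((Rᴴ * Matrix.of (Fin.cons (y 0 • A 0) B :
        Fin (n + 1) → Fin (n + 1) → ℂ)) 0)
      fun i => (Rᴴ * Matrix.of (Fin.cons (y 0 • A 0) B : Fin (n + 1) → Fin (n + 1) → ℂ)) i.succ :
      Fin (n + 1) → Fin (n + 1) → ℂ) =
      Rᴴ * Matrix.of (Fin.cons (y 0 • A 0) B : Fin (n + 1) → Fin (n + 1) → ℂ) :=
    Fin.cons_self_tail (α := fun _ => Fin (n + 1) → ℂ) _
  rw [hcons, pencil_mul] at h1
  have h2 : eigMap A B (Fin.cons (y 0) 0) = y 0 • A 0 := by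
    simp [eigMap, eigRow]
  rw [pencil_eq_mul_eigQuot h2, Fin.cons_zero] at h1
  refine mul_left_cancel₀ (X_sub_C_ne_zero (y 0)) ?_
  rw [← h1]
  ring

end Deflation
end SphericalEnsemble
end

noncomputable section
namespace SphericalEnsemble
open MeasureTheory ProbabilityTheory Set Filter Polynomial
open scoped ENNReal Topology Matrix

/-! ### Area formula for eigenpairs and the Jacobian of the adapted frame. -/

section Deflation

variable {n : ℕ}

theorem measurable_cons {E : Type*} [MeasurableSpace E] :
    Measurable fun x : E × (Fin n → E) => (Fin.cons x.1 x.2 : Fin (n + 1) → E) := by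
  refine measurable_pi_iff.2 fun i => Fin.cases ?_ (fun i => ?_) i
  · simpa only [Fin.cons_zero] using measurable_fst
  · simp only [Fin.cons_succ]
    fun_prop

theorem gaussMat_absolutelyContinuous (k m : ℕ) : gaussMat k m ≪ volume := by
  rw [gaussMat_eq_withDensity]
  exact withDensity_absolutelyContinuous _ _

theorem measurable_eigMap_right (A : Fin (n + 1) → Fin (n + 1) → ℂ) (B : Fin n → Fin (n + 1) → ℂ) :
    Measurable (eigMap A B) :=
  (continuous_iff_continuousAt.2 fun y =>
    (hasStrictFDerivAt_eigMap A B y).continuousAt).measurable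

theorem measurable_apply_eigQuot {Φ : ℂ → ℂ[X] → ℝ≥0∞}
    (hΦ : Measurable fun x : ℂ × ℂ[X] => Φ x.1 x.2) :
    Measurable fun x : (Fin (n + 1) → Fin (n + 1) → ℂ) ×
      (Fin n → Fin (n + 1) → ℂ) × (Fin (n + 1) → ℂ) => Φ (x.2.2 0) (eigQuot x.1 x.2.1 x.2.2) :=
  hΦ.comp (Measurable.prodMk (f := fun x : (Fin (n + 1) → Fin (n + 1) → ℂ) ×
      (Fin n → Fin (n + 1) → ℂ) × (Fin (n + 1) → ℂ) => x.2.2 0) (by fun_prop) measurable_eigQuot)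

theorem measurable_apply_eigQuot_right {Φ : ℂ → ℂ[X] → ℝ≥0∞}
    (hΦ : Measurable fun x : ℂ × ℂ[X] => Φ x.1 x.2) (A : Fin (n + 1) → Fin (n + 1) → ℂ)
    (B : Fin n → Fin (n + 1) → ℂ) : Measurable fun y => Φ (y 0) (eigQuot A B y) :=
  (measurable_apply_eigQuot hΦ).comp (g := fun x : (Fin (n + 1) → Fin (n + 1) → ℂ) ×
      (Fin n → Fin (n + 1) → ℂ) × (Fin (n + 1) → ℂ) => Φ (x.2.2 0) (eigQuot x.1 x.2.1 x.2.2))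
    (f := fun y => (A, B, y)) (by fun_prop)

theorem measurable_normSq_eval_mul {Θ : ℂ → ℂ[X] → ℝ≥0∞}
    (hΘ : Measurable fun x : ℂ × ℂ[X] => Θ x.1 x.2) :
    Measurable fun x : ℂ × ℂ[X] => ENNReal.ofReal (Complex.normSq (x.2.eval x.1)) * Θ x.1 x.2 :=
  (ENNReal.measurable_ofReal.comp
    (Complex.continuous_normSq.measurable.comp measurable_polynomial_eval)).mul hΘ

/-- The area formula for the pairs of an eigenvalue and an eigenvector. -/
theorem lintegral_sum_roots_pencil {Θ : ℂ → ℂ[X] → ℝ≥0∞}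
    (hΘ : Measurable fun x : ℂ × ℂ[X] => Θ x.1 x.2)
    (hS : Measurable fun q : ℂ[X] => (q.roots.map fun z => Θ z (q /ₘ (X - C z))).sum)
    (A : Fin (n + 1) → Fin (n + 1) → ℂ) :
    ∫⁻ B, ((pencil A B).roots.map fun z => Θ z (pencil A B /ₘ (X - C z))).sum
        ∂gaussMat (n + 1) (n + 1) =
      gaussConst ^ (n + 1) * ∫⁻ B, (∫⁻ y, wt (normSqVec (eigMap A B y)) *
        (ENNReal.ofReal (Complex.normSq ((eigQuot A B y).eval (y 0))) * Θ (y 0) (eigQuot A B y)))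
          ∂gaussMat n (n + 1) := by
  have hpA : Measurable fun B : Fin (n + 1) → Fin (n + 1) → ℂ => pencil A B :=
    Measurable.of_uncurry_left (f := fun A B => pencil A B) measurable_pencil
  have hSp : Measurable fun B : Fin (n + 1) → Fin (n + 1) → ℂ =>
      ((pencil A B).roots.map fun z => Θ z (pencil A B /ₘ (X - C z))).sum := hS.comp hpA
  rw [lintegral_pi_cons _ hSp, lintegral_lintegral_swap (f := fun b B =>
      ((pencil A (Fin.cons b B)).roots.map fun z =>
        Θ z (pencil A (Fin.cons b B) /ₘ (X - C z))).sum) (hSp.comp measurable_cons).aemeasurable,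
    ← lintegral_const_mul' _ _ (ENNReal.pow_ne_top gaussConst_ne_top)]
  refine lintegral_congr_ae ?_
  filter_upwards [(gaussMat_absolutelyContinuous n (n + 1)).ae_le
    (ae_vecMul_ne_zero fun i => A i.succ)] with B hB
  have hSB : Measurable fun b : Fin (n + 1) → ℂ =>
      ((pencil A (Fin.cons b B)).roots.map fun z =>
        Θ z (pencil A (Fin.cons b B) /ₘ (X - C z))).sum :=
    hSp.comp (measurable_cons.comp (Measurable.prodMk measurable_id measurable_const))
  -- On the fibre over `b` one has `eigMap A B y = b`, so the Gaussian weight of the zeroth row of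
  -- `B` can be carried inside the fibre sum as a function of `y`.
  have hθ : Measurable fun y => wt (normSqVec (eigMap A B y)) * Θ (y 0) (eigQuot A B y) :=
    (measurable_wt.comp (measurable_normSqVec.comp (measurable_eigMap_right A B))).mul
      (measurable_apply_eigQuot_right hΘ A B)
  rw [lintegral_gaussVec hSB]
  congr 1
  have harea := lintegral_det_fderiv_mul_eq_lintegral_tsum volume (hasStrictFDerivAt_eigMap A B)
    (continuous_eigMapDeriv A B) hθ
  calc _ = ∫⁻ b, ∑' y, (eigMap A B ⁻¹' {b}).indicator
        (fun y => wt (normSqVec (eigMap A B y)) * Θ (y 0) (eigQuot A B y)) y := by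
        refine lintegral_congr_ae ?_
        filter_upwards [ae_eval_eigQuot_ne_zero A B] with b hb
        rw [← tsum_indicator_eigMap hb hB Θ, ← ENNReal.tsum_mul_left]
        refine tsum_congr fun y => ?_
        by_cases hy : y ∈ eigMap A B ⁻¹' {b}
        · rw [indicator_of_mem hy, indicator_of_mem hy, show eigMap A B y = b from hy]
        · rw [indicator_of_notMem hy, indicator_of_notMem hy, mul_zero]
    _ = _ := by
        rw [← harea]
        refine lintegral_congr fun y => ?_
        rw [abs_det_eigMapDeriv, mul_left_comm]

/-- The Jacobian factor of the change to an adapted frame. -/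
def frameWeight (y : Fin (n + 1) → ℂ) : ℝ≥0∞ :=
  ∫⁻ B : Fin n → Fin (n + 1) → ℂ, wt (frob (Fin.cons (eigMap 0 B y) B : Fin (n + 1) → _))

theorem frob_mul_eq {k m : ℕ} {R : Matrix (Fin k) (Fin k) ℂ} (h : R * Rᴴ = 1)
    (h' : Rᴴ * R = 1) (X : Fin k → Fin m → ℂ) : frob (Rᴴ * Matrix.of X) = frob X :=
  frob_leftMul m (R := Rᴴ) (by simpa using h') (by simpa using h) X

/-- The substitution is affine in `B` with linear part `T`, multiplication by a minor of `Rᴴ`. Its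
Jacobian is found by testing on the weight defining `frameWeight`: by unitarity that weight pulls
back under `T` to the Gaussian one. So the Jacobian depends on `y` only, not on `R` or `s`. -/
theorem lintegral_mul_frame {R : Matrix (Fin (n + 1)) (Fin (n + 1)) ℂ} (hR : R * Rᴴ = 1)
    (hR' : Rᴴ * R = 1) {y : Fin (n + 1) → ℂ} {ρ : ℂ} (hy : eigVec y = ρ • R 0)
    (hdet : (Rᴴ.submatrix Fin.succ Fin.succ).det ≠ 0) (s : Fin (n + 1) → ℂ)
    {f : (Fin n → Fin (n + 1) → ℂ) → ℝ≥0∞} (hf : Measurable f) :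
    (∫⁻ B, f B) * ∫⁻ B : Fin n → Fin (n + 1) → ℂ, wt (frob B) =
      (∫⁻ B, f (fun i => (Rᴴ * Matrix.of (Fin.cons s B : Fin (n + 1) → Fin (n + 1) → ℂ)) i.succ)) *
        frameWeight y := by
  set E := Rᴴ.submatrix (Fin.succ : Fin n → _) (Fin.succ : Fin n → _)
  have hu : IsUnit E.det := isUnit_iff_ne_zero.2 hdet
  let T := leftMul (n + 1) (E.mul_nonsing_inv hu) (E.nonsing_inv_mul hu)
  have hT : ∀ (s : Fin (n + 1) → ℂ) (B : Fin n → Fin (n + 1) → ℂ),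
      (fun i => (Rᴴ * Matrix.of (Fin.cons s B : Fin (n + 1) → Fin (n + 1) → ℂ)) (Fin.succ i)) =
        (fun i : Fin n => Rᴴ i.succ 0 • s) + T B := by
    intro s B
    funext i k
    change _ = Rᴴ i.succ 0 * s k + (E * Matrix.of B) i k
    rw [Matrix.mul_apply, Fin.sum_univ_succ, Matrix.mul_apply]
    rfl
  have hw : Measurable fun B : Fin n → Fin (n + 1) → ℂ =>
      wt (frob (Fin.cons (eigMap 0 B y) B : Fin (n + 1) → _)) := by
    have : Continuous fun B : Fin n → Fin (n + 1) → ℂ => eigMap 0 B y := by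
      unfold eigMap
      fun_prop
    simp only [frob_cons]
    have := this.measurable
    fun_prop
  have hwT : ∀ B, wt (frob (Fin.cons (eigMap 0 (T B) y) (T B) : Fin (n + 1) → _)) =
      wt (frob B) := by
    intro B
    have h1 := eigMap_frame hR hy 0 B
    have h0 := hT (y 0 • (0 : Fin (n + 1) → Fin (n + 1) → ℂ) 0) B
    have hz : (fun i : Fin n => Rᴴ i.succ 0 • y 0 • (0 : Fin (n + 1) → Fin (n + 1) → ℂ) 0) = 0 := by
      funext i
      simp
    rw [hz, zero_add] at h0
    have hm : (Rᴴ * Matrix.of (0 : Fin (n + 1) → Fin (n + 1) → ℂ) :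
      Matrix (Fin (n + 1)) (Fin (n + 1)) ℂ) = 0 := Matrix.mul_zero _
    rw [← h0]
    have h2 : eigMap 0 (fun i => (Rᴴ * Matrix.of (Fin.cons (y 0 • (0 : Fin (n + 1) →
        Fin (n + 1) → ℂ) 0) B : Fin (n + 1) → Fin (n + 1) → ℂ)) (Fin.succ i)) y = _ :=
      (congrArg (fun M => eigMap M _ y) hm).symm.trans h1
    rw [h2]
    have h3 := frob_mul_eq hR hR' (Fin.cons (y 0 • (0 : Fin (n + 1) →
        Fin (n + 1) → ℂ) 0) B : Fin (n + 1) → Fin (n + 1) → ℂ)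
    have h4 : (Fin.cons ((Rᴴ * Matrix.of (Fin.cons (y 0 • (0 : Fin (n + 1) →
        Fin (n + 1) → ℂ) 0) B : Fin (n + 1) → Fin (n + 1) → ℂ)) 0)
        fun i => (Rᴴ * Matrix.of (Fin.cons (y 0 • (0 : Fin (n + 1) →
        Fin (n + 1) → ℂ) 0) B : Fin (n + 1) → Fin (n + 1) → ℂ)) i.succ :
        Fin (n + 1) → Fin (n + 1) → ℂ) = _ := Fin.cons_self_tail (α := fun _ => Fin (n + 1) → ℂ) _
    rw [h4]
    refine congrArg wt (h3.trans ?_)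
    rw [frob_cons]
    simp [normSqVec]
  have hadd : Measurable fun B : Fin n → Fin (n + 1) → ℂ => f ((fun i : Fin n => Rᴴ i.succ 0 • s) + B) :=
    hf.comp (measurable_const_add _)
  have h := lintegral_mul_lintegral_comp_linearEquiv volume T hadd hw
  simp only [hwT] at h
  rw [lintegral_add_left_eq_self f] at h
  simp only [hT]
  exact h

theorem gaussConst_pow_mul_lintegral_wt (k m : ℕ) :
    gaussConst ^ (m * k) * ∫⁻ B : Fin k → Fin m → ℂ, wt (frob B) = 1 := by
  have h := lintegral_gaussMat (k := k) (m := m) (f := 1) measurable_one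
  simpa using h.symm

end Deflation
end SphericalEnsemble
end

noncomputable section
namespace SphericalEnsemble
open MeasureTheory ProbabilityTheory Set Filter Polynomial
open scoped ENNReal Topology Matrix

/-! ### Integrating out the eigenvector: the one-step deflation formula. -/

section Deflation

variable {n : ℕ}

theorem normSqVec_smul {m : ℕ} (c : ℂ) (a : Fin m → ℂ) :
    normSqVec (c • a) = Complex.normSq c * normSqVec a := by
  simp [normSqVec, Finset.mul_sum]

/-- The two weights combine to `exp (-(1 + |z|²) |a|²)`. Rescaling `a` gives exponent `m` from the
Jacobian in `2 m` real dimensions and `j` from the moment. -/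
theorem lintegral_wt_smul_mul_pow (m j : ℕ) (z : ℂ) :
    ∫⁻ a, wt (normSqVec (z • a)) * ENNReal.ofReal (normSqVec a) ^ j ∂gaussVec m =
      ENNReal.ofReal ((1 + Complex.normSq z)⁻¹) ^ (m + j) *
        ∫⁻ a, ENNReal.ofReal (normSqVec a) ^ j ∂gaussVec m := by
  set t := 1 + Complex.normSq z
  have ht : 0 < t := by have := Complex.normSq_nonneg z; positivity
  set r := Real.sqrt t
  have hr : 0 < r := Real.sqrt_pos.2 ht
  have hrr : r * r = t := Real.mul_self_sqrt ht.le
  set h : (Fin m → ℂ) → ℝ≥0∞ := fun a => wt (normSqVec a) * ENNReal.ofReal (normSqVec a) ^ j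
  have hh : Measurable h := by fun_prop
  have hz : Measurable fun a : Fin m → ℂ =>
      wt (normSqVec (z • a)) * ENNReal.ofReal (normSqVec a) ^ j := by
    simp only [normSqVec_smul]
    fun_prop
  rw [lintegral_gaussVec hz, lintegral_gaussVec (by fun_prop)]
  have hnr : ∀ a : Fin m → ℂ, normSqVec (r • a) = t * normSqVec a := by
    intro a
    have : r • a = (r : ℂ) • a := by
      funext i
      simp
    rw [this, normSqVec_smul, Complex.normSq_ofReal, hrr]
  have hpt : ∀ a : Fin m → ℂ,
      wt (normSqVec a) * (wt (normSqVec (z • a)) * ENNReal.ofReal (normSqVec a) ^ j) =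
        ENNReal.ofReal t⁻¹ ^ j * h (r • a) := by
    intro a
    simp only [h, hnr, normSqVec_smul]
    rw [ENNReal.ofReal_mul ht.le, mul_pow, ← mul_assoc, ← wt_add]
    have h1 : ENNReal.ofReal t⁻¹ ^ j * ENNReal.ofReal t ^ j = 1 := by
      rw [← mul_pow, ← ENNReal.ofReal_mul (by positivity), inv_mul_cancel₀ ht.ne',
        ENNReal.ofReal_one, one_pow]
    rw [show normSqVec a + Complex.normSq z * normSqVec a = t * normSqVec a by simp only [t]; ring]
    calc _ = (ENNReal.ofReal t⁻¹ ^ j * ENNReal.ofReal t ^ j) *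
          (wt (t * normSqVec a) * ENNReal.ofReal (normSqVec a) ^ j) := by rw [h1, one_mul]
      _ = _ := by ring
  have hfin : Module.finrank ℝ (Fin m → ℂ) = 2 * m := by
    rw [Module.finrank_pi_fintype]
    simp [mul_comm]
  have hsc : ∫⁻ a, h (r • a) = ENNReal.ofReal t⁻¹ ^ m * ∫⁻ a, h a := by
    rw [← lintegral_map (f := h) hh (measurable_const_smul r), Measure.map_addHaar_smul _ hr.ne',
      lintegral_smul_measure, hfin, abs_of_pos (by positivity), pow_mul, pow_two, hrr,
      ← inv_pow, ENNReal.ofReal_pow (by positivity), smul_eq_mul]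
  simp only [hpt]
  have hhr : Measurable fun a => h (r • a) := hh.comp (measurable_const_smul r)
  rw [lintegral_const_mul _ hhr, hsc, pow_add]
  ring

theorem measurable_prodMk_const {α β γ : Type*} [MeasurableSpace α] [MeasurableSpace β]
    [MeasurableSpace γ] (y : γ) : Measurable fun x : α × β => (x.1, x.2, y) := by fun_prop

theorem measurable_apply_fst {α β γ δ : Type*} [MeasurableSpace α] [MeasurableSpace β]
    [MeasurableSpace γ] [MeasurableSpace δ] {g : α → β → γ → δ}
    (h : Measurable fun x : α × β × γ => g x.1 x.2.1 x.2.2) (y : γ) :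
    Measurable fun x : α × β => g x.1 x.2 y := h.comp (measurable_prodMk_const y)

theorem measurable_eigQuot_fst {Φ : ℂ[X] → ℝ≥0∞} (hΦ : Measurable Φ) (y : Fin (n + 1) → ℂ) :
    Measurable fun x : (Fin (n + 1) → Fin (n + 1) → ℂ) ×
      (Fin n → Fin (n + 1) → ℂ) => Φ (eigQuot x.1 x.2 y) :=
  hΦ.comp (measurable_apply_fst (g := fun A B y => eigQuot A B y) measurable_eigQuot y)

theorem measurable_wt_eigMap_mul {Φ : ℂ[X] → ℝ≥0∞} (hΦ : Measurable Φ) (y : Fin (n + 1) → ℂ) :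
    Measurable fun x : (Fin (n + 1) → Fin (n + 1) → ℂ) × (Fin n → Fin (n + 1) → ℂ) =>
      wt (normSqVec (eigMap x.1 x.2 y)) * Φ (eigQuot x.1 x.2 y) := by
  have hM : Measurable fun x : (Fin (n + 1) → Fin (n + 1) → ℂ) ×
      (Fin n → Fin (n + 1) → ℂ) => eigMap x.1 x.2 y :=
    measurable_apply_fst (g := fun A B y => eigMap A B y) measurable_eigMap y
  have h1 : Measurable fun x : (Fin (n + 1) → Fin (n + 1) → ℂ) × (Fin n → Fin (n + 1) → ℂ) =>
      wt (normSqVec (eigMap x.1 x.2 y)) := by fun_prop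
  exact h1.mul (measurable_eigQuot_fst hΦ y)

/-- The two weights on the left together measure all rows of `Rᴴ` times the matrix with rows `y 0 •
A 0` and `B`. By unitarity they equal the weight of that matrix itself, while the polynomial changes
only by a scalar of modulus one. -/
theorem wt_frame {Φ : ℂ[X] → ℝ≥0∞} {k : ℕ}
    (hhom : ∀ c : ℂ, c ≠ 0 → ∀ q, Φ (C c * q) = ENNReal.ofReal (Complex.normSq c) ^ (k + 1) * Φ q)
    {R : Matrix (Fin (n + 1)) (Fin (n + 1)) ℂ} (hR : R * Rᴴ = 1)
    (hR' : Rᴴ * R = 1) {y : Fin (n + 1) → ℂ} {ρ : ℂ} (hy : eigVec y = ρ • R 0)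
    (A : Fin (n + 1) → Fin (n + 1) → ℂ) (B : Fin n → Fin (n + 1) → ℂ) :
    wt (frob fun i : Fin n => (Rᴴ * Matrix.of (Fin.cons (y 0 • A 0) B :
        Fin (n + 1) → Fin (n + 1) → ℂ)) i.succ) *
      (wt (normSqVec (eigMap (Rᴴ * Matrix.of A) (fun i : Fin n => (Rᴴ * Matrix.of
        (Fin.cons (y 0 • A 0) B : Fin (n + 1) → Fin (n + 1) → ℂ)) i.succ) y)) *
      Φ (eigQuot (Rᴴ * Matrix.of A) (fun i : Fin n => (Rᴴ * Matrix.of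
        (Fin.cons (y 0 • A 0) B : Fin (n + 1) → Fin (n + 1) → ℂ)) i.succ) y)) =
    wt (normSqVec (y 0 • A 0)) * (wt (frob B) * Φ (eigQuot A B (Fin.cons (y 0) 0))) := by
  have hnd : Complex.normSq Rᴴ.det = 1 := normSq_det_of_unitary (by simpa using hR')
  have hne : Rᴴ.det ≠ 0 := fun h => by simp [h] at hnd
  have h1 := eigMap_frame hR hy A B
  have h2 := eigQuot_frame hR hy A B
  have h3 := frob_mul_eq hR hR' (Fin.cons (y 0 • A 0) B : Fin (n + 1) → Fin (n + 1) → ℂ)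
  generalize (Rᴴ * Matrix.of (Fin.cons (y 0 • A 0) B : Fin (n + 1) → Fin (n + 1) → ℂ)) = M
    at h1 h2 h3 ⊢
  have h4 : frob M = normSqVec (M 0) + frob fun i : Fin n => M i.succ := by
    rw [← frob_cons]
    exact congrArg frob (Fin.cons_self_tail (α := fun _ => Fin (n + 1) → ℂ) M).symm
  rw [h1, h2, hhom _ hne, hnd, ENNReal.ofReal_one, one_pow, one_mul, ← mul_assoc, ← wt_add,
    ← mul_assoc, ← wt_add, ← frob_cons, ← h3, add_comm]
  exact congrArg (fun t => wt t * _) h4.symm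

theorem lintegral_eigMap_frame {Φ : ℂ[X] → ℝ≥0∞} (hΦ : Measurable Φ) {k : ℕ}
    (hhom : ∀ c : ℂ, c ≠ 0 → ∀ q, Φ (C c * q) = ENNReal.ofReal (Complex.normSq c) ^ (k + 1) * Φ q)
    {R : Matrix (Fin (n + 1)) (Fin (n + 1)) ℂ} (hR : R * Rᴴ = 1)
    (hR' : Rᴴ * R = 1) {y : Fin (n + 1) → ℂ} {ρ : ℂ} (hy : eigVec y = ρ • R 0)
    (hdet : (Rᴴ.submatrix Fin.succ Fin.succ).det ≠ 0) (A : Fin (n + 1) → Fin (n + 1) → ℂ) :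
    ∫⁻ B, wt (normSqVec (eigMap (Rᴴ * Matrix.of A) B y)) * Φ (eigQuot (Rᴴ * Matrix.of A) B y)
        ∂gaussMat n (n + 1) =
      gaussConst ^ ((n + 1) * n) * frameWeight y * (wt (normSqVec (y 0 • A 0)) *
        ∫⁻ B, Φ (eigQuot A B (Fin.cons (y 0) 0)) ∂gaussMat n (n + 1)) := by
  have hFA : Measurable fun B => wt (normSqVec (eigMap (Rᴴ * Matrix.of A) B y)) *
      Φ (eigQuot (Rᴴ * Matrix.of A) B y) :=
    Measurable.of_uncurry_left (f := fun A B => wt (normSqVec (eigMap A B y)) *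
      Φ (eigQuot A B y)) (measurable_wt_eigMap_mul hΦ y)
  have hQA : Measurable fun B => Φ (eigQuot A B (Fin.cons (y 0) 0)) :=
    Measurable.of_uncurry_left (f := fun A B => Φ (eigQuot A B (Fin.cons (y 0) 0))) (measurable_eigQuot_fst hΦ _)
  have hwQA : Measurable fun B => wt (frob B) * Φ (eigQuot A B (Fin.cons (y 0) 0)) :=
    (measurable_wt.comp measurable_frob).mul hQA
  have key := lintegral_mul_frame hR hR' hy hdet (y 0 • A 0)
    (f := fun B => wt (frob B) * (wt (normSqVec (eigMap (Rᴴ * Matrix.of A) B y)) *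
      Φ (eigQuot (Rᴴ * Matrix.of A) B y))) (by fun_prop)
  simp only [wt_frame hhom hR hR' hy] at key
  rw [lintegral_const_mul _ hwQA] at key
  rw [lintegral_gaussMat hFA, lintegral_gaussMat hQA]
  calc _ = gaussConst ^ ((n + 1) * n) * (gaussConst ^ ((n + 1) * n) *
        ((∫⁻ B, wt (frob B) * (wt (normSqVec (eigMap (Rᴴ * Matrix.of A) B y)) *
          Φ (eigQuot (Rᴴ * Matrix.of A) B y))) *
          ∫⁻ B : Fin n → Fin (n + 1) → ℂ, wt (frob B))) := by
        -- The inserted factor one is the normalized total Gaussian mass; it produces the product of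
        -- integrals that occurs in `key`.
        conv_lhs => rw [← mul_one (gaussConst ^ ((n + 1) * n)),
          ← gaussConst_pow_mul_lintegral_wt n (n + 1)]
        ring
    _ = _ := by
        rw [key]
        ring

/-- Conditioning on an eigenvector, in a frame adapted to it. -/
theorem lintegral_eigMap_eigQuot {Φ : ℂ[X] → ℝ≥0∞} (hΦ : Measurable Φ) {k : ℕ}
    (hhom : ∀ c : ℂ, c ≠ 0 → ∀ q, Φ (C c * q) = ENNReal.ofReal (Complex.normSq c) ^ (k + 1) * Φ q)
    (h0 : Φ 0 = 0) (y : Fin (n + 1) → ℂ) :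
    ∫⁻ A, ∫⁻ B, wt (normSqVec (eigMap A B y)) * Φ (eigQuot A B y) ∂gaussMat n (n + 1)
        ∂gaussMat (n + 1) (n + 1) =
      gaussConst ^ ((n + 1) * n) * frameWeight y *
        (ENNReal.ofReal ((1 + Complex.normSq (y 0))⁻¹) ^ (n + 1 + (k + 1)) *
          ∫⁻ a, ENNReal.ofReal (normSqVec a) ^ (k + 1) ∂gaussVec (n + 1)) *
        ∫⁻ A, ∫⁻ B, Φ (pencil A B) ∂gaussMat n n ∂gaussMat n n := by
  have hF := measurable_wt_eigMap_mul hΦ y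
  obtain ⟨R, hR, hR', ⟨ρ, hy⟩, hdet⟩ := exists_frame y
  have hmp := (measurePreserving_gaussMat (leftMul (n + 1) (R := Rᴴ) (R' := R) hR' hR)
    (frob_mul_eq hR hR')).2
  have hinner := lintegral_eigMap_frame hΦ hhom hR hR' hy hdet
  have hW : Measurable fun A : Fin (n + 1) → Fin (n + 1) → ℂ =>
      ∫⁻ B, Φ (eigQuot A B (Fin.cons (y 0) 0)) ∂gaussMat n (n + 1) :=
    (measurable_eigQuot_fst hΦ _).lintegral_prod_right'
  have hW2 : Measurable fun A : Fin (n + 1) → Fin (n + 1) → ℂ => wt (normSqVec (y 0 • A 0)) *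
      ∫⁻ B, Φ (eigQuot A B (Fin.cons (y 0) 0)) ∂gaussMat n (n + 1) := by
    simp only [normSqVec_smul]
    fun_prop
  -- The frame depends on `y` alone, and `y` is fixed, so invariance of the Gaussian law allows `A`
  -- to be replaced by `Rᴴ A`.
  rw [← hmp.lintegral_comp (f := fun A => ∫⁻ B, wt (normSqVec (eigMap A B y)) *
    Φ (eigQuot A B y) ∂gaussMat n (n + 1)) hF.lintegral_prod_right']
  refine (lintegral_congr hinner).trans ?_
  rw [lintegral_const_mul _ hW2, mul_assoc (gaussConst ^ ((n + 1) * n) * frameWeight y)]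
  congr 1
  rw [lintegral_pi_cons _ hW2]
  simp only [Fin.cons_zero]
  have hcA : ∀ a : Fin (n + 1) → ℂ, Measurable fun A : Fin n → Fin (n + 1) → ℂ =>
      ∫⁻ B, Φ (eigQuot (Fin.cons a A) B (Fin.cons (y 0) 0)) ∂gaussMat n (n + 1) := fun a =>
    hW.comp (measurable_cons.comp (Measurable.prodMk measurable_const measurable_id))
  have hstep : ∀ a : Fin (n + 1) → ℂ, ∫⁻ A : Fin n → Fin (n + 1) → ℂ, wt (normSqVec (y 0 • a)) *
      ∫⁻ B, Φ (eigQuot (Fin.cons a A) B (Fin.cons (y 0) 0)) ∂gaussMat n (n + 1)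
        ∂gaussMat n (n + 1) =
      wt (normSqVec (y 0 • a)) * ENNReal.ofReal (normSqVec a) ^ (k + 1) *
        ∫⁻ A, ∫⁻ B, Φ (pencil A B) ∂gaussMat n n ∂gaussMat n n := by
    intro a
    rw [lintegral_const_mul _ (hcA a), lintegral_eigQuot_cons hΦ hhom h0, mul_assoc]
  refine (lintegral_congr hstep).trans ?_
  rw [lintegral_mul_const _ (by simp only [normSqVec_smul]; fun_prop),
    lintegral_wt_smul_mul_pow]

/-- With `A = 0` the eigenvalue coordinate drops out of `eigMap`. Hence the integral over the
eigenvector separates from the integral over `z`. -/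
theorem frameWeight_cons (z : ℂ) (u : Fin n → ℂ) :
    frameWeight (Fin.cons z u) = frameWeight (Fin.cons 0 u) := by
  simp [frameWeight, eigMap, eigRow]

theorem measurable_frameWeight : Measurable (frameWeight (n := n)) := by
  have h : Measurable fun x : (Fin (n + 1) → ℂ) × (Fin n → Fin (n + 1) → ℂ) =>
      wt (frob (Fin.cons (eigMap 0 x.2 x.1) x.2 : Fin (n + 1) → _)) := by
    have : Continuous fun x : (Fin (n + 1) → ℂ) × (Fin n → Fin (n + 1) → ℂ) =>
        eigMap 0 x.2 x.1 := by
      unfold eigMap eigRow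
      fun_prop
    have := this.measurable
    simp only [frob_cons]
    fun_prop
  exact h.lintegral_prod_right'

/-- Conditionally on an eigenvalue, the other eigenvalues of a Ginibre pencil are those of a
smaller Ginibre pencil, reweighted by the squared modulus of its characteristic polynomial at
the given eigenvalue. -/
theorem exists_lintegral_sum_roots_pencil (n p : ℕ) :
    ∃ c : ℝ≥0∞, ∀ Θ : ℂ → ℂ[X] → ℝ≥0∞, (Measurable fun x : ℂ × ℂ[X] => Θ x.1 x.2) →
      (Measurable fun q : ℂ[X] => (q.roots.map fun z => Θ z (q /ₘ (X - C z))).sum) →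
      (∀ z c, c ≠ 0 → ∀ q, Θ z (C c * q) = ENNReal.ofReal (Complex.normSq c) ^ p * Θ z q) →
      ∫⁻ A, ∫⁻ B, ((pencil A B).roots.map fun z => Θ z (pencil A B /ₘ (X - C z))).sum
        ∂gaussMat (n + 1) (n + 1) ∂gaussMat (n + 1) (n + 1) =
      c * ∫⁻ z, ENNReal.ofReal ((1 + Complex.normSq z)⁻¹) ^ (n + 2 + p) *
        ∫⁻ A, ∫⁻ B, ENNReal.ofReal (Complex.normSq ((pencil A B).eval z)) * Θ z (pencil A B)
          ∂gaussMat n n ∂gaussMat n n := by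
  -- The constant does not depend on `Θ`, and neither its value nor its finiteness is needed: the
  -- final normalization comes from counting pairs.
  refine ⟨gaussConst ^ (n + 1) * (gaussConst ^ ((n + 1) * n) *
    (∫⁻ a, ENNReal.ofReal (normSqVec a) ^ (p + 1) ∂gaussVec (n + 1)) *
    ∫⁻ u : Fin n → ℂ, frameWeight (Fin.cons 0 u)), fun Θ hΘ hS hhom => ?_⟩
  set Φ : ℂ → ℂ[X] → ℝ≥0∞ := fun z q => ENNReal.ofReal (Complex.normSq (q.eval z)) * Θ z q
  have hΦ : Measurable fun x : ℂ × ℂ[X] => Φ x.1 x.2 := measurable_normSq_eval_mul hΘ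
  have hΦz : ∀ z, Measurable (Φ z) := fun z => Measurable.of_uncurry_left (f := Φ) hΦ
  have hΦhom : ∀ z c, c ≠ 0 → ∀ q,
      Φ z (C c * q) = ENNReal.ofReal (Complex.normSq c) ^ (p + 1) * Φ z q := by
    intro z c hc q
    simp only [Φ, hhom z c hc, eval_mul, eval_C, Complex.normSq_mul,
      ENNReal.ofReal_mul (Complex.normSq_nonneg c)]
    ring
  have hΦ0 : ∀ z, Φ z 0 = 0 := fun z => by simp [Φ]
  have hF : Measurable fun x : (Fin (n + 1) → Fin (n + 1) → ℂ) ×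
      (Fin n → Fin (n + 1) → ℂ) × (Fin (n + 1) → ℂ) =>
      wt (normSqVec (eigMap x.1 x.2.1 x.2.2)) * Φ (x.2.2 0) (eigQuot x.1 x.2.1 x.2.2) :=
    (measurable_wt.comp (measurable_normSqVec.comp measurable_eigMap)).mul
      (measurable_apply_eigQuot hΦ)
  simp only [lintegral_sum_roots_pencil hΘ hS]
  rw [lintegral_const_mul' _ _ (ENNReal.pow_ne_top gaussConst_ne_top), mul_assoc]
  congr 1
  have hswap1 : ∀ A : Fin (n + 1) → Fin (n + 1) → ℂ,
      ∫⁻ B, (∫⁻ y, wt (normSqVec (eigMap A B y)) * Φ (y 0) (eigQuot A B y)) ∂gaussMat n (n + 1) =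
        ∫⁻ y, ∫⁻ B, wt (normSqVec (eigMap A B y)) * Φ (y 0) (eigQuot A B y)
          ∂gaussMat n (n + 1) := fun A =>
    lintegral_lintegral_swap (f := fun B y =>
      wt (normSqVec (eigMap A B y)) * Φ (y 0) (eigQuot A B y))
      (Measurable.of_uncurry_left (f := fun A (x : (Fin n → Fin (n + 1) → ℂ) ×
        (Fin (n + 1) → ℂ)) => wt (normSqVec (eigMap A x.1 x.2)) *
          Φ (x.2 0) (eigQuot A x.1 x.2)) hF).aemeasurable
  have hF2 : Measurable fun x : (Fin (n + 1) → Fin (n + 1) → ℂ) × (Fin (n + 1) → ℂ) =>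
      ∫⁻ B, wt (normSqVec (eigMap x.1 B x.2)) * Φ (x.2 0) (eigQuot x.1 B x.2)
        ∂gaussMat n (n + 1) :=
    Measurable.lintegral_prod_right' (f := fun x : ((Fin (n + 1) → Fin (n + 1) → ℂ) ×
      (Fin (n + 1) → ℂ)) × (Fin n → Fin (n + 1) → ℂ) =>
      wt (normSqVec (eigMap x.1.1 x.2 x.1.2)) * Φ (x.1.2 0) (eigQuot x.1.1 x.2 x.1.2))
      (hF.comp (f := fun x : ((Fin (n + 1) → Fin (n + 1) → ℂ) ×
        (Fin (n + 1) → ℂ)) × (Fin n → Fin (n + 1) → ℂ) => (x.1.1, x.2, x.1.2)) (by fun_prop))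
  refine (lintegral_congr hswap1).trans ?_
  rw [lintegral_lintegral_swap (f := fun A y =>
    ∫⁻ B, wt (normSqVec (eigMap A B y)) * Φ (y 0) (eigQuot A B y)
          ∂gaussMat n (n + 1)) hF2.aemeasurable]
  have hJ := fun y : Fin (n + 1) → ℂ =>
    lintegral_eigMap_eigQuot (hΦz (y 0)) (hΦhom (y 0)) (hΦ0 (y 0)) y
  refine (lintegral_congr hJ).trans ?_
  have hW : Measurable fun z => ∫⁻ A, ∫⁻ B, Φ z (pencil A B) ∂gaussMat n n ∂gaussMat n n := by
    refine Measurable.lintegral_prod_right' (f := fun x : ℂ × (Fin n → Fin n → ℂ) =>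
      ∫⁻ B, Φ x.1 (pencil x.2 B) ∂gaussMat n n) ?_
    refine Measurable.lintegral_prod_right' (f := fun x : (ℂ × (Fin n → Fin n → ℂ)) ×
      (Fin n → Fin n → ℂ) => Φ x.1.1 (pencil x.1.2 x.2)) ?_
    exact hΦ.comp (f := fun x : (ℂ × (Fin n → Fin n → ℂ)) × (Fin n → Fin n → ℂ) =>
      (x.1.1, pencil x.1.2 x.2)) (Measurable.prodMk (by fun_prop)
        (measurable_pencil.comp (f := fun x : (ℂ × (Fin n → Fin n → ℂ)) × (Fin n → Fin n → ℂ) =>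
          (x.1.2, x.2)) (by fun_prop)))
  have hfw := measurable_frameWeight (n := n)
  set W : ℂ → ℝ≥0∞ := fun z => ∫⁻ A, ∫⁻ B, Φ z (pencil A B) ∂gaussMat n n ∂gaussMat n n
  set K := ∫⁻ a, ENNReal.ofReal (normSqVec a) ^ (p + 1) ∂gaussVec (n + 1)
  have hnq : Measurable Complex.normSq := Complex.continuous_normSq.measurable
  have hmeas : Measurable fun y : Fin (n + 1) → ℂ => gaussConst ^ ((n + 1) * n) * frameWeight y *
      (ENNReal.ofReal ((1 + Complex.normSq (y 0))⁻¹) ^ (n + 1 + (p + 1)) * K) * W (y 0) := by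
    have h0 : Measurable fun y : Fin (n + 1) → ℂ => y 0 := measurable_pi_apply 0
    have h1 := hW.comp h0
    have h2 := hnq.comp h0
    exact ((hfw.const_mul _).mul (((ENNReal.measurable_ofReal.comp
      ((h2.const_add 1).inv)).pow_const _).mul_const _)).mul h1
  refine (lintegral_pi_cons volume hmeas).trans ?_
  simp only [Fin.cons_zero, frameWeight_cons (n := n)]
  have hfu : Measurable fun u : Fin n → ℂ => frameWeight (Fin.cons 0 u) :=
    hfw.comp (measurable_cons.comp (Measurable.prodMk measurable_const measurable_id))
  have hzm : Measurable fun z : ℂ =>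
      ENNReal.ofReal (1 + Complex.normSq z)⁻¹ ^ (n + 2 + p) * W z := by fun_prop
  refine Eq.trans ?_ (lintegral_const_mul _ hzm)
  refine lintegral_congr fun z => ?_
  rw [show ∀ a b : ℝ≥0∞, (∫⁻ u : Fin n → ℂ, gaussConst ^ ((n + 1) * n) *
      frameWeight (Fin.cons 0 u) * a * b ∂Measure.pi fun _ => volume) =
      gaussConst ^ ((n + 1) * n) * (∫⁻ u : Fin n → ℂ, frameWeight (Fin.cons 0 u)) * a * b from
    fun a b => by
      rw [lintegral_mul_const _ ((hfu.const_mul _).mul_const _),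
        lintegral_mul_const _ (hfu.const_mul _), lintegral_const_mul _ hfu]
      rfl]
  -- The exponent collects `n + 1` from the dimension of a row and `p + 1` from the degree of
  -- homogeneity of `Θ` times the Jacobian.
  rw [show n + 1 + (p + 1) = n + 2 + p by ring]
  ring

end Deflation
end SphericalEnsemble
end

noncomputable section
namespace SphericalEnsemble
open MeasureTheory ProbabilityTheory Set Filter Polynomial
open scoped ENNReal Topology Matrix

/-! ### Sums over pairs of roots, by deflating twice. -/

section PairSums

open Classical in
/-- The sum of a function of two variables over the ordered pairs of distinct elements of a
multiset, counted with multiplicity. -/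
def pairSum {α M : Type*} [AddCommMonoid M] (f : α → α → M) (s : Multiset α) : M :=
  (s.map fun a => ((s.erase a).map (f a)).sum).sum

theorem pairSum_map_univ {ι α M : Type*} [AddCommMonoid M] [Fintype ι] [DecidableEq ι]
    (f : α → α → M) (t : ι → α) :
    pairSum f ((Finset.univ : Finset ι).val.map t) =
      ∑ k ∈ (Finset.univ : Finset ι).offDiag, f (t k.1) (t k.2) := by
  classical
  have h1 : ∀ i, ((((Finset.univ : Finset ι).val.map t).erase (t i)).map (f (t i))).sum =
      ∑ j ∈ Finset.univ.erase i, f (t i) (t j) := by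
    intro i
    rw [← Multiset.map_erase_of_mem t _ (Finset.mem_univ_val i), Multiset.map_map]
    rfl
  have h2 : ∑ k ∈ (Finset.univ : Finset ι).offDiag, f (t k.1) (t k.2) =
      ∑ i, ∑ j ∈ Finset.univ.erase i, f (t i) (t j) := by
    rw [Finset.sum_sigma']
    refine Finset.sum_bij' (fun k _ => ⟨k.1, k.2⟩) (fun k _ => (k.1, k.2)) ?_ ?_ ?_ ?_ ?_ <;>
      simp [Finset.mem_offDiag, eq_comm]
  rw [h2, pairSum, Multiset.map_map]
  exact Finset.sum_congr rfl fun i _ => by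
    simp only [Function.comp_apply]
    convert h1 i using 4

theorem pairSum_map {α β M : Type*} [AddCommMonoid M] (f : β → β → M) (g : α → β)
    (s : Multiset α) : pairSum f (s.map g) = pairSum (fun a b => f (g a) (g b)) s := by
  obtain ⟨l, rfl⟩ := Quot.exists_rep s
  have hl : (Quot.mk _ l : Multiset α) = (Finset.univ : Finset (Fin l.length)).val.map l.get := by
    rw [Fin.univ_val_map, List.ofFn_get]
    rfl
  rw [hl, Multiset.map_map, pairSum_map_univ, pairSum_map_univ]
  rfl

theorem measurable_pairSum {F : ℂ → ℂ → ℝ≥0∞} (hF : Measurable fun x : ℂ × ℂ => F x.1 x.2) :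
    Measurable fun q : ℂ[X] => pairSum F q.roots := by
  have h := measurable_roots (T := fun _ s => pairSum F s) fun k => by
    simp only [pairSum_map_univ]
    refine Finset.measurable_sum _ fun i _ => ?_
    exact hF.comp (f := fun x : ℂ × (Fin k → ℂ) => (x.2 i.1, x.2 i.2)) (by fun_prop)
  exact h.comp (f := fun q : ℂ[X] => ((0 : ℂ), q)) (by fun_prop)

theorem measurable_sum_map_roots {F : ℂ → ℂ → ℝ≥0∞}
    (hF : Measurable fun x : ℂ × ℂ => F x.1 x.2) :
    Measurable fun x : ℂ × ℂ[X] => (x.2.roots.map (F x.1)).sum := by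
  refine measurable_roots (T := fun w s => (s.map (F w)).sum) fun k => ?_
  simp only [Multiset.map_map]
  have : (fun x : ℂ × (Fin k → ℂ) =>
      (Multiset.map (F x.1 ∘ x.2) (Finset.univ : Finset (Fin k)).val).sum) =
      fun x => ∑ i, F x.1 (x.2 i) := rfl
  rw [this]
  refine Finset.measurable_sum _ fun i _ => ?_
  exact hF.comp (f := fun x : ℂ × (Fin k → ℂ) => (x.1, x.2 i)) (by fun_prop)

theorem mul_divByMonic_of_mem_roots {q : ℂ[X]} {z : ℂ} (hz : z ∈ q.roots) :
    (X - C z) * (q /ₘ (X - C z)) = q :=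
  mul_divByMonic_eq_iff_isRoot.2 (mem_roots'.1 hz).2

open Classical in
theorem roots_divByMonic_X_sub_C {q : ℂ[X]} {z : ℂ} (hz : z ∈ q.roots) :
    (q /ₘ (X - C z)).roots = q.roots.erase z := by
  have h := mul_divByMonic_of_mem_roots hz
  have h0 : q ≠ 0 := (mem_roots'.1 hz).1
  conv_rhs => rw [← h, roots_mul (by rwa [h]), roots_X_sub_C]
  simp

/-- Dividing by `X - z` removes one copy of the root `z`, so a sum over pairs of roots acquires the
form that deflation requires. -/
theorem sum_map_roots_divByMonic (F : ℂ → ℂ → ℝ≥0∞) (q : ℂ[X]) :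
    (q.roots.map fun z => ((q /ₘ (X - C z)).roots.map (F z)).sum).sum = pairSum F q.roots := by
  classical
  rw [pairSum]
  congr 1
  refine Multiset.map_congr rfl fun z hz => ?_
  rw [roots_divByMonic_X_sub_C hz]

/-- Since `q(w) = (w - z) (q / (X - z))(w)`, the weight `|q(w)|²` left by the first deflation
becomes a function of the twice deflated polynomial. This is where the repulsion factor `|w - z|²`
arises. -/
theorem sum_map_roots_normSq_eval (F : ℂ → ℂ → ℝ≥0∞) (q : ℂ[X]) (w : ℂ) :
    (q.roots.map fun z => ENNReal.ofReal (Complex.normSq (w - z)) *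
      ENNReal.ofReal (Complex.normSq ((q /ₘ (X - C z)).eval w)) * F w z).sum =
    ENNReal.ofReal (Complex.normSq (q.eval w)) * (q.roots.map (F w)).sum := by
  rw [← Multiset.sum_map_mul_left]
  congr 1
  refine Multiset.map_congr rfl fun z hz => ?_
  conv_rhs => rw [← mul_divByMonic_of_mem_roots hz]
  rw [eval_mul, eval_sub, eval_X, eval_C, Complex.normSq_mul,
    ENNReal.ofReal_mul (Complex.normSq_nonneg _)]

theorem measurable_lintegral_detSq_mul_detSq (n : ℕ) :
    Measurable fun x : ℂ × ℂ => ∫⁻ A, ∫⁻ B, detSq (x.1 • A - B) * detSq (x.2 • A - B)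
      ∂gaussMat n n ∂gaussMat n n := by
  refine Measurable.lintegral_prod_right' (f := fun x : (ℂ × ℂ) × (Fin n → Fin n → ℂ) =>
    ∫⁻ B, detSq (x.1.1 • x.2 - B) * detSq (x.1.2 • x.2 - B) ∂gaussMat n n) ?_
  refine Measurable.lintegral_prod_right' (f := fun x : ((ℂ × ℂ) × (Fin n → Fin n → ℂ)) ×
    (Fin n → Fin n → ℂ) => detSq (x.1.1.1 • x.1.2 - x.2) * detSq (x.1.1.2 • x.1.2 - x.2)) ?_
  exact (Continuous.measurable_detSq (by fun_prop)).mul (Continuous.measurable_detSq (by fun_prop))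

/-- The two-point function of the eigenvalues of a Ginibre pencil, up to a constant, in terms
of the expected product of squared characteristic polynomials. -/
theorem exists_lintegral_pairSum_aux (n : ℕ) :
    ∃ c : ℝ≥0∞, ∀ F : ℂ → ℂ → ℝ≥0∞, (Measurable fun x : ℂ × ℂ => F x.1 x.2) →
      ∫⁻ A, ∫⁻ B, pairSum F (pencil A B).roots ∂gaussMat (n + 2) (n + 2)
          ∂gaussMat (n + 2) (n + 2) =
        c * ∫⁻ w, ENNReal.ofReal ((1 + Complex.normSq w)⁻¹) ^ (n + 3) *
          ∫⁻ z, ENNReal.ofReal ((1 + Complex.normSq z)⁻¹) ^ (n + 3) *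
            (F w z * (ENNReal.ofReal (Complex.normSq (w - z)) *
              ∫⁻ A, ∫⁻ B, detSq (w • A - B) * detSq (z • A - B)
                ∂gaussMat n n ∂gaussMat n n)) := by
  -- The first deflation goes from size `n + 2` to `n + 1` with a function of degree `0`; the second
  -- goes to size `n` with degree `1`, because of the extra `|q(w)|²`. Both leave the exponent `n +
  -- 3`.
  obtain ⟨c₁, h₁⟩ := exists_lintegral_sum_roots_pencil (n + 1) 0
  obtain ⟨c₂, h₂⟩ := exists_lintegral_sum_roots_pencil n 1
  have hnq : Measurable Complex.normSq := Complex.continuous_normSq.measurable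
  refine ⟨c₁ * c₂, fun F hF => ?_⟩
  have hsum := measurable_sum_map_roots hF
  have e₁ := h₁ (fun w q => (q.roots.map (F w)).sum) hsum
    (by simpa only [sum_map_roots_divByMonic] using measurable_pairSum hF)
    (fun z c hc q => by rw [roots_C_mul _ hc, pow_zero, one_mul])
  simp only [sum_map_roots_divByMonic] at e₁
  rw [e₁, mul_assoc]
  congr 1
  have hD := measurable_lintegral_detSq_mul_detSq n
  have hG : Measurable fun x : ℂ × ℂ => ENNReal.ofReal ((1 + Complex.normSq x.2)⁻¹) ^ (n + 3) *
      (F x.1 x.2 * (ENNReal.ofReal (Complex.normSq (x.1 - x.2)) *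
        ∫⁻ A, ∫⁻ B, detSq (x.1 • A - B) * detSq (x.2 • A - B)
          ∂gaussMat n n ∂gaussMat n n)) := by fun_prop
  have hG2 := hG.lintegral_prod_right' (ν := volume)
  rw [← lintegral_const_mul _ (by fun_prop)]
  refine lintegral_congr fun w => ?_
  have hFw : Measurable (F w) := Measurable.of_uncurry_left (f := F) hF
  have e₂ := h₂ (fun z q => ENNReal.ofReal (Complex.normSq (w - z)) *
    ENNReal.ofReal (Complex.normSq (q.eval w)) * F w z) (by
      have hev : Measurable fun x : ℂ × ℂ[X] => x.2.eval w :=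
        measurable_polynomial_eval.comp (f := fun x : ℂ × ℂ[X] => (w, x.2)) (by fun_prop)
      fun_prop) (by
      simp only [sum_map_roots_normSq_eval]
      have hev : Measurable fun x : ℂ[X] => x.eval w :=
        measurable_polynomial_eval.comp (f := fun x : ℂ[X] => (w, x)) (by fun_prop)
      have hs : Measurable fun q : ℂ[X] => (q.roots.map (F w)).sum :=
        hsum.comp (f := fun x : ℂ[X] => (w, x)) (by fun_prop)
      fun_prop) (fun z c hc q => by
      rw [eval_mul, eval_C, Complex.normSq_mul, ENNReal.ofReal_mul (Complex.normSq_nonneg _)]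
      ring)
  simp only [sum_map_roots_normSq_eval] at e₂
  rw [show n + 1 + 2 + 0 = n + 3 by ring, e₂, mul_left_comm]
  congr 2
  refine lintegral_congr fun z => ?_
  rw [show n + 2 + 1 = n + 3 by ring]
  congr 1
  have hd : Measurable fun x : (Fin n → Fin n → ℂ) × (Fin n → Fin n → ℂ) =>
      detSq (w • x.1 - x.2) * detSq (z • x.1 - x.2) := by fun_prop
  rw [← mul_assoc, ← lintegral_const_mul _ hd.lintegral_prod_right']
  refine lintegral_congr fun A => ?_
  rw [← lintegral_const_mul _ (Measurable.of_uncurry_left (f := fun A B : Fin n → Fin n → ℂ =>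
    detSq (w • A - B) * detSq (z • A - B)) hd)]
  refine lintegral_congr fun B => ?_
  simp only [eval_pencil, detSq]
  ring

end PairSums
end SphericalEnsemble
end

noncomputable section
namespace SphericalEnsemble
open MeasureTheory ProbabilityTheory Set Filter
open scoped ENNReal Topology ComplexConjugate

/-! ### The two-point function in terms of the overlap of two points on the sphere. -/

section Overlap

/-- The squared cosine of half the geodesic distance between the points of the sphere over `w`
and `z`. -/
def overlap (w z : ℂ) : ℝ :=
  Complex.normSq (1 + z * conj w) / ((1 + Complex.normSq w) * (1 + Complex.normSq z))

theorem one_add_normSq_pos (z : ℂ) : 0 < 1 + Complex.normSq z := by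
  have := Complex.normSq_nonneg z
  positivity

theorem overlap_nonneg (w z : ℂ) : 0 ≤ overlap w z :=
  div_nonneg (Complex.normSq_nonneg _)
    (mul_pos (one_add_normSq_pos w) (one_add_normSq_pos z)).le

/-- Lagrange's identity for the vectors `(1, w)` and `(1, z)`; it bounds the overlap by one. -/
theorem normSq_sub_add_normSq_one_add (w z : ℂ) :
    Complex.normSq (z - w) + Complex.normSq (1 + z * conj w) =
      (1 + Complex.normSq w) * (1 + Complex.normSq z) := by
  simp only [Complex.normSq_apply, Complex.sub_re, Complex.sub_im, Complex.add_re, Complex.add_im,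
    Complex.mul_re, Complex.mul_im, Complex.conj_re, Complex.conj_im, Complex.one_re,
    Complex.one_im]
  ring

theorem one_sub_overlap (w z : ℂ) :
    1 - overlap w z = Complex.normSq (z - w) / ((1 + Complex.normSq w) * (1 + Complex.normSq z)) := by
  have h := mul_pos (one_add_normSq_pos w) (one_add_normSq_pos z)
  rw [overlap, eq_div_iff h.ne', sub_mul, div_mul_cancel₀ _ h.ne',
    ← normSq_sub_add_normSq_one_add]
  ring

theorem overlap_le_one (w z : ℂ) : overlap w z ≤ 1 := by
  have h := one_sub_overlap w z
  have : 0 ≤ 1 - overlap w z := by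
    rw [h]
    exact div_nonneg (Complex.normSq_nonneg _)
      (mul_pos (one_add_normSq_pos w) (one_add_normSq_pos z)).le
  linarith

theorem measurable_overlap : Measurable fun x : ℂ × ℂ => overlap x.1 x.2 := by
  have h : Measurable Complex.normSq := Complex.continuous_normSq.measurable
  have hc : Measurable fun x : ℂ × ℂ => 1 + x.2 * conj x.1 := by
    have : Continuous fun x : ℂ × ℂ => 1 + x.2 * conj x.1 := by fun_prop
    exact this.measurable
  unfold overlap
  fun_prop

/-- The term added on the left of the correlation identity is finite, so it can be cancelled. Of the
`n + 3` factors `(1 + |·|²)⁻¹` left by deflation, `n + 1` are absorbed here; the remaining two give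
the area density of the sphere. -/
theorem normSq_sub_mul_lintegral_eq (n : ℕ) (w z : ℂ) :
    ENNReal.ofReal (Complex.normSq (w - z)) *
        (∫⁻ A, ∫⁻ B, detSq (w • A - B) * detSq (z • A - B) ∂gaussMat n n ∂gaussMat n n) =
      (n.factorial : ℝ≥0∞) ^ 2 *
        (ENNReal.ofReal (1 + Complex.normSq w) ^ (n + 1) *
          ENNReal.ofReal (1 + Complex.normSq z) ^ (n + 1) *
          ENNReal.ofReal (1 - overlap w z ^ (n + 1))) := by
  have h := normSq_sub_mul_lintegral_detSq_mul_detSq n w z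
  have ha := one_add_normSq_pos w
  have hb := one_add_normSq_pos z
  have hab := mul_pos ha hb
  have hov : Complex.normSq (1 + z * conj w) =
      overlap w z * ((1 + Complex.normSq w) * (1 + Complex.normSq z)) := by
    rw [overlap, div_mul_cancel₀ _ hab.ne']
  have hsymm : Complex.normSq (w - z) = Complex.normSq (z - w) := by
    rw [← Complex.normSq_neg, neg_sub]
  have hk : 0 ≤ 1 - overlap w z ^ (n + 1) :=
    sub_nonneg.2 (pow_le_one₀ (overlap_nonneg w z) (overlap_le_one w z))
  rw [hov, ← ENNReal.ofReal_pow (mul_nonneg (overlap_nonneg w z) hab.le),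
    ← ENNReal.ofReal_pow hab.le] at h
  have hfin : (n.factorial : ℝ≥0∞) ^ 2 * ENNReal.ofReal ((overlap w z *
      ((1 + Complex.normSq w) * (1 + Complex.normSq z))) ^ (n + 1)) ≠ ∞ :=
    ENNReal.mul_ne_top (ENNReal.pow_ne_top (ENNReal.natCast_ne_top _)) ENNReal.ofReal_ne_top
  rw [hsymm]
  refine (ENNReal.add_left_inj hfin).1 (h.trans ?_)
  rw [← mul_add, ← ENNReal.ofReal_pow ha.le, ← ENNReal.ofReal_pow hb.le,
    ← ENNReal.ofReal_mul (by positivity), ← ENNReal.ofReal_mul (by positivity),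
    ← ENNReal.ofReal_add (mul_nonneg (by positivity) hk)
      (pow_nonneg (mul_nonneg (overlap_nonneg w z) hab.le) _)]
  congr 2
  rw [mul_pow (overlap w z), mul_pow (1 + Complex.normSq w)]
  ring

/-- The two-point function of the eigenvalues of a Ginibre pencil, up to a constant. -/
theorem exists_lintegral_pairSum (n : ℕ) :
    ∃ c : ℝ≥0∞, ∀ F : ℂ → ℂ → ℝ≥0∞, (Measurable fun x : ℂ × ℂ => F x.1 x.2) →
      ∫⁻ A, ∫⁻ B, pairSum F (pencil A B).roots ∂gaussMat (n + 2) (n + 2)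
          ∂gaussMat (n + 2) (n + 2) =
        c * ∫⁻ w, ENNReal.ofReal ((1 + Complex.normSq w)⁻¹) ^ 2 *
          ∫⁻ z, ENNReal.ofReal ((1 + Complex.normSq z)⁻¹) ^ 2 *
            (ENNReal.ofReal (1 - overlap w z ^ (n + 1)) * F w z) := by
  obtain ⟨c, hc⟩ := exists_lintegral_pairSum_aux n
  refine ⟨c * (n.factorial : ℝ≥0∞) ^ 2, fun F hF => ?_⟩
  have hf : (n.factorial : ℝ≥0∞) ^ 2 ≠ ∞ := ENNReal.pow_ne_top (ENNReal.natCast_ne_top _)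
  rw [hc F hF, mul_assoc]
  congr 1
  rw [← lintegral_const_mul' _ _ hf]
  refine lintegral_congr fun w => ?_
  have hinv : ∀ x : ℂ, ENNReal.ofReal ((1 + Complex.normSq x)⁻¹) ^ (n + 1) *
      ENNReal.ofReal (1 + Complex.normSq x) ^ (n + 1) = 1 := by
    intro x
    rw [← mul_pow, ← ENNReal.ofReal_mul (inv_nonneg.2 (one_add_normSq_pos x).le),
      inv_mul_cancel₀ (one_add_normSq_pos x).ne', ENNReal.ofReal_one, one_pow]
  rw [← lintegral_const_mul' _ _ (ENNReal.pow_ne_top ENNReal.ofReal_ne_top),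
    ← lintegral_const_mul' _ _ (ENNReal.pow_ne_top ENNReal.ofReal_ne_top),
    ← lintegral_const_mul' _ _ hf]
  refine lintegral_congr fun z => ?_
  rw [normSq_sub_mul_lintegral_eq, show n + 3 = (n + 1) + 2 by ring, pow_add _ (n + 1) 2,
    pow_add _ (n + 1) 2]
  calc _ = (ENNReal.ofReal ((1 + Complex.normSq w)⁻¹) ^ (n + 1) *
      ENNReal.ofReal (1 + Complex.normSq w) ^ (n + 1)) *
      (ENNReal.ofReal ((1 + Complex.normSq z)⁻¹) ^ (n + 1) *
      ENNReal.ofReal (1 + Complex.normSq z) ^ (n + 1)) *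
      ((n.factorial : ℝ≥0∞) ^ 2 * (ENNReal.ofReal ((1 + Complex.normSq w)⁻¹) ^ 2 *
        (ENNReal.ofReal ((1 + Complex.normSq z)⁻¹) ^ 2 *
          (ENNReal.ofReal (1 - overlap w z ^ (n + 1)) * F w z)))) := by ring
    _ = _ := by rw [hinv, hinv, one_mul, one_mul]

/-- The substitution `v = (1 + t)⁻¹`, with `t` the squared modulus: spherical area is uniform in
height. -/
theorem lintegral_one_add_inv {g : ℝ → ℝ≥0∞} :
    ∫⁻ t in Ioi (0 : ℝ), ENNReal.ofReal ((1 + t)⁻¹) ^ 2 * g (1 + t)⁻¹ = ∫⁻ v in Ioo (0 : ℝ) 1, g v := by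
  have himg : (fun t : ℝ => (1 + t)⁻¹) '' Ioi 0 = Ioo 0 1 := by
    ext v
    constructor
    · rintro ⟨t, ht, rfl⟩
      have ht : (0 : ℝ) < t := ht
      exact ⟨by positivity, inv_lt_one_of_one_lt₀ (by linarith)⟩
    · rintro ⟨h0, h1⟩
      refine ⟨v⁻¹ - 1, ?_, by simp⟩
      have := (one_lt_inv₀ h0).2 h1
      simp only [mem_Ioi]
      linarith
  have hinj : InjOn (fun t : ℝ => (1 + t)⁻¹) (Ioi 0) := fun a _ b _ h => by
    simpa using h
  rw [← himg, lintegral_image_eq_lintegral_abs_deriv_mul measurableSet_Ioi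
    (f' := fun t => -((1 + t)⁻¹) ^ 2) (fun t ht => ?_) hinj]
  · refine setLIntegral_congr_fun measurableSet_Ioi fun t ht => ?_
    have ht : (0 : ℝ) < t := ht
    simp only [abs_neg]
    rw [abs_of_nonneg (by positivity), ENNReal.ofReal_pow (by positivity)]
  · have ht : (0 : ℝ) < t := ht
    have h := ((hasDerivAt_id t).const_add 1).fun_inv (by simp only [id]; positivity)
    refine (h.congr_deriv ?_).hasDerivWithinAt
    simp only [id]
    rw [inv_pow, neg_div, one_div]

theorem volume_setOf_affine_eq_zero (a b : ℂ) (hb : b ≠ 0) :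
    volume {z : ℂ | b + a * z = 0} = 0 := by
  refine Set.Subsingleton.measure_zero (fun z hz z' hz' => ?_) _
  have hz : b + a * z = 0 := hz
  have hz' : b + a * z' = 0 := hz'
  have ha : a ≠ 0 := fun h => hb (by simpa [h] using hz)
  exact mul_left_cancel₀ ha (add_left_cancel (hz.trans hz'.symm))

theorem abs_det_restrictScalars_toSpanSingleton (d : ℂ) :
    |((ContinuousLinearMap.toSpanSingleton ℂ d).restrictScalars ℝ).det| = Complex.normSq d := by
  have h : ((ContinuousLinearMap.toSpanSingleton ℂ d).restrictScalars ℝ).det =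
      LinearMap.det (((ContinuousLinearMap.toSpanSingleton ℂ d : ℂ →L[ℂ] ℂ) :
        ℂ →ₗ[ℂ] ℂ).restrictScalars ℝ) := rfl
  rw [h, LinearMap.det_restrictScalars, Algebra.norm_complex_eq]
  simp [LinearMap.det_ring, abs_of_nonneg (Complex.normSq_nonneg d)]

/-- By rotational symmetry, the overlap with a fixed point is uniformly distributed. -/
theorem lintegral_comp_overlap (w : ℂ) {g : ℝ → ℝ≥0∞} (hg : Measurable g) :
    ∫⁻ z, ENNReal.ofReal ((1 + Complex.normSq z)⁻¹) ^ 2 * g (overlap w z) =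
      ENNReal.ofReal Real.pi * ∫⁻ v in Ioo (0 : ℝ) 1, g v := by
  set s : Set ℂ := {z | 1 + conj w * z ≠ 0} with hs
  -- This Möbius map is a rotation of the sphere taking `w` to `0`. It satisfies `(1 + |f z|²)⁻¹ =
  -- overlap w z`, and its domain and image each omit at most one point.
  set f : ℂ → ℂ := fun z => (z - w) / (1 + conj w * z) with hf
  have hww : conj w * w = (Complex.normSq w : ℂ) := by rw [mul_comm, Complex.mul_conj]
  have ha : (1 + Complex.normSq w : ℂ) ≠ 0 := by
    exact_mod_cast (one_add_normSq_pos w).ne'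
  have hms : MeasurableSet s := by
    have : IsOpen s := isOpen_ne_fun (by fun_prop) continuous_const
    exact this.measurableSet
  have hsu : s =ᵐ[volume] univ := by
    rw [ae_eq_univ]
    refine measure_mono_null (fun z hz => ?_) (volume_setOf_affine_eq_zero (conj w) 1 one_ne_zero)
    exact not_not.1 hz
  have hiu : f '' s =ᵐ[volume] univ := by
    rw [ae_eq_univ]
    refine measure_mono_null (fun m hm => ?_) (volume_setOf_affine_eq_zero (-conj w) 1 one_ne_zero)
    by_contra hne
    have hne : 1 + -conj w * m ≠ 0 := hne
    have h1 : 1 + conj w * ((m + w) / (1 + -conj w * m)) =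
        (1 + conj w * w) / (1 + -conj w * m) := by
      rw [eq_div_iff hne, add_mul, mul_assoc, div_mul_cancel₀ _ hne]
      ring
    have h2 : (m + w) / (1 + -conj w * m) - w = m * (1 + conj w * w) / (1 + -conj w * m) := by
      rw [eq_div_iff hne, sub_mul, div_mul_cancel₀ _ hne]
      ring
    refine hm ⟨(m + w) / (1 + -conj w * m), ?_, ?_⟩
    · change 1 + conj w * _ ≠ 0
      rw [h1, hww]
      exact div_ne_zero ha hne
    · simp only [hf]
      rw [h1, h2, hww, div_div_div_cancel_right₀ hne, mul_div_cancel_right₀ _ ha]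
  have hinj : InjOn f s := by
    intro z hz z' hz' h
    have hz : 1 + conj w * z ≠ 0 := hz
    have hz' : 1 + conj w * z' ≠ 0 := hz'
    simp only [hf] at h
    rw [div_eq_div_iff hz hz'] at h
    have : (1 + conj w * w) * (z - z') = 0 := by linear_combination h
    rw [hww] at this
    exact sub_eq_zero.1 ((mul_eq_zero.1 this).resolve_left ha)
  have hder : ∀ z ∈ s, HasFDerivWithinAt f ((ContinuousLinearMap.toSpanSingleton ℂ
      ((1 + Complex.normSq w : ℂ) / (1 + conj w * z) ^ 2)).restrictScalars ℝ) s z := by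
    intro z hz
    have hz : 1 + conj w * z ≠ 0 := hz
    have h1 : HasDerivAt (fun z => z - w) 1 z := (hasDerivAt_id z).sub_const w
    have h2 : HasDerivAt (fun z => 1 + conj w * z) (conj w) z := by
      simpa using ((hasDerivAt_id z).const_mul (conj w)).const_add 1
    have h3 := h1.fun_div h2 hz
    have h4 : HasDerivAt f ((1 + Complex.normSq w : ℂ) / (1 + conj w * z) ^ 2) z := by
      refine h3.congr_deriv ?_
      rw [← hww]
      congr 1
      ring
    exact (h4.hasFDerivAt.restrictScalars ℝ).hasFDerivWithinAt
  set γ : ℝ → ℝ≥0∞ := fun t => ENNReal.ofReal ((1 + t)⁻¹) ^ 2 * g (1 + t)⁻¹ with hγ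
  have hγm : Measurable γ := by fun_prop
  have key := lintegral_image_eq_lintegral_abs_det_fderiv_mul volume hms hder hinj
    (fun m => γ (Complex.normSq m))
  rw [setLIntegral_congr hiu, setLIntegral_univ, lintegral_normSq hγm, lintegral_one_add_inv] at key
  rw [key, ← setLIntegral_univ, ← setLIntegral_congr hsu]
  refine setLIntegral_congr_fun hms fun z hz => ?_
  have hz : 1 + conj w * z ≠ 0 := hz
  have hN : Complex.normSq (1 + conj w * z) ≠ 0 := fun h => hz (Complex.normSq_eq_zero.1 h)
  have hb := one_add_normSq_pos z
  have ha' := one_add_normSq_pos w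
  have hov : (1 + Complex.normSq (f z))⁻¹ = overlap w z := by
    have h1 := normSq_sub_add_normSq_one_add w z
    rw [mul_comm z] at h1
    simp only [hf, Complex.normSq_div]
    rw [overlap, mul_comm z, ← h1]
    generalize Complex.normSq (1 + conj w * z) = N at hN ⊢
    rw [one_add_div hN, inv_div, add_comm]
  simp only [hγ, hov]
  rw [abs_det_restrictScalars_toSpanSingleton, ← mul_assoc]
  congr 1
  have hn : Complex.normSq (1 + Complex.normSq w : ℂ) = (1 + Complex.normSq w) ^ 2 := by
    rw [show (1 + Complex.normSq w : ℂ) = ((1 + Complex.normSq w : ℝ) : ℂ) by push_cast; rfl,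
      Complex.normSq_ofReal, sq]
  rw [Complex.normSq_div, map_pow, hn, ← ENNReal.ofReal_pow (overlap_nonneg w z),
    ← ENNReal.ofReal_pow (by positivity), ← ENNReal.ofReal_mul (by positivity), overlap,
    mul_comm z]
  congr 1
  field_simp

/-- The two-point function of the eigenvalues of a Ginibre pencil, up to a constant, for functions
of the distance of the corresponding points of the sphere. -/
theorem exists_lintegral_pairSum_overlap (n : ℕ) :
    ∃ c : ℝ≥0∞, ∀ h : ℝ → ℝ≥0∞, Measurable h →
      ∫⁻ A, ∫⁻ B, pairSum (fun w z => h (overlap w z)) (pencil A B).roots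
          ∂gaussMat (n + 2) (n + 2) ∂gaussMat (n + 2) (n + 2) =
        c * ∫⁻ v in Ioo (0 : ℝ) 1, ENNReal.ofReal (1 - v ^ (n + 1)) * h v := by
  obtain ⟨c, hc⟩ := exists_lintegral_pairSum n
  refine ⟨c * ((∫⁻ w : ℂ, ENNReal.ofReal ((1 + Complex.normSq w)⁻¹) ^ 2) *
    ENNReal.ofReal Real.pi), fun h hh => ?_⟩
  have hnq : Measurable Complex.normSq := Complex.continuous_normSq.measurable
  rw [hc _ (hh.comp measurable_overlap), mul_assoc, mul_assoc,
    ← lintegral_mul_const _ (by fun_prop)]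
  congr 1
  refine lintegral_congr fun w => ?_
  rw [lintegral_comp_overlap w (g := fun v => ENNReal.ofReal (1 - v ^ (n + 1)) * h v)
    (by fun_prop)]

end Overlap
end SphericalEnsemble
end

noncomputable section
namespace SphericalEnsemble
open MeasureTheory ProbabilityTheory Set Filter Polynomial
open scoped ENNReal Topology ComplexConjugate

/-! ### Passing from pencils to eigenvalues, and the normalizing constant. -/

section Normalization

/-- In the direction of the identity matrix, `det (A + t)` is the characteristic polynomial of `-A`
at `t`, with finitely many zeros. -/
theorem ae_det_ne_zero (n : ℕ) :
    ∀ᵐ A : Fin n → Fin n → ℂ, (Matrix.of A).det ≠ 0 := by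
  have hm : MeasurableSet {A : Fin n → Fin n → ℂ | (Matrix.of A).det ≠ 0} := by
    have hc : Continuous fun A : Fin n → Fin n → ℂ => (Matrix.of A).det :=
      Continuous.matrix_det continuous_id
    exact (isOpen_ne_fun hc continuous_const).measurableSet
  let L : ℂ →ₗ[ℝ] (Fin n → Fin n → ℂ) :=
    { toFun := fun t => (t • (1 : Matrix (Fin n) (Fin n) ℂ) : Matrix (Fin n) (Fin n) ℂ)
      map_add' := fun s t => add_smul s t (1 : Matrix (Fin n) (Fin n) ℂ)
      map_smul' := fun c t => smul_assoc c t (1 : Matrix (Fin n) (Fin n) ℂ) }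
  refine ae_mem_of_ae_add_linearMap_mem L volume volume hm fun A => ?_
  have hfin : {t : ℂ | (-Matrix.of A).charpoly.eval t = 0}.Finite := by
    refine ((-Matrix.of A).charpoly.roots.toFinset.finite_toSet).subset fun t ht => ?_
    simpa [mem_roots (Matrix.charpoly_monic _).ne_zero] using ht
  refine measure_mono_null (fun t ht => ?_) (hfin.measure_zero volume)
  have ht : (Matrix.of (A + L t)).det = 0 := not_not.1 ht
  change eval t _ = 0
  rw [Matrix.eval_charpoly, ← ht]
  congr 1
  ext i j
  have hL : L t i j = t * (1 : Matrix (Fin n) (Fin n) ℂ) i j := rfl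
  simp [hL, Matrix.scalar_apply, Matrix.diagonal_apply, Matrix.one_apply, add_comm]

theorem pencil_eq_mul_charpoly {n : ℕ} {A B : Fin n → Fin n → ℂ}
    (hA : (Matrix.of A).det ≠ 0) :
    pencil A B = C (Matrix.of A).det * ((Matrix.of A)⁻¹ * Matrix.of B).charpoly := by
  have h := pencil_mul (Matrix.of A) (1 : Matrix (Fin n) (Fin n) ℂ)
    ((Matrix.of A)⁻¹ * Matrix.of B : Matrix (Fin n) (Fin n) ℂ)
  have h1 : (Matrix.of A * Matrix.of (1 : Matrix (Fin n) (Fin n) ℂ) :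
      Matrix (Fin n) (Fin n) ℂ) = A := Matrix.mul_one (Matrix.of A)
  have h2 : (Matrix.of A * Matrix.of ((Matrix.of A)⁻¹ * Matrix.of B : Matrix (Fin n) (Fin n) ℂ) :
      Matrix (Fin n) (Fin n) ℂ) = B :=
    Matrix.mul_nonsing_inv_cancel_left (Matrix.of A) _ (isUnit_iff_ne_zero.2 hA)
  rw [h1, h2] at h
  rw [h]
  congr 1
  refine congrArg Matrix.det ?_
  ext1 i j
  rw [Matrix.of_apply, Matrix.charmatrix_apply]
  congr 1
  rw [Matrix.one_apply]
  by_cases hij : i = j <;> simp [hij]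

theorem roots_pencil {n : ℕ} {A B : Fin n → Fin n → ℂ} (hA : (Matrix.of A).det ≠ 0) :
    (pencil A B).roots = ((Matrix.of A)⁻¹ * Matrix.of B).charpoly.roots := by
  rw [pencil_eq_mul_charpoly hA, roots_C_mul _ hA]

theorem exists_roots_pencil {n : ℕ} {A : Fin n → Fin n → ℂ} (B : Fin n → Fin n → ℂ)
    (hA : (Matrix.of A).det ≠ 0) :
    ∃ t : Fin n → ℂ, (pencil A B).roots = (Finset.univ : Finset (Fin n)).val.map t := by
  rw [roots_pencil hA]
  exact exists_roots_eq _ (by rw [Matrix.charpoly_natDegree_eq_dim, Fintype.card_fin])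

theorem lintegral_one_sub_pow (n : ℕ) {a : ℝ} (h0 : 0 ≤ a) (h1 : a ≤ 1) :
    ∫⁻ v in Ioo (0 : ℝ) 1, ENNReal.ofReal (1 - v ^ (n + 1)) * (Ici a).indicator 1 v =
      ENNReal.ofReal ((1 - a) - (1 - a ^ (n + 2)) / (n + 2)) := by
  have hint : ∫ v in a..1, (1 - v ^ (n + 1)) = (1 - a) - (1 - a ^ (n + 2)) / (n + 2) := by
    rw [intervalIntegral.integral_sub (by simp) (by simp), integral_pow]
    simp
    ring
  rw [← hint, intervalIntegral.integral_of_le h1, ofReal_integral_eq_lintegral_ofReal]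
  · have : ∀ v : ℝ, ENNReal.ofReal (1 - v ^ (n + 1)) * (Ici a).indicator 1 v =
        (Ici a).indicator (fun v => ENNReal.ofReal (1 - v ^ (n + 1))) v := by
      intro v
      by_cases hv : v ∈ Ici a <;> simp [hv]
    simp only [this]
    rw [lintegral_indicator measurableSet_Ici, Measure.restrict_restrict measurableSet_Ici]
    refine setLIntegral_congr ?_
    have e1 : (Ici a ∩ Ioo 0 1 : Set ℝ) =ᵐ[volume] (Ioi a ∩ Ioc 0 1 : Set ℝ) :=
      Ioi_ae_eq_Ici.symm.inter Ioo_ae_eq_Ioc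
    refine e1.trans (Eq.eventuallyEq ?_)
    rw [show (Ioi a ∩ Ioc 0 1 : Set ℝ) = Ioc a 1 by
      ext v
      simp only [mem_inter_iff, mem_Ioi, mem_Ioc]
      constructor
      · rintro ⟨h, -, h'⟩
        exact ⟨h, h'⟩
      · rintro ⟨h, h'⟩
        exact ⟨h, h0.trans_lt h, h'⟩]
  · exact (by fun_prop : Continuous fun v : ℝ => 1 - v ^ (n + 1)).integrableOn_Ioc
  · filter_upwards [ae_restrict_mem measurableSet_Ioc] with v hv
    exact sub_nonneg.2 (pow_le_one₀ (h0.trans hv.1.le) hv.2)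

/-- The two-point function of the spherical ensemble. -/
theorem lintegral_pairSum_overlap (n : ℕ) {h : ℝ → ℝ≥0∞} (hh : Measurable h) :
    ∫⁻ A, ∫⁻ B, pairSum (fun w z => h (overlap w z)) (pencil A B).roots
        ∂gaussMat (n + 2) (n + 2) ∂gaussMat (n + 2) (n + 2) =
      ((n + 2 : ℕ) : ℝ≥0∞) ^ 2 *
        ∫⁻ v in Ioo (0 : ℝ) 1, ENNReal.ofReal (1 - v ^ (n + 1)) * h v := by
  obtain ⟨c, hc⟩ := exists_lintegral_pairSum_overlap n
  suffices hcN : c = ((n + 2 : ℕ) : ℝ≥0∞) ^ 2 by rw [hc h hh, hcN]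
  -- Testing on the constant `1` counts all ordered pairs: with `N = n + 2` this reads `N (N - 1) =
  -- c (N - 1) / N`.
  have h1 := hc 1 measurable_one
  have hn : (0 : ℝ) < n + 2 := by positivity
  have hl : ∫⁻ A, ∫⁻ B, pairSum (fun w z => (1 : ℝ → ℝ≥0∞) (overlap w z)) (pencil A B).roots
        ∂gaussMat (n + 2) (n + 2) ∂gaussMat (n + 2) (n + 2) = (((n + 2) * (n + 1) : ℕ) : ℝ≥0∞) := by
    have : ∀ᵐ A ∂gaussMat (n + 2) (n + 2), ∫⁻ B, pairSum (fun w z => (1 : ℝ → ℝ≥0∞) (overlap w z))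
        (pencil A B).roots ∂gaussMat (n + 2) (n + 2) = (((n + 2) * (n + 1) : ℕ) : ℝ≥0∞) := by
      filter_upwards [(gaussMat_absolutelyContinuous _ _).ae_le (ae_det_ne_zero (n + 2))] with A hA
      have hp : ∀ B, pairSum (fun w z => (1 : ℝ → ℝ≥0∞) (overlap w z)) (pencil A B).roots =
          (((n + 2) * (n + 1) : ℕ) : ℝ≥0∞) := by
        intro B
        obtain ⟨t, ht⟩ := exists_roots_pencil B hA
        rw [ht, pairSum_map_univ]
        simp only [Pi.one_apply, Finset.sum_const, Finset.offDiag_card, Finset.card_univ,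
          Fintype.card_fin, nsmul_eq_mul, mul_one]
        congr 1
        rw [← Nat.mul_sub_one]
        rfl
      simp only [hp, lintegral_const, measure_univ, mul_one]
    rw [lintegral_congr_ae this]
    simp
  have hr : ∫⁻ v in Ioo (0 : ℝ) 1, ENNReal.ofReal (1 - v ^ (n + 1)) * (1 : ℝ → ℝ≥0∞) v =
      ENNReal.ofReal ((n + 1) / (n + 2)) := by
    have h0 := lintegral_one_sub_pow n le_rfl zero_le_one
    rw [setLIntegral_congr_fun (g := fun v => ENNReal.ofReal (1 - v ^ (n + 1)) *
      (Ici (0 : ℝ)).indicator 1 v) measurableSet_Ioo fun v hv => by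
        simp [indicator_of_mem (show v ∈ Ici (0 : ℝ) from hv.1.le)], h0]
    congr 1
    field_simp
    simp
    ring
  rw [hl, hr] at h1
  have h2 := congrArg (· * ENNReal.ofReal ((n + 2) / (n + 1))) h1
  simp only [mul_assoc] at h2
  rw [← ENNReal.ofReal_mul (by positivity), show ((n : ℝ) + 1) / (n + 2) * ((n + 2) / (n + 1)) = 1 by
    field_simp, ENNReal.ofReal_one, mul_one] at h2
  rw [← h2, ← ENNReal.ofReal_natCast, ← ENNReal.ofReal_natCast, ← ENNReal.ofReal_mul (by positivity),
    ← ENNReal.ofReal_pow (by positivity)]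
  congr 1
  push_cast
  field_simp

end Normalization

/-! ### Both distances as functions of the overlap. -/

section Geometry

/-- The overlap is the squared cosine of the half angle, so this is the double angle formula. -/
theorem inner_stereoInv (w z : ℂ) :
    inner ℝ (stereoInv w : EuclideanSpace ℝ (Fin 3)) (stereoInv z) = 2 * overlap w z - 1 := by
  have ha := (one_add_normSq_pos w).ne'
  have hb := (one_add_normSq_pos z).ne'
  simp only [stereoInv, PiLp.inner_apply, Fin.sum_univ_three, overlap]
  simp only [RCLike.inner_apply, conj_trivial, Matrix.cons_val_zero, Matrix.cons_val_one,
    Matrix.cons_val]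
  field_simp
  simp only [Complex.normSq_apply, Complex.add_re, Complex.add_im,
    Complex.mul_re, Complex.mul_im, Complex.conj_re, Complex.conj_im, Complex.one_re,
    Complex.one_im]
  ring

theorem norm_stereoInv (w : ℂ) : ‖(stereoInv w : EuclideanSpace ℝ (Fin 3))‖ = 1 :=
  mem_sphere_zero_iff_norm.1 (stereoInv w).2

theorem dist_stereoInv (w z : ℂ) :
    dist (stereoInv w) (stereoInv z) = 2 * Real.sqrt (1 - overlap w z) := by
  have h : ‖(stereoInv w : EuclideanSpace ℝ (Fin 3)) - stereoInv z‖ ^ 2 =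
      2 ^ 2 * (1 - overlap w z) := by
    rw [norm_sub_sq_real, norm_stereoInv, norm_stereoInv, inner_stereoInv]
    ring
  rw [Subtype.dist_eq, dist_eq_norm, ← Real.sqrt_sq (norm_nonneg _), h,
    Real.sqrt_mul (by positivity), Real.sqrt_sq (by positivity)]

theorem geodesicDist_stereoInv (w z : ℂ) :
    geodesicDist (stereoInv w) (stereoInv z) = Real.arccos (2 * overlap w z - 1) := by
  rw [geodesicDist, InnerProductGeometry.angle, norm_stereoInv, norm_stereoInv, inner_stereoInv]
  simp

end Geometry
end SphericalEnsemble
end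

noncomputable section
namespace SphericalEnsemble
open MeasureTheory ProbabilityTheory Set Filter
open scoped ENNReal Topology

/-! ### The exact expectation of `G` for finite `N`. -/

section Expectation

variable {Ω : Type*} [MeasurableSpace Ω] {P : Measure Ω} [IsProbabilityMeasure P]

/-- The spherical ensemble in terms of the characteristic polynomial of a Ginibre pencil. -/
theorem IsSphericalEnsemble.exists_pencil {N : ℕ} {x : Fin N → Ω → S2}
    (hx : IsSphericalEnsemble P x) :
    ∃ Y : Ω → (Fin N → Fin N → ℂ) × (Fin N → Fin N → ℂ),
      HasLaw Y ((gaussMat N N).prod (gaussMat N N)) P ∧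
      ∀ᵐ ω ∂P, (Finset.univ : Finset (Fin N)).val.map (fun i => x i ω) =
        (pencil (Y ω).1 (Y ω).2).roots.map stereoInv := by
  obtain ⟨A, B, hAB, h⟩ := hx
  have hlaw := hAB.hasLaw
  refine ⟨_, hlaw, ?_⟩
  have hdet : ∀ᵐ y ∂(gaussMat N N).prod (gaussMat N N), (Matrix.of y.1).det ≠ 0 :=
    (measurePreserving_fst (μ := gaussMat N N) (ν := gaussMat N N)).quasiMeasurePreserving.ae
      ((gaussMat_absolutelyContinuous N N).ae_le (ae_det_ne_zero N))
  have hdet' : ∀ᵐ ω ∂P, (A ω).det ≠ 0 := by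
    rw [← hlaw.map_eq] at hdet
    exact ae_of_ae_map hlaw.aemeasurable hdet
  filter_upwards [h, hdet'] with ω h1 h2
  rw [h1]
  congr 1
  exact (roots_pencil (A := fun i j => A ω i j) (B := fun i j => B ω i j) h2).symm

variable {δ : S2 → S2 → ℝ} {d : ℝ → ℝ}

/-- The contribution to the pair correlation statistic of two points of given overlap. -/
def pairWeight (d : ℝ → ℝ) (s : ℝ) (N : ℕ) (v : ℝ) : ℝ≥0∞ :=
  (Icc 0 s).indicator 1 (d v * Real.sqrt N)

theorem measurable_pairWeight (hd : Measurable d) (s : ℝ) (N : ℕ) :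
    Measurable (pairWeight d s N) :=
  (measurable_one.indicator measurableSet_Icc).comp (hd.mul_const _)

theorem F_nonneg (s : ℝ) (N : ℕ) (p q : S2) : 0 ≤ F δ s N p q :=
  indicator_nonneg (fun _ _ => zero_le_one) _

theorem G_nonneg (s : ℝ) {N : ℕ} (x : Fin N → S2) : 0 ≤ G δ s x :=
  mul_nonneg (by positivity) (Finset.sum_nonneg fun _ _ => F_nonneg _ _ _ _)

theorem ofReal_F_stereoInv (hδ : ∀ w z, δ (stereoInv w) (stereoInv z) = d (overlap w z)) (s : ℝ)
    (N : ℕ) (w z : ℂ) :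
    ENNReal.ofReal (F δ s N (stereoInv w) (stereoInv z)) = pairWeight d s N (overlap w z) := by
  rw [F, pairWeight, hδ]
  by_cases h : d (overlap w z) * Real.sqrt N ∈ Icc 0 s <;> simp [h]

theorem ofReal_G (s : ℝ) {N : ℕ} (x : Fin N → S2) :
    ENNReal.ofReal (G δ s x) = ENNReal.ofReal (1 / N) *
      pairSum (fun p q => ENNReal.ofReal (F δ s N p q))
        ((Finset.univ : Finset (Fin N)).val.map x) := by
  rw [G, ENNReal.ofReal_mul (by positivity), pairSum_map_univ,
    ENNReal.ofReal_sum_of_nonneg fun _ _ => F_nonneg _ _ _ _]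

theorem measurable_pairSum_pencil (hd : Measurable d) (s : ℝ) (N : ℕ) :
    Measurable fun y : (Fin N → Fin N → ℂ) × (Fin N → Fin N → ℂ) =>
      ENNReal.ofReal (1 / N) *
        pairSum (fun w z => pairWeight d s N (overlap w z)) (pencil y.1 y.2).roots :=
  ((measurable_pairSum ((measurable_pairWeight hd s N).comp measurable_overlap)).comp
    measurable_pencil).const_mul _

theorem IsSphericalEnsemble.ofReal_G_ae_eq {N : ℕ} {x : Fin N → Ω → S2}
    (hx : IsSphericalEnsemble P x)
    (hδ : ∀ w z, δ (stereoInv w) (stereoInv z) = d (overlap w z)) (s : ℝ) :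
    ∃ Y : Ω → (Fin N → Fin N → ℂ) × (Fin N → Fin N → ℂ),
      HasLaw Y ((gaussMat N N).prod (gaussMat N N)) P ∧
      (fun ω => ENNReal.ofReal (G δ s fun i => x i ω)) =ᵐ[P] fun ω => ENNReal.ofReal (1 / N) *
        pairSum (fun w z => pairWeight d s N (overlap w z)) (pencil (Y ω).1 (Y ω).2).roots := by
  obtain ⟨Y, hY, h⟩ := hx.exists_pencil
  refine ⟨Y, hY, ?_⟩
  filter_upwards [h] with ω hω
  rw [ofReal_G, hω, pairSum_map]
  simp only [ofReal_F_stereoInv hδ]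

/-- The labelled points need not be measurable. `G` is symmetric in them, so almost surely it is a
function of the multiset of roots, which is a measurable function of the Gaussian matrices. -/
theorem IsSphericalEnsemble.aestronglyMeasurable_G {N : ℕ} {x : Fin N → Ω → S2}
    (hx : IsSphericalEnsemble P x) (hd : Measurable d)
    (hδ : ∀ w z, δ (stereoInv w) (stereoInv z) = d (overlap w z)) (s : ℝ) :
    AEStronglyMeasurable (fun ω => G δ s fun i => x i ω) P := by
  obtain ⟨Y, hY, h⟩ := hx.ofReal_G_ae_eq hδ s
  have h1 := ((measurable_pairSum_pencil hd s N).comp_aemeasurable hY.aemeasurable).congr h.symm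
  have h2 := h1.ennreal_toReal
  simp only [ENNReal.toReal_ofReal (G_nonneg _ _)] at h2
  exact h2.aestronglyMeasurable

theorem IsSphericalEnsemble.integrable_G {N : ℕ} {x : Fin N → Ω → S2}
    (hx : IsSphericalEnsemble P x) (hd : Measurable d)
    (hδ : ∀ w z, δ (stereoInv w) (stereoInv z) = d (overlap w z)) (s : ℝ) :
    Integrable (fun ω => G δ s fun i => x i ω) P := by
  refine Integrable.of_bound (hx.aestronglyMeasurable_G hd hδ s)
    (1 / N * ∑ k ∈ (Finset.univ : Finset (Fin N)).offDiag, 1) (ae_of_all _ fun ω => ?_)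
  rw [Real.norm_of_nonneg (G_nonneg _ _)]
  refine mul_le_mul_of_nonneg_left (Finset.sum_le_sum fun k _ => ?_) (by positivity)
  exact indicator_le_self' (fun _ _ => zero_le_one) _

/-- The expected pair correlation statistic, if two points contribute to it exactly when they
lie in a spherical cap of relative area `r`. -/
theorem IsSphericalEnsemble.integral_G {n : ℕ} {x : Fin (n + 2) → Ω → S2}
    (hx : IsSphericalEnsemble P x) (hd : Measurable d)
    (hδ : ∀ w z, δ (stereoInv w) (stereoInv z) = d (overlap w z)) {s r : ℝ} (hr0 : 0 ≤ r)
    (hr1 : r ≤ 1) (hr : ∀ v ∈ Ioo (0 : ℝ) 1, d v * Real.sqrt (n + 2 : ℕ) ∈ Icc 0 s ↔ 1 - r ≤ v) :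
    ∫ ω, G δ s (fun i => x i ω) ∂P =
      (n + 2 : ℕ) * r - 1 + (1 - r) ^ (n + 2) := by
  obtain ⟨Y, hY, h⟩ := hx.ofReal_G_ae_eq hδ s
  have hm := measurable_pairSum_pencil hd s (n + 2)
  have hm2 : Measurable fun y : (Fin (n + 2) → Fin (n + 2) → ℂ) × (Fin (n + 2) → Fin (n + 2) → ℂ) =>
      pairSum (fun w z => pairWeight d s (n + 2) (overlap w z)) (pencil y.1 y.2).roots :=
    (measurable_pairSum ((measurable_pairWeight hd s _).comp measurable_overlap)).comp
      measurable_pencil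
  have hN : (0 : ℝ) < (n + 2 : ℕ) := by positivity
  have hweight : ∫⁻ v in Ioo (0 : ℝ) 1,
      ENNReal.ofReal (1 - v ^ (n + 1)) * pairWeight d s (n + 2) v =
        ENNReal.ofReal (r - (1 - (1 - r) ^ (n + 2)) / (n + 2)) := by
    have h0 := lintegral_one_sub_pow n (sub_nonneg.2 hr1) (sub_le_self 1 hr0)
    rw [sub_sub_cancel] at h0
    rw [← h0]
    refine setLIntegral_congr_fun measurableSet_Ioo fun v hv => ?_
    simp only [pairWeight]
    congr 1
    by_cases hv' : d v * Real.sqrt (n + 2 : ℕ) ∈ Icc 0 s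
    · rw [indicator_of_mem hv', indicator_of_mem (show v ∈ Ici (1 - r) from (hr v hv).1 hv')]
      rfl
    · rw [indicator_of_notMem hv', indicator_of_notMem (show v ∉ Ici (1 - r) from fun h' => hv' ((hr v hv).2 h'))]
  -- By Bernoulli's inequality the claimed value is nonnegative, so it survives the passage through
  -- `ℝ≥0∞`.
  have hpos : 0 ≤ (n + 2 : ℕ) * r - 1 + (1 - r) ^ (n + 2) := by
    have := one_add_mul_le_pow (a := -r) (by linarith) (n + 2)
    rw [← sub_eq_add_neg] at this
    linarith
  rw [integral_eq_lintegral_of_nonneg_ae (ae_of_all _ fun ω => G_nonneg _ _)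
    (hx.aestronglyMeasurable_G hd hδ s), lintegral_congr_ae h,
    hY.lintegral_comp (f := fun y => ENNReal.ofReal (1 / (n + 2 : ℕ)) *
      pairSum (fun w z => pairWeight d s (n + 2) (overlap w z)) (pencil y.1 y.2).roots)
      hm.aemeasurable, lintegral_const_mul _ hm2, lintegral_prod _ hm2.aemeasurable,
    lintegral_pairSum_overlap n (measurable_pairWeight hd s _), hweight,
    ← ENNReal.ofReal_natCast, ← ENNReal.ofReal_pow hN.le, ← ENNReal.ofReal_mul (by positivity),
    ← ENNReal.ofReal_mul (by positivity), ENNReal.toReal_ofReal]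
  · push_cast
    field_simp
    ring
  · refine hpos.trans_eq ?_
    push_cast
    field_simp
    ring

end Expectation

/-! ### The limit for both distances, and its asymptotics. -/

section Limit

theorem tendsto_of_tendsto_mul {r : ℕ → ℝ} {a : ℝ}
    (hr : Tendsto (fun N : ℕ => N * r N) atTop (𝓝 a)) :
    Tendsto (fun N : ℕ => N * r N - 1 + (1 - r N) ^ N) atTop (𝓝 (a - 1 + Real.exp (-a))) := by
  refine (hr.sub_const 1).add ?_
  have h := Real.tendsto_one_add_pow_exp_of_tendsto (g := fun N => -r N) (t := -a)
    (by simpa only [mul_neg] using hr.neg)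
  simpa only [← sub_eq_add_neg] using h

/-- The limit of the expected pair correlation statistics, for distances that are asymptotic to
the chordal distance. -/
theorem tendsto_integral_G {Ω : ℕ → Type*} [∀ N, MeasurableSpace (Ω N)]
    {P : ∀ N, Measure (Ω N)} [∀ N, IsProbabilityMeasure (P N)] {x : ∀ N, Fin N → Ω N → S2}
    (hx : ∀ N, IsSphericalEnsemble (P N) (x N)) {δ : S2 → S2 → ℝ} {d : ℝ → ℝ} (hd : Measurable d)
    (hδ : ∀ w z, δ (stereoInv w) (stereoInv z) = d (overlap w z)) {s a : ℝ} {r : ℕ → ℝ}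
    (hr : ∀ᶠ N : ℕ in atTop, 0 ≤ r N ∧ r N ≤ 1 ∧
      ∀ v ∈ Ioo (0 : ℝ) 1, d v * Real.sqrt N ∈ Icc 0 s ↔ 1 - r N ≤ v)
    (ha : Tendsto (fun N : ℕ => N * r N) atTop (𝓝 a)) :
    Tendsto (fun N => ∫ ω, G δ s (fun i => x N i ω) ∂P N) atTop (𝓝 (a - 1 + Real.exp (-a))) := by
  refine (tendsto_of_tendsto_mul ha).congr' ?_
  filter_upwards [hr, eventually_ge_atTop 2] with N ⟨h0, h1, h2⟩ hN
  obtain ⟨n, rfl⟩ := Nat.exists_eq_add_of_le' hN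
  exact ((hx (n + 2)).integral_G hd hδ h0 h1 h2).symm

/-- Squaring `2 √(1 - v) √N ≤ s` gives `1 - v ≤ s² / (4 N)`; this bound is at most one as soon as `N
≥ s²`. -/
theorem chordal_radius {s : ℝ} (hs : 0 ≤ s) :
    (∀ᶠ N : ℕ in atTop, 0 ≤ s ^ 2 / (4 * N) ∧ s ^ 2 / (4 * N) ≤ 1 ∧ ∀ v ∈ Ioo (0 : ℝ) 1,
      2 * Real.sqrt (1 - v) * Real.sqrt N ∈ Icc 0 s ↔ 1 - s ^ 2 / (4 * N) ≤ v) ∧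
    Tendsto (fun N : ℕ => N * (s ^ 2 / (4 * N))) atTop (𝓝 (s ^ 2 / 4)) := by
  constructor
  · filter_upwards [eventually_gt_atTop 0, tendsto_natCast_atTop_atTop.eventually_ge_atTop (s ^ 2)]
      with N hN hNs
    have hN' : (0 : ℝ) < N := by exact_mod_cast hN
    refine ⟨by positivity, by rw [div_le_one (by positivity)]; linarith, fun v hv => ?_⟩
    have hv1 : 0 ≤ 1 - v := by linarith [hv.2]
    have h1 : 0 ≤ 2 * Real.sqrt (1 - v) * Real.sqrt N := by positivity
    have h2 : (2 * Real.sqrt (1 - v) * Real.sqrt N) ^ 2 = 4 * N * (1 - v) := by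
      rw [mul_pow, mul_pow, Real.sq_sqrt hv1, Real.sq_sqrt hN'.le]
      ring
    rw [mem_Icc, and_iff_right h1, ← pow_le_pow_iff_left₀ h1 hs two_ne_zero, h2, sub_le_comm,
      le_div_iff₀ (by positivity), mul_comm]
  · refine tendsto_const_nhds.congr' ?_
    filter_upwards [eventually_gt_atTop 0] with N hN
    have hN' : (N : ℝ) ≠ 0 := by exact_mod_cast hN.ne'
    field_simp

theorem arccos_le_iff_cos_le {x θ : ℝ} (hx0 : -1 ≤ x) (hx1 : x ≤ 1) (h0 : 0 ≤ θ)
    (hpi : θ ≤ Real.pi) : Real.arccos x ≤ θ ↔ Real.cos θ ≤ x := by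
  conv_rhs => rw [← Real.cos_arccos hx0 hx1]
  exact (Real.strictAntiOn_cos.le_iff_ge ⟨h0, hpi⟩
    ⟨Real.arccos_nonneg x, Real.arccos_le_pi x⟩).symm

/-- With `θ = s / √N`, the condition `arccos (2 v - 1) ≤ θ` means `1 - v ≤ (1 - cos θ) / 2`, and `1
- cos θ` is asymptotic to `θ² / 2`. -/
theorem geodesic_radius {s : ℝ} (hs : 0 ≤ s) :
    (∀ᶠ N : ℕ in atTop, 0 ≤ (1 - Real.cos (s / Real.sqrt N)) / 2 ∧
      (1 - Real.cos (s / Real.sqrt N)) / 2 ≤ 1 ∧ ∀ v ∈ Ioo (0 : ℝ) 1,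
      Real.arccos (2 * v - 1) * Real.sqrt N ∈ Icc 0 s ↔
        1 - (1 - Real.cos (s / Real.sqrt N)) / 2 ≤ v) ∧
    Tendsto (fun N : ℕ => N * ((1 - Real.cos (s / Real.sqrt N)) / 2)) atTop (𝓝 (s ^ 2 / 4)) := by
  have hsmall : ∀ᶠ N : ℕ in atTop, 0 < (N : ℝ) ∧ s / Real.sqrt N ≤ 1 := by
    filter_upwards [eventually_gt_atTop 0,
      tendsto_natCast_atTop_atTop.eventually_ge_atTop (s ^ 2)] with N hN hNs
    have hN' : (0 : ℝ) < N := by exact_mod_cast hN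
    exact ⟨hN', (div_le_one (Real.sqrt_pos.2 hN')).2 (Real.le_sqrt_of_sq_le hNs)⟩
  constructor
  · filter_upwards [hsmall] with N ⟨hN, hθ⟩
    have hsq := Real.sqrt_pos.2 hN
    refine ⟨by linarith [Real.cos_le_one (s / Real.sqrt N)],
      by linarith [Real.neg_one_le_cos (s / Real.sqrt N)], fun v hv => ?_⟩
    rw [mem_Icc, and_iff_right (mul_nonneg (Real.arccos_nonneg _) hsq.le), ← le_div_iff₀ hsq,
      arccos_le_iff_cos_le (by linarith [hv.1]) (by linarith [hv.2]) (by positivity)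
        (hθ.trans (by linarith [Real.pi_gt_three]))]
    constructor <;> intro h <;> linarith
  · rw [tendsto_iff_norm_sub_tendsto_zero]
    -- `Real.cos_bound` has error `(5 / 96) θ⁴` with `θ⁴ = s⁴ / N²`; the factor `N / 2` turns this
    -- into `(5 / 192) s⁴ / N`.
    have hlim : Tendsto (fun N : ℕ => s ^ 4 * (5 / 192) * (N : ℝ)⁻¹) atTop (𝓝 0) := by
      have h := (tendsto_inv_atTop_nhds_zero_nat (𝕜 := ℝ)).const_mul (s ^ 4 * (5 / 192))
      rwa [mul_zero] at h
    refine squeeze_zero' (Eventually.of_forall fun _ => norm_nonneg _) ?_ hlim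
    filter_upwards [hsmall] with N ⟨hN, hθ⟩
    have h0 : 0 ≤ s / Real.sqrt N := by positivity
    have hb := Real.cos_bound (x := s / Real.sqrt N) (by rwa [abs_of_nonneg h0])
    have h2 : (s / Real.sqrt N) ^ 2 = s ^ 2 / N := by rw [div_pow, Real.sq_sqrt hN.le]
    have h4 : (s / Real.sqrt N) ^ 4 = s ^ 4 / N ^ 2 := by
      rw [show (4 : ℕ) = 2 * 2 by norm_num, pow_mul, h2, div_pow, ← pow_mul]
    rw [abs_of_nonneg h0, h2, h4] at hb
    have he : (N : ℝ) * ((1 - Real.cos (s / Real.sqrt N)) / 2) - s ^ 2 / 4 =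
        -(N / 2) * (Real.cos (s / Real.sqrt N) - (1 - s ^ 2 / N / 2)) := by
      field_simp
      ring
    rw [he, norm_mul, norm_neg, Real.norm_of_nonneg (by positivity), Real.norm_eq_abs]
    refine (mul_le_mul_of_nonneg_left hb (by positivity)).trans_eq ?_
    field_simp
    ring

/-- The terms removed are the Taylor polynomial of degree two of the exponential at `-s² / 4`, so
the remainder is cubic in `s²`. -/
theorem isBigO_nhdsWithin_zero :
    (fun s : ℝ => s ^ 2 / 4 - 1 + Real.exp (-s ^ 2 / 4) - s ^ 4 / 32) =O[𝓝[Ici 0] 0]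
      fun s : ℝ => s ^ 6 := by
  refine Asymptotics.IsBigO.of_bound 1 (mem_nhdsWithin_of_mem_nhds ?_)
  filter_upwards [Metric.ball_mem_nhds (0 : ℝ) one_pos] with s hs
  have hs1 : |s| < 1 := by simpa using hs
  have hs2 : s ^ 2 < 1 := by
    rw [← sq_abs]
    exact pow_lt_one₀ (abs_nonneg s) hs1 two_ne_zero
  have hx : |(-s ^ 2 / 4)| = s ^ 2 / 4 := by
    rw [abs_of_nonpos (by nlinarith [sq_nonneg s])]
    ring
  have h := Real.exp_bound (x := -s ^ 2 / 4) (by rw [hx]; linarith) (n := 3) (by norm_num)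
  rw [hx] at h
  simp only [Finset.sum_range_succ, Finset.sum_range_zero, Nat.factorial] at h
  rw [Real.norm_eq_abs, Real.norm_eq_abs, one_mul, abs_of_nonneg (by positivity : 0 ≤ s ^ 6)]
  have e : s ^ 2 / 4 - 1 + Real.exp (-s ^ 2 / 4) - s ^ 4 / 32 = Real.exp (-s ^ 2 / 4) -
      (0 + (-s ^ 2 / 4) ^ 0 / ((1 : ℕ) : ℝ) + (-s ^ 2 / 4) ^ 1 / (((0 + 1) * 1 : ℕ) : ℝ) +
        (-s ^ 2 / 4) ^ 2 / (((1 + 1) * ((0 + 1) * 1) : ℕ) : ℝ)) := by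
    push_cast
    ring
  rw [e]
  refine h.trans ?_
  have : 0 ≤ s ^ 6 := by positivity
  push_cast
  nlinarith

/-- Only the exponential remains, and `exp (s² / 4) ≥ 1 + s² / 4` bounds it by `4 / s²`. -/
theorem isBigO_atTop :
    (fun s : ℝ => s ^ 2 / 4 - 1 + Real.exp (-s ^ 2 / 4) - (s ^ 2 / 4 - 1)) =O[atTop]
      fun s : ℝ => s ^ (-2 : ℤ) := by
  refine Asymptotics.IsBigO.of_bound 4 ?_
  filter_upwards [eventually_gt_atTop (0 : ℝ)] with s hs
  rw [add_sub_cancel_left, Real.norm_of_nonneg (Real.exp_pos _).le,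
    Real.norm_of_nonneg (by positivity), zpow_neg, neg_div, Real.exp_neg, ← div_eq_mul_inv,
    inv_le_comm₀ (Real.exp_pos _) (by positivity)]
  rw [inv_div]
  have := Real.add_one_le_exp (s ^ 2 / 4)
  have h2 : s ^ (2 : ℤ) = s ^ 2 := by norm_cast
  rw [h2]
  linarith

end Limit
end SphericalEnsemble
end

theorem mainTheorem2 {Ω : ℕ → Type*} [∀ N, MeasurableSpace (Ω N)]
    (P : ∀ N, MeasureTheory.Measure (Ω N)) [∀ N, MeasureTheory.IsProbabilityMeasure (P N)]
    (x : ∀ N, Fin N → Ω N → SphericalEnsemble.S2)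
    (hx : ∀ N, SphericalEnsemble.IsSphericalEnsemble (P N) (x N))
    (δ : SphericalEnsemble.S2 → SphericalEnsemble.S2 → ℝ)
    (hδ : δ = dist ∨ δ = SphericalEnsemble.geodesicDist) :
    (∀ s : ℝ, 0 ≤ s → ∀ N,
      MeasureTheory.Integrable (fun ω => SphericalEnsemble.G δ s (fun i => x N i ω)) (P N)) ∧
    ∃ g : ℝ → ℝ,
      (∀ s : ℝ, 0 ≤ s →
        Filter.Tendsto (fun N => ∫ ω, SphericalEnsemble.G δ s (fun i => x N i ω) ∂(P N))
          Filter.atTop (nhds (g s))) ∧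
      (∀ s : ℝ, 0 ≤ s → g s = s ^ 2 / 4 - 1 + Real.exp (-s ^ 2 / 4)) ∧
      Asymptotics.IsBigO (nhdsWithin 0 (Set.Ici 0))
        (fun s : ℝ => g s - s ^ 4 / 32) (fun s : ℝ => s ^ 6) ∧
      Asymptotics.IsBigO Filter.atTop
        (fun s : ℝ => g s - (s ^ 2 / 4 - 1)) (fun s : ℝ => s ^ (-2 : ℤ)) := by
  have hdc : Measurable fun v : ℝ => 2 * Real.sqrt (1 - v) := by fun_prop
  have hdg : Measurable fun v : ℝ => Real.arccos (2 * v - 1) :=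
    Real.continuous_arccos.measurable.comp (by fun_prop)
  refine ⟨fun s _ N => ?_, fun s => s ^ 2 / 4 - 1 + Real.exp (-s ^ 2 / 4), fun s hs => ?_,
    fun s _ => rfl, SphericalEnsemble.isBigO_nhdsWithin_zero, SphericalEnsemble.isBigO_atTop⟩
  · rcases hδ with rfl | rfl
    · exact (hx N).integrable_G hdc SphericalEnsemble.dist_stereoInv s
    · exact (hx N).integrable_G hdg SphericalEnsemble.geodesicDist_stereoInv s
  · simp only [neg_div]
    rcases hδ with rfl | rfl
    · exact SphericalEnsemble.tendsto_integral_G hx hdc SphericalEnsemble.dist_stereoInv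
        (SphericalEnsemble.chordal_radius hs).1 (SphericalEnsemble.chordal_radius hs).2
    · exact SphericalEnsemble.tendsto_integral_G hx hdg SphericalEnsemble.geodesicDist_stereoInv
        (SphericalEnsemble.geodesic_radius hs).1 (SphericalEnsemble.geodesic_radius hs).2
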